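/- Let $d\ge 1$, let $\Omega\subset\mathbb R^d$ be a bounded domain (open, connected, non-empty), let $\alpha>0$ and $f,y_d\in L^2(\Omega)$. Put $$\mathcal M=\{A\in\mathbb R^{d\times d}:\ \xi^TA\xi\ge\alpha|\xi|^2\ \ \forall \xi\in\mathbb R^d\},\qquad \mathcal A=\{a\in L^\infty(\Omega;\mathbb R^{d\times d}):\ a(x)\in\mathcal M\text{ for a.a. }x\in\Omega\}.$$ For every $a\in\mathcal A$ there is a unique $y=y_a\in H^1_0(\Omega)$ (the state) with $$\int_\Omega a\nabla y\cdot\nabla v\,dx=\int_\Omega f v\,dx\qquad\forall v\in H^1_0(\Omega),$$ and we define $J(a)=\tfrac12\|y_a-y_d\|_{L^2(\Omega)}^2$. Fix $a\in\mathcal A$ with state $y$, and let $p\in H^1_0(\Omega)$ be the (unique) adjoint state, i.e. the solution of $$\int_\Omega a\nabla v\cdot\nabla p\,dx=\int_\Omega (y-y_d)v\,dx\qquad\forall v\in H^1_0(\Omega).$$ Let $\omega\subset\mathbb R^d$ be open and bounded with $0\in\omega$, and let $b\in\mathcal M$. For $x_0\in\Omega$ and $r>0$ put $a_r=a+\chi_{x_0+r\omega}(b-a)$.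 Let $$\dot H^1(\mathbb R^d)=\{z\in H^1_{\mathrm{loc}}(\mathbb R^d):\ \nabla z\in L^2(\mathbb R^d)\}/\mathbb R .$$ Then for almost every $x_0\in\Omega$ the following holds. With $\tilde a=\chi_\omega b+\chi_{\mathbb R^d\setminus\omega}\,a(x_0)$ there is a unique $Q\in\dot H^1(\mathbb R^d)$ such that $$\int_{\mathbb R^d}\tilde a\nabla v\cdot\nabla Q\,dx'+(b-a(x_0))\int_\omega\nabla v\,dx'\cdot\nabla p(x_0)=0\qquad\forall v\in\dot H^1(\mathbb R^d);$$ so $Q$ depends solely on $a(x_0)$, $b$, $\nabla p(x_0)$ and $\omega$. Moreover, the limit $$\delta J(a;b,x_0,\omega)=\lim_{r\searrow0}\frac{J(a_r)-J(a)}{r^d|\omega|}$$ exists, and $$\delta J(a;b,x_0,\omega)=-(b-a(x_0))\nabla y(x_0)\cdot\Big(\nabla p(x_0)+\frac1{|\omega|}\int_\omega\nabla Q\,dx'\Big).$$ -/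

import Mathlib

open MeasureTheory Filter Topology TopologicalSpace
open scoped ENNReal Distributions

noncomputable section

/-- Euclidean space `ℝ^d`. -/
abbrev E (d : ℕ) : Type := EuclideanSpace ℝ (Fin d)

/-- Real `d × d` matrices. -/
abbrev Mat (d : ℕ) : Type := Matrix (Fin d) (Fin d) ℝ

/-- The matrix-vector product `A ξ` in `ℝ^d`. -/
def act {d : ℕ} (A : Mat d) (ξ : E d) : E d := Matrix.toEuclideanLin A ξ

/-- The set `𝓜` of matrices with `ξᵀ A ξ ≥ α |ξ|²` for all `ξ`. -/
def ellipticMatrices (d : ℕ) (α : ℝ) : Set (Mat d) :=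
  {A | ∀ ξ : E d, α * ‖ξ‖ ^ 2 ≤ inner ℝ ξ (act A ξ)}

/-- The set `𝓐` of coefficients `a ∈ L^∞(Ω; ℝ^{d×d})` with `a(x) ∈ 𝓜` for almost all `x ∈ Ω`. -/
def admissibleCoefficients {d : ℕ} (Ω : Opens (E d)) (α : ℝ) : Set (E d → Mat d) :=
  {a | (∀ i j, MemLp (fun x => a x i j) ∞ (volume.restrict (Ω : Set (E d)))) ∧
    ∀ᵐ x ∂(volume.restrict (Ω : Set (E d))), a x ∈ ellipticMatrices d α}

/-- `g` is a (representative of the) weak gradient of `u` on the open set `U`: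
`∫_U u ∂_i φ = - ∫_U g_i φ` for all `φ ∈ C_c^∞(U)` and all `i`. -/
def HasWeakGradient {d : ℕ} (U : Opens (E d)) (u : E d → ℝ) (g : E d → E d) : Prop :=
  LocallyIntegrableOn u (U : Set (E d)) ∧ LocallyIntegrableOn g (U : Set (E d)) ∧
    ∀ (φ : 𝓓(U, ℝ)) (i : Fin d),
      ∫ x in (U : Set (E d)), u x * gradient φ x i = - ∫ x in (U : Set (E d)), g x i * φ x

/-- `u ∈ H¹(U)` with weak gradient `g`. -/
def MemH1 {d : ℕ} (U : Opens (E d)) (u : E d → ℝ) (g : E d → E d) : Prop :=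
  MemLp u 2 (volume.restrict (U : Set (E d))) ∧ MemLp g 2 (volume.restrict (U : Set (E d))) ∧
    HasWeakGradient U u g

/-- `u ∈ H¹₀(U)` with weak gradient `g`: `u` lies in the closure of `C_c^∞(U)` in `H¹(U)`. -/
def MemH10 {d : ℕ} (U : Opens (E d)) (u : E d → ℝ) (g : E d → E d) : Prop :=
  MemH1 U u g ∧ ∀ ε : ℝ≥0∞, 0 < ε → ∃ φ : 𝓓(U, ℝ),
    eLpNorm (fun x => u x - φ x) 2 (volume.restrict (U : Set (E d))) < ε ∧
    eLpNorm (fun x => g x - gradient φ x) 2 (volume.restrict (U : Set (E d))) < ε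

/-- `z` represents an element of the homogeneous Sobolev space `Ḣ¹(ℝ^d)` with weak gradient `g`:
`z ∈ H¹_loc(ℝ^d)` and `∇z = g ∈ L²(ℝ^d)`. Two functions represent the same
element if their difference is (almost everywhere) constant. -/
def MemHomH1 {d : ℕ} (z : E d → ℝ) (g : E d → E d) : Prop :=
  (∀ K : Set (E d), IsCompact K → MemLp z 2 (volume.restrict K)) ∧
    MemLp g 2 volume ∧ HasWeakGradient ⊤ z g

/-- `y ∈ H¹₀(Ω)`, with weak gradient `gy`, is the weak solution of `-div (a ∇y) = f`. -/
def IsState {d : ℕ} (Ω : Opens (E d)) (a : E d → Mat d) (f : E d → ℝ)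
    (y : E d → ℝ) (gy : E d → E d) : Prop :=
  MemH10 Ω y gy ∧ ∀ (v : E d → ℝ) (gv : E d → E d), MemH10 Ω v gv →
    ∫ x in (Ω : Set (E d)), inner ℝ (act (a x) (gy x)) (gv x) =
      ∫ x in (Ω : Set (E d)), f x * v x

/-- `p ∈ H¹₀(Ω)`, with weak gradient `gp`, is the adjoint state:
`∫_Ω a ∇v · ∇p = ∫_Ω (y - y_d) v` for all `v ∈ H¹₀(Ω)`. -/
def IsAdjoint {d : ℕ} (Ω : Opens (E d)) (a : E d → Mat d) (y yd : E d → ℝ)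
    (p : E d → ℝ) (gp : E d → E d) : Prop :=
  MemH10 Ω p gp ∧ ∀ (v : E d → ℝ) (gv : E d → E d), MemH10 Ω v gv →
    ∫ x in (Ω : Set (E d)), inner ℝ (act (a x) (gv x)) (gp x) =
      ∫ x in (Ω : Set (E d)), (y x - yd x) * v x

open Classical in
/-- The reduced cost `J(a) = ½ ‖y - y_d‖²_{L²(Ω)}`, where `y` is the state belonging to `a`
(a dummy value is used if there is no state). -/
def cost {d : ℕ} (Ω : Opens (E d)) (f yd : E d → ℝ) (a : E d → Mat d) : ℝ :=
  if h : ∃ y : E d → ℝ, ∃ gy : E d → E d, IsState Ω a f y gy then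
    1 / 2 * ∫ x in (Ω : Set (E d)), (h.choose x - yd x) ^ 2
  else 0

/-- The perturbed coefficient `a_r = a + χ_{x₀ + r ω} (b - a)`. -/
def perturbedCoefficient {d : ℕ} (a : E d → Mat d) (b : Mat d) (x₀ : E d) (ω : Set (E d))
    (r : ℝ) : E d → Mat d :=
  fun x => a x + ((fun z => x₀ + r • z) '' ω).indicator (fun x => b - a x) x

open Classical in
/-- The two-phase coefficient on `ℝ^d`, equal to `b` on `ω` and to `A` on the complement. -/
def transmissionCoefficient {d : ℕ} (A b : Mat d) (ω : Set (E d)) : E d → Mat d :=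
  fun x => if x ∈ ω then b else A

/-- `Q ∈ Ḣ¹(ℝ^d)`, with weak gradient `gQ`, solves the transmission problem with data
`A`, `b`, `q`, `ω`: with `ã = χ_ω b + χ_{ω^c} A`,
`∫_{ℝ^d} ã ∇v · ∇Q + ((b - A) ∫_ω ∇v) · q = 0` for all `v ∈ Ḣ¹(ℝ^d)`. -/
def IsTransmissionSolution {d : ℕ} (A b : Mat d) (q : E d) (ω : Set (E d))
    (Q : E d → ℝ) (gQ : E d → E d) : Prop :=
  MemHomH1 Q gQ ∧ ∀ (v : E d → ℝ) (gv : E d → E d), MemHomH1 v gv →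
    (∫ x, inner ℝ (act (transmissionCoefficient A b ω x) (gv x)) (gQ x)) +
      inner ℝ (act (b - A) (∫ x in ω, gv x)) q = 0

end

/-! The argument lives in Hilbert spaces of gradients. `sobolevZero` is the closed space of pairs
(u, ∇u) with u in H¹₀(Ω), extended by zero. A coefficient becomes a bounded coercive operator on L²
vector fields that commutes with indicator functions, and changing it on a set gives `perturbOp`.
State, adjoint and transmission problems are then instances of Lax-Milgram.

Let s = x₀ + rω, let W be the state for a_r, and let P solve the adjoint equation with the perturbed
coefficient but the unperturbed datum y - y_d. Testing that equation with W - y gives the exact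
identity (`cost_sub_eq`) J(a_r) - J(a) = ∫_s (a - b)∇y · ∇P + ½ ‖W - y‖², so two limits remain.

The quadratic term is o(r^d) (`tendsto_norm_state_sub_sq_div`). At a Lebesgue point the energy
estimate gives ‖∇(W - y)‖ = O(r^{d/2}), so r^{-d/2}(W - y) is bounded in H¹₀. Its pairing with a
fixed m in L² becomes, through the dual solution for m, an integral over the shrinking set s, and
hence tends to zero. Rellich's theorem (`tendsto_norm_fst_of_tendsto_inner`) upgrades this weak
convergence to strong convergence in L².

For the linear term, the substitution x = x₀ + r x' turns the integral over s, divided by r^d, into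
one over the fixed set ω. At Lebesgue points the rescaled flux jump (a - b)∇y and the rescaled ∇p
converge strongly on ω to constants. The rescaled ∇(P - p) is bounded in L²(ℝ^d). Testing its
equation with test functions transplanted to Ω, and freezing a at x₀, identifies its weak limit as
∇Q (`tendsto_inner_rescale_adjoint_sub`). Products of strongly and weakly convergent factors pass to
the limit (`tendsto_cost_sub_div`).

This produces ∇Q in `gradientClosure`, the L² closure of gradients of test functions, whereas the
transmission problem is posed on all of Ḣ¹(ℝ^d). The two agree. A weighted Poincaré inequality gives
every element of the closure a potential (`exists_memHomH1_of_mem_gradientClosure`). Conversely, the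
part of a gradient orthogonal to the closure is free of curl and divergence, hence harmonic and in
L², hence zero by Fourier transform (`MemHomH1.toLp_mem_gradientClosure`). -/

noncomputable section

/-- Square integrable functions on `ℝ^d`. -/
abbrev L2 (d : ℕ) : Type := Lp ℝ 2 (volume : Measure (E d))

/-- Square integrable vector fields on `ℝ^d`. -/
abbrev L2v (d : ℕ) : Type := Lp (E d) 2 (volume : Measure (E d))

/-- Pairs consisting of a square integrable function and a square integrable vector field. -/
abbrev L2Pair (d : ℕ) : Type := WithLp 2 (L2 d × L2v d)

/-! ### Gradients of test functions and the spaces they generate -/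

section Gradient

variable {d : ℕ}

lemma gradient_apply_eq_fderiv (u : E d → ℝ) (x : E d) (i : Fin d) :
    gradient u x i = fderiv ℝ u x (EuclideanSpace.single i 1) := by
  rw [← inner_gradient_left, EuclideanSpace.inner_single_right]; simp

lemma ContDiff.continuous_gradient {u : E d → ℝ} (hu : ContDiff ℝ 1 u) :
    Continuous (gradient u) :=
  (InnerProductSpace.toDual ℝ (E d)).symm.continuous.comp (hu.continuous_fderiv one_ne_zero)

lemma HasCompactSupport.gradient {u : E d → ℝ} (hu : HasCompactSupport u) :
    HasCompactSupport (gradient u) :=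
  (hu.fderiv ℝ).comp_left (g := (InnerProductSpace.toDual ℝ (E d)).symm) (map_zero _)

lemma norm_gradient (u : E d → ℝ) (x : E d) : ‖gradient u x‖ = ‖fderiv ℝ u x‖ := by
  rw [← toDual_gradient, LinearIsometryEquiv.norm_map]

variable {Ω : Opens (E d)}

lemma TestFunction.contDiff_one (φ : 𝓓(Ω, ℝ)) : ContDiff ℝ 1 φ :=
  φ.contDiff.of_le (by exact_mod_cast le_top)

lemma TestFunction.differentiable (φ : 𝓓(Ω, ℝ)) : Differentiable ℝ φ :=
  φ.contDiff_one.differentiable one_ne_zero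

lemma TestFunction.memLp_two (φ : 𝓓(Ω, ℝ)) : MemLp φ 2 (volume : Measure (E d)) :=
  φ.continuous.memLp_of_hasCompactSupport φ.hasCompactSupport

lemma TestFunction.continuous_gradient (φ : 𝓓(Ω, ℝ)) : Continuous (gradient φ) :=
  φ.contDiff_one.continuous_gradient

lemma TestFunction.memLp_gradient (φ : 𝓓(Ω, ℝ)) :
    MemLp (gradient φ) 2 (volume : Measure (E d)) :=
  φ.continuous_gradient.memLp_of_hasCompactSupport φ.hasCompactSupport.gradient

lemma TestFunction.eq_zero_of_notMem (φ : 𝓓(Ω, ℝ)) {x : E d} (hx : x ∉ Ω) : φ x = 0 :=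
  image_eq_zero_of_notMem_tsupport fun h => hx (φ.tsupport_subset h)

lemma TestFunction.gradient_eq_zero_of_notMem (φ : 𝓓(Ω, ℝ)) {x : E d} (hx : x ∉ Ω) :
    gradient φ x = 0 := by
  have : fderiv ℝ φ x = 0 := image_eq_zero_of_notMem_tsupport
    fun h => hx (φ.tsupport_subset (tsupport_fderiv_subset ℝ h))
  simp [gradient, this]

lemma TestFunction.gradient_add (φ ψ : 𝓓(Ω, ℝ)) :
    gradient (φ + ψ : 𝓓(Ω, ℝ)) = gradient φ + gradient ψ := by
  ext1 x
  have : fderiv ℝ (φ + ψ : 𝓓(Ω, ℝ)) x = fderiv ℝ φ x + fderiv ℝ ψ x :=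
    fderiv_add (φ.differentiable x) (ψ.differentiable x)
  rw [gradient, this, map_add]; rfl

lemma TestFunction.gradient_smul (c : ℝ) (φ : 𝓓(Ω, ℝ)) :
    gradient (c • φ : 𝓓(Ω, ℝ)) = c • gradient φ := by
  ext1 x
  have : fderiv ℝ (c • φ : 𝓓(Ω, ℝ)) x = c • fderiv ℝ φ x :=
    fderiv_const_smul (φ.differentiable x) c
  rw [gradient, this, map_smul]; rfl

variable (Ω) in
/-- The map `φ ↦ (φ, ∇φ)` on test functions. -/
def testPair : 𝓓(Ω, ℝ) →ₗ[ℝ] L2Pair d where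
  toFun φ := WithLp.toLp 2 (φ.memLp_two.toLp φ, φ.memLp_gradient.toLp (gradient φ))
  map_add' φ ψ := by
    have h2 : (φ + ψ).memLp_gradient.toLp _ =
        φ.memLp_gradient.toLp _ + ψ.memLp_gradient.toLp _ := by
      rw [← MemLp.toLp_add]; exact MemLp.toLp_congr _ _ (by rw [TestFunction.gradient_add])
    rw [h2]; rfl
  map_smul' c φ := by
    have h2 : (c • φ).memLp_gradient.toLp _ = c • φ.memLp_gradient.toLp _ := by
      rw [← MemLp.toLp_const_smul]
      exact MemLp.toLp_congr _ _ (by rw [TestFunction.gradient_smul])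
    rw [h2]; rfl

lemma testPair_fst (φ : 𝓓(Ω, ℝ)) : (testPair Ω φ).fst = φ.memLp_two.toLp φ := rfl

lemma testPair_snd (φ : 𝓓(Ω, ℝ)) :
    (testPair Ω φ).snd = φ.memLp_gradient.toLp (gradient φ) := rfl

variable (Ω) in
/-- The space `H¹₀(Ω)`, as the closure of the pairs `(φ, ∇φ)` for test functions `φ`. -/
def sobolevZero : Submodule ℝ (L2Pair d) := (LinearMap.range (testPair Ω)).topologicalClosure

variable (d) in
/-- The closure of the gradients of test functions on `ℝ^d`. -/
def gradientClosure : Submodule ℝ (L2v d) :=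
  (LinearMap.range ((WithLp.sndL 2 ℝ (L2 d) (L2v d)).toLinearMap ∘ₗ
    testPair (⊤ : Opens (E d)))).topologicalClosure

lemma isClosed_sobolevZero : IsClosed (sobolevZero Ω : Set (L2Pair d)) :=
  Submodule.isClosed_topologicalClosure _

lemma isClosed_gradientClosure : IsClosed (gradientClosure d : Set (L2v d)) :=
  Submodule.isClosed_topologicalClosure _

lemma testPair_mem (φ : 𝓓(Ω, ℝ)) : testPair Ω φ ∈ sobolevZero Ω :=
  Submodule.le_topologicalClosure _ ⟨φ, rfl⟩

lemma gradient_mem_gradientClosure (φ : 𝓓((⊤ : Opens (E d)), ℝ)) :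
    φ.memLp_gradient.toLp (gradient φ) ∈ gradientClosure d :=
  Submodule.le_topologicalClosure _ ⟨φ, rfl⟩

/-- A closed property of pairs that holds for test functions holds on `H¹₀(Ω)`. -/
lemma sobolevZero_induction {P : L2Pair d → Prop} (hP : IsClosed {w | P w})
    (h : ∀ φ : 𝓓(Ω, ℝ), P (testPair Ω φ)) {w : L2Pair d} (hw : w ∈ sobolevZero Ω) : P w := by
  have : (sobolevZero Ω : Set (L2Pair d)) ⊆ {w | P w} := by
    refine closure_minimal ?_ hP
    rintro _ ⟨φ, rfl⟩
    exact h φ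
  exact this hw

/-- A closed property of vector fields that holds for gradients of test functions holds on their
closure. -/
lemma gradientClosure_induction {P : L2v d → Prop} (hP : IsClosed {w | P w})
    (h : ∀ φ : 𝓓((⊤ : Opens (E d)), ℝ), P (φ.memLp_gradient.toLp (gradient φ)))
    {g : L2v d} (hg : g ∈ gradientClosure d) : P g := by
  have : (gradientClosure d : Set (L2v d)) ⊆ {w | P w} := by
    refine closure_minimal ?_ hP
    rintro _ ⟨φ, rfl⟩
    exact h φ
  exact this hg

/-- Integration by parts for a continuously differentiable function and a test function. -/
lemma integral_mul_gradient_eq_neg {u : E d → ℝ} (hu : ContDiff ℝ 1 u) (φ : 𝓓(Ω, ℝ))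
    (i : Fin d) : ∫ x, u x * gradient φ x i = - ∫ x, gradient u x i * φ x := by
  simp_rw [gradient_apply_eq_fderiv]
  have hφ' : Continuous fun x => fderiv ℝ φ x (EuclideanSpace.single i (1 : ℝ)) :=
    (φ.contDiff_one.continuous_fderiv one_ne_zero).clm_apply continuous_const
  have hu' : Continuous fun x => fderiv ℝ u x (EuclideanSpace.single i (1 : ℝ)) :=
    (hu.continuous_fderiv one_ne_zero).clm_apply continuous_const
  have hc : HasCompactSupport fun x => fderiv ℝ φ x (EuclideanSpace.single i (1 : ℝ)) :=
    (φ.hasCompactSupport.fderiv ℝ).comp_left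
      (g := fun L : E d →L[ℝ] ℝ => L (EuclideanSpace.single i (1 : ℝ))) rfl
  apply integral_mul_fderiv_eq_neg_fderiv_mul_of_integrable
  · exact (hu'.mul φ.continuous).integrable_of_hasCompactSupport φ.hasCompactSupport.mul_left
  · exact (hu.continuous.mul hφ').integrable_of_hasCompactSupport hc.mul_left
  · exact (hu.continuous.mul φ.continuous).integrable_of_hasCompactSupport
      φ.hasCompactSupport.mul_left
  · exact fun x _ => hu.differentiable one_ne_zero x
  · exact fun x _ => φ.differentiable x

end Gradient

/-! ### Translation estimates in L² -/

section Translation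

variable {d : ℕ}

lemma lintegral_enorm_sq_le {α F : Type*} [MeasurableSpace α] [NormedAddCommGroup F]
    {P : Measure α} [IsProbabilityMeasure P] {f : α → F} (hf : AEStronglyMeasurable f P) :
    (∫⁻ t, ‖f t‖ₑ ∂P) ^ 2 ≤ ∫⁻ t, ‖f t‖ₑ ^ 2 ∂P := by
  have := eLpNorm_le_eLpNorm_of_exponent_le (p := 1) (q := 2) one_le_two hf
  rw [eLpNorm_one_eq_lintegral_enorm] at this
  refine (pow_le_pow_left' this 2).trans_eq ?_
  simpa using eLpNorm_nnreal_pow_eq_lintegral (p := 2) (μ := P) (f := f) two_ne_zero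

/-- Fundamental theorem of calculus along the segment from x to x + h, then Jensen on [0, 1]. -/
lemma enorm_sub_sq_le_lintegral {u : E d → ℝ} (hu : ContDiff ℝ 1 u) (x h : E d) :
    ‖u (x + h) - u x‖ₑ ^ 2 ≤
      ‖h‖ₑ ^ 2 * ∫⁻ t in Set.Icc (0 : ℝ) 1, ‖gradient u (x + t • h)‖ₑ ^ 2 := by
  have hcont : Continuous fun t : ℝ => gradient u (x + t • h) :=
    hu.continuous_gradient.comp (by fun_prop)
  have hder : ∀ t : ℝ, HasDerivAt (fun t : ℝ => u (x + t • h))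
      (inner ℝ (gradient u (x + t • h)) h) t := by
    intro t
    rw [inner_gradient_left]
    have h1 : HasDerivAt (fun t : ℝ => x + t • h) h t := by
      simpa using ((hasDerivAt_id t).smul_const h).const_add x
    exact ((hu.differentiable one_ne_zero _).hasFDerivAt).comp_hasDerivAt t h1
  have hint : u (x + h) - u x =
      ∫ t in Set.Icc (0 : ℝ) 1, inner ℝ (gradient u (x + t • h)) h := by
    rw [integral_Icc_eq_integral_Ioc, ← intervalIntegral.integral_of_le zero_le_one,
      intervalIntegral.integral_eq_sub_of_hasDerivAt (fun t _ => hder t)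
        ((hcont.inner continuous_const).intervalIntegrable _ _)]
    simp
  have hle : ‖u (x + h) - u x‖ₑ ≤
      ‖h‖ₑ * ∫⁻ t in Set.Icc (0 : ℝ) 1, ‖gradient u (x + t • h)‖ₑ := by
    rw [hint, ← lintegral_const_mul' _ _ enorm_ne_top]
    refine (enorm_integral_le_lintegral_enorm _).trans (lintegral_mono fun t => ?_)
    rw [mul_comm]
    simp only [enorm_eq_nnnorm]
    exact_mod_cast nnnorm_inner_le_nnnorm (𝕜 := ℝ) (gradient u (x + t • h)) h
  have hJ : (∫⁻ t in Set.Icc (0 : ℝ) 1, ‖gradient u (x + t • h)‖ₑ) ^ 2 ≤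
      ∫⁻ t in Set.Icc (0 : ℝ) 1, ‖gradient u (x + t • h)‖ₑ ^ 2 := by
    have : IsProbabilityMeasure (volume.restrict (Set.Icc (0 : ℝ) 1)) := ⟨by simp⟩
    exact lintegral_enorm_sq_le hcont.aestronglyMeasurable
  calc _ ≤ (‖h‖ₑ * ∫⁻ t in Set.Icc (0 : ℝ) 1, ‖gradient u (x + t • h)‖ₑ) ^ 2 :=
        pow_le_pow_left' hle 2
    _ ≤ _ := by rw [mul_pow]; gcongr

/-- Integrating the segment bound over x, Tonelli and translation invariance make the inner integral
independent of t. Lower integrals spare any integrability assumption; the weighted Poincaré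
inequality below uses this form as well. -/
lemma lintegral_sub_translate_sq_le {u : E d → ℝ} (hu : ContDiff ℝ 1 u) (h : E d) :
    ∫⁻ x, ‖u (x + h) - u x‖ₑ ^ 2 ≤ ‖h‖ₑ ^ 2 * ∫⁻ x, ‖gradient u x‖ₑ ^ 2 := by
  have hm : Measurable (Function.uncurry fun (x : E d) (t : ℝ) =>
      ‖gradient u (x + t • h)‖ₑ ^ 2) := by
    have : Continuous (Function.uncurry fun (x : E d) (t : ℝ) => gradient u (x + t • h)) :=
      hu.continuous_gradient.comp (by fun_prop)
    exact (this.enorm.measurable).pow_const 2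
  calc _ ≤ ∫⁻ x, ‖h‖ₑ ^ 2 * ∫⁻ t in Set.Icc (0 : ℝ) 1, ‖gradient u (x + t • h)‖ₑ ^ 2 :=
        lintegral_mono fun x => enorm_sub_sq_le_lintegral hu x h
    _ = ‖h‖ₑ ^ 2 * ∫⁻ t in Set.Icc (0 : ℝ) 1, ∫⁻ x, ‖gradient u (x + t • h)‖ₑ ^ 2 := by
        rw [lintegral_const_mul' _ _ (by simp), lintegral_lintegral_swap hm.aemeasurable]
    _ = _ := by
        congr 1
        have : ∀ t : ℝ, ∫⁻ x, ‖gradient u (x + t • h)‖ₑ ^ 2 = ∫⁻ x, ‖gradient u x‖ₑ ^ 2 :=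
          fun t => lintegral_add_right_eq_self (fun x => ‖gradient u x‖ₑ ^ 2) (t • h)
        simp [this]

lemma Lp_two_enorm_sq {F : Type*} [NormedAddCommGroup F] {α : Type*} [MeasurableSpace α]
    {μ : Measure α} (f : Lp F 2 μ) : ‖f‖ₑ ^ 2 = ∫⁻ x, ‖f x‖ₑ ^ 2 ∂μ := by
  have := eLpNorm_nnreal_pow_eq_lintegral (p := 2) (μ := μ) (f := f) two_ne_zero
  rw [Lp.enorm_def]
  simpa using this

lemma MemLp.enorm_toLp_sq {F : Type*} [NormedAddCommGroup F] {α : Type*} [MeasurableSpace α]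
    {μ : Measure α} {f : α → F} (hf : MemLp f 2 μ) :
    ‖hf.toLp f‖ₑ ^ 2 = ∫⁻ x, ‖f x‖ₑ ^ 2 ∂μ := by
  rw [Lp_two_enorm_sq]
  refine lintegral_congr_ae ?_
  filter_upwards [hf.coeFn_toLp] with x hx
  rw [hx]

lemma measurePreserving_translate (h : E d) :
    MeasurePreserving (fun x : E d => x + h) volume volume :=
  measurePreserving_add_right volume h

/-- Translation `u ↦ u(· + h)` on `L²(ℝ^d)`. -/
def translateL2 (h : E d) : L2 d →ₗᵢ[ℝ] L2 d :=
  Lp.compMeasurePreservingₗᵢ ℝ (fun x : E d => x + h) (measurePreserving_translate h)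

lemma translateL2_coeFn (h : E d) (u : L2 d) : translateL2 h u =ᵐ[volume] fun x => u (x + h) :=
  Lp.coeFn_compMeasurePreserving u (measurePreserving_translate h)

lemma norm_translateL2_sub_le_of_test {Ω : Opens (E d)} (h : E d) (φ : 𝓓(Ω, ℝ)) :
    ‖translateL2 h (testPair Ω φ).fst - (testPair Ω φ).fst‖ ≤ ‖h‖ * ‖(testPair Ω φ).snd‖ := by
  rw [← ENNReal.ofReal_le_ofReal_iff (by positivity), ENNReal.ofReal_mul (norm_nonneg _)]
  simp only [ofReal_norm]
  rw [← (ENNReal.pow_right_strictMono two_ne_zero).le_iff_le, mul_pow, testPair_snd,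
    MemLp.enorm_toLp_sq, Lp_two_enorm_sq]
  refine le_trans (le_of_eq ?_) (lintegral_sub_translate_sq_le φ.contDiff_one h)
  refine lintegral_congr_ae ?_
  have h1 := φ.memLp_two.coeFn_toLp
  filter_upwards [Lp.coeFn_sub (translateL2 h (testPair Ω φ).fst) (testPair Ω φ).fst,
    translateL2_coeFn h (testPair Ω φ).fst, h1,
    (measurePreserving_translate h).quasiMeasurePreserving.ae h1] with x h2 h3 h4 h5
  rw [h2, Pi.sub_apply, h3, testPair_fst, h4, h5]

/-- Translations of an `H¹₀` function by `h` differ from it by at most `‖h‖ ‖∇u‖` in `L²`. -/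
lemma norm_translateL2_sub_le {Ω : Opens (E d)} (h : E d) {w : L2Pair d}
    (hw : w ∈ sobolevZero Ω) : ‖translateL2 h w.fst - w.fst‖ ≤ ‖h‖ * ‖w.snd‖ := by
  refine sobolevZero_induction (P := fun w => ‖translateL2 h w.fst - w.fst‖ ≤ ‖h‖ * ‖w.snd‖)
    ?_ (norm_translateL2_sub_le_of_test h) hw
  have h1 : Continuous fun w : L2Pair d => w.fst := (WithLp.fstL 2 ℝ (L2 d) (L2v d)).continuous
  have h2 : Continuous fun w : L2Pair d => w.snd := (WithLp.sndL 2 ℝ (L2 d) (L2v d)).continuous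
  exact isClosed_le (((translateL2 h).continuous.comp h1).sub h1).norm
    (continuous_const.mul h2.norm)

end Translation

/-! ### The Poincaré inequality -/

section Poincare

variable {d : ℕ} {Ω : Opens (E d)}

/-- The Poincaré inequality on a bounded open set. -/
lemma exists_poincare_const (hd : 0 < d) (hΩ : Bornology.IsBounded (Ω : Set (E d))) :
    ∃ C : ℝ, 0 < C ∧ ∀ w ∈ sobolevZero Ω, ‖w.fst‖ ≤ C * ‖w.snd‖ := by
  obtain ⟨R, hR, hΩR⟩ := hΩ.subset_ball_lt 0 0
  -- A shift by the diameter 2R of a ball containing Ω moves Ω off itself. Hence u and its translate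
  -- are orthogonal, ‖τ_h u - u‖² = 2‖u‖², and the translation estimate bounds the left side.
  set h : E d := EuclideanSpace.single ⟨0, hd⟩ (2 * R)
  have hn : ‖h‖ = 2 * R := by simp [h, abs_of_pos hR]
  refine ⟨2 * R, by positivity, fun w hw => ?_⟩
  have h1 : Continuous fun w : L2Pair d => w.fst := (WithLp.fstL 2 ℝ (L2 d) (L2v d)).continuous
  have horth : inner ℝ (translateL2 h w.fst) w.fst = 0 := by
    refine sobolevZero_induction (Ω := Ω) (P := fun w => inner ℝ (translateL2 h w.fst) w.fst = 0)
      ?_ (fun φ => ?_) hw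
    · exact isClosed_eq (((translateL2 h).continuous.comp h1).inner h1) continuous_const
    · rw [L2.inner_def]
      have h1 := φ.memLp_two.coeFn_toLp
      refine integral_eq_zero_of_ae ?_
      filter_upwards [translateL2_coeFn h (testPair Ω φ).fst, h1,
        (measurePreserving_translate h).quasiMeasurePreserving.ae h1] with x h3 h4 h5
      rw [h3, testPair_fst, h4, h5]
      by_cases hx : x ∈ Ω
      · have hx' : x + h ∉ Ω := by
          intro hx'
          have e1 := hΩR hx
          have e2 := hΩR hx'
          simp only [Metric.mem_ball, dist_zero_right] at e1 e2
          have := norm_sub_le (x + h) x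
          rw [add_sub_cancel_left, hn] at this
          linarith
        simp [φ.eq_zero_of_notMem hx']
      · simp [φ.eq_zero_of_notMem hx]
  have hpy : ‖translateL2 h w.fst - w.fst‖ ^ 2 = ‖w.fst‖ ^ 2 + ‖w.fst‖ ^ 2 := by
    rw [@norm_sub_sq_real, horth, LinearIsometry.norm_map]; ring
  have := norm_translateL2_sub_le h hw
  rw [hn] at this
  refine le_trans ?_ this
  exact (sq_le_sq₀ (norm_nonneg _) (norm_nonneg _)).1 (by rw [hpy]; nlinarith [sq_nonneg ‖w.fst‖])

end Poincare

/-! ### Vanishing outside Ω -/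

section Support

variable {d : ℕ} {Ω : Opens (E d)}

lemma continuous_L2Pair_fst : Continuous fun w : L2Pair d => w.fst :=
  (WithLp.fstL 2 ℝ (L2 d) (L2v d)).continuous

lemma continuous_L2Pair_snd : Continuous fun w : L2Pair d => w.snd :=
  (WithLp.sndL 2 ℝ (L2 d) (L2v d)).continuous

/-- The functions of `L²` vanishing almost everywhere on a measurable set form a closed set. -/
lemma isClosed_ae_eq_zero {F : Type*} [NormedAddCommGroup F] [NormedSpace ℝ F]
    {s : Set (E d)} (hs : MeasurableSet s) :
    IsClosed {u : Lp F 2 (volume : Measure (E d)) | ∀ᵐ x, x ∈ s → u x = 0} := by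
  have : {u : Lp F 2 (volume : Measure (E d)) | ∀ᵐ x, x ∈ s → u x = 0} =
      LpToLpRestrictCLM (E d) F ℝ volume 2 s ⁻¹' {0} := by
    ext u
    simp only [Set.mem_ofPred_eq, Set.mem_preimage, Set.mem_singleton_iff]
    rw [← ae_restrict_iff' hs, Lp.eq_zero_iff_ae_eq_zero]
    have h := LpToLpRestrictCLM_coeFn (𝕜 := ℝ) (p := 2) s u
    constructor
    · intro hu
      filter_upwards [h, hu] with x h1 h2
      rw [h1, h2]; rfl
    · intro hu
      filter_upwards [h, hu] with x h1 h2
      rw [← h1, h2]; rfl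
  rw [this]
  exact isClosed_singleton.preimage (ContinuousLinearMap.continuous _)

lemma sobolevZero_fst_eq_zero {w : L2Pair d} (hw : w ∈ sobolevZero Ω) :
    ∀ᵐ x, x ∈ (Ω : Set (E d))ᶜ → w.fst x = 0 := by
  refine sobolevZero_induction (P := fun w => ∀ᵐ x, x ∈ (Ω : Set (E d))ᶜ → w.fst x = 0)
    ((isClosed_ae_eq_zero Ω.isOpen.measurableSet.compl).preimage continuous_L2Pair_fst)
    (fun φ => ?_) hw
  filter_upwards [φ.memLp_two.coeFn_toLp] with x hx hx'
  rw [testPair_fst, hx, φ.eq_zero_of_notMem hx']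

lemma sobolevZero_snd_eq_zero {w : L2Pair d} (hw : w ∈ sobolevZero Ω) :
    ∀ᵐ x, x ∈ (Ω : Set (E d))ᶜ → w.snd x = 0 := by
  refine sobolevZero_induction (P := fun w => ∀ᵐ x, x ∈ (Ω : Set (E d))ᶜ → w.snd x = 0)
    ((isClosed_ae_eq_zero Ω.isOpen.measurableSet.compl).preimage continuous_L2Pair_snd)
    (fun φ => ?_) hw
  filter_upwards [φ.memLp_gradient.coeFn_toLp] with x hx hx'
  rw [testPair_snd, hx, φ.gradient_eq_zero_of_notMem hx']

end Support

/-! ### Rellich's theorem by local averages -/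

section Rellich

variable {d : ℕ}

/-- The integral of `u` over the ball of radius `δ` around `x`. -/
def ballIntegral (δ : ℝ) (u : L2 d) (x : E d) : ℝ := ∫ h in Metric.ball (0 : E d) δ, u (x + h)

/-- As a pairing with a fixed L² function, the local integral at each point passes to the limit
under weak convergence. -/
lemma ballIntegral_eq_inner (δ : ℝ) (u : L2 d) (x : E d) :
    ballIntegral δ u x = inner ℝ (indicatorConstLp 2 (Metric.isOpen_ball.measurableSet)
      (measure_ball_lt_top (x := x) (r := δ)).ne (1 : ℝ)) u := by
  rw [L2.inner_indicatorConstLp_one, ballIntegral]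
  have := (measurePreserving_add_left (volume : Measure (E d)) x).setIntegral_preimage_emb
    (measurableEmbedding_addLeft x) u (Metric.ball x δ)
  rw [← this]
  congr 2
  ext h; simp

lemma abs_ballIntegral_le (δ : ℝ) (u : L2 d) (x : E d) :
    |ballIntegral δ u x| ≤ volume.real (Metric.ball (0 : E d) δ) ^ (1 / 2 : ℝ) * ‖u‖ := by
  rw [ballIntegral_eq_inner]
  refine (abs_real_inner_le_norm _ _).trans ?_
  gcongr
  rw [norm_indicatorConstLp two_ne_zero ENNReal.ofNat_ne_top]
  simp [Measure.real, Measure.addHaar_ball_center volume x δ]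

/-- Needed for Fubini: for each h, Cauchy-Schwarz and translation invariance bound the x-integral by
‖u‖², and h ranges over a set of finite measure. -/
lemma integrable_mul_translate (δ : ℝ) (u : L2 d) :
    Integrable (Function.uncurry fun (h x : E d) => u x * u (x + h))
      ((volume.restrict (Metric.ball (0 : E d) δ)).prod volume) := by
  have hm : StronglyMeasurable (Function.uncurry fun (h x : E d) => u x * u (x + h)) := by
    have hu := Lp.stronglyMeasurable u
    exact (hu.comp_measurable measurable_snd).mul
      (hu.comp_measurable (measurable_snd.add measurable_fst))
  have hu2 := Lp.memLp u
  have hmem : ∀ h : E d, MemLp (fun x => u (x + h)) 2 volume := fun h =>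
    hu2.comp_measurePreserving (measurePreserving_translate h)
  have hbd : ∀ h : E d, ∫ x, ‖u x * u (x + h)‖ ≤ ‖u‖ * ‖u‖ := by
    intro h
    have := abs_real_inner_le_norm (hu2.norm.toLp _) ((hmem h).norm.toLp _)
    rw [L2.inner_def] at this
    have h1 : ∫ x, ‖u x * u (x + h)‖ =
        ∫ x, inner ℝ (hu2.norm.toLp _ x) ((hmem h).norm.toLp _ x) := by
      refine integral_congr_ae ?_
      filter_upwards [hu2.norm.coeFn_toLp, (hmem h).norm.coeFn_toLp] with x h2 h3
      rw [h2, h3]; simp [mul_comm]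
    rw [h1]
    refine (le_abs_self _).trans (this.trans_eq ?_)
    congr 1
    · rw [Lp.norm_toLp, eLpNorm_norm, Lp.norm_def]
    · rw [Lp.norm_toLp, eLpNorm_norm, Lp.norm_def]
      congr 1
      exact eLpNorm_comp_measurePreserving hu2.1 (measurePreserving_translate h)
  rw [integrable_prod_iff hm.aestronglyMeasurable]
  refine ⟨Eventually.of_forall fun h => hu2.integrable_mul (hmem h), ?_⟩
  have : IsFiniteMeasure (volume.restrict (Metric.ball (0 : E d) δ)) :=
    ⟨by simpa using measure_ball_lt_top⟩
  refine Integrable.of_bound (C := ‖u‖ * ‖u‖) ?_ (Eventually.of_forall fun h => ?_)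
  · exact (hm.norm.aestronglyMeasurable (μ := (volume.restrict (Metric.ball (0 : E d) δ)).prod
      volume)).integral_prod_right'
  · rw [Real.norm_of_nonneg (integral_nonneg fun x => norm_nonneg _)]
    exact hbd h

/-- By polarisation ⟨τ_h u, u⟩ = ‖u‖² - ½‖τ_h u - u‖², which is at least ‖u‖² - δ²M²/2 for |h| < δ;
integrate over h in the ball. Control of local averages thus controls the norm, up to an error small
with δ. -/
lemma norm_sq_mul_measure_ball_le {δ M : ℝ} (hM : 0 ≤ M) {u : L2 d}
    (hu : ∀ h : E d, ‖translateL2 h u - u‖ ≤ ‖h‖ * M) :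
    volume.real (Metric.ball (0 : E d) δ) * (‖u‖ ^ 2 - δ ^ 2 * M ^ 2 / 2) ≤
      ∫ x, u x * ballIntegral δ u x := by
  have hI := integrable_mul_translate δ u
  have hswap := integral_integral_swap hI
  have heq : ∀ h : E d, ∫ x, u x * u (x + h) = inner ℝ (translateL2 h u) u := by
    intro h
    rw [L2.inner_def]
    refine integral_congr_ae ?_
    filter_upwards [translateL2_coeFn h u] with x hx
    rw [hx]; simp
  have : ∫ x, u x * ballIntegral δ u x =
      ∫ h in Metric.ball (0 : E d) δ, inner ℝ (translateL2 h u) u := by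
    simp_rw [← heq, hswap, ballIntegral, integral_const_mul]
  rw [this]
  have hint : IntegrableOn (fun h => inner ℝ (translateL2 h u) u) (Metric.ball (0 : E d) δ) := by
    refine hI.integral_prod_left.congr (Eventually.of_forall fun h => ?_)
    exact heq h
  have hc : ∫ h in Metric.ball (0 : E d) δ, (‖u‖ ^ 2 - δ ^ 2 * M ^ 2 / 2) =
      volume.real (Metric.ball (0 : E d) δ) * (‖u‖ ^ 2 - δ ^ 2 * M ^ 2 / 2) := by
    simp
  rw [← hc]
  refine setIntegral_mono_on (integrableOn_const measure_ball_lt_top.ne) hint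
    Metric.isOpen_ball.measurableSet fun h hh => ?_
  have h1 : ‖translateL2 h u - u‖ ^ 2 = 2 * ‖u‖ ^ 2 - 2 * inner ℝ (translateL2 h u) u := by
    rw [@norm_sub_sq_real, LinearIsometry.norm_map]; ring
  have h2 : ‖translateL2 h u - u‖ ≤ δ * M := (hu h).trans (by
    have : ‖h‖ < δ := by simpa using hh
    gcongr)
  nlinarith [norm_nonneg (translateL2 h u - u)]

lemma aestronglyMeasurable_ballIntegral (δ : ℝ) (u : L2 d) :
    AEStronglyMeasurable (ballIntegral δ u) volume := by
  have hm : StronglyMeasurable (fun p : E d × E d => u (p.1 + p.2)) :=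
    (Lp.stronglyMeasurable u).comp_measurable (measurable_fst.add measurable_snd)
  exact hm.aestronglyMeasurable.integral_prod_right'
    (μ := volume) (ν := volume.restrict (Metric.ball (0 : E d) δ))

/-- A form of Rellich's theorem: a family in `H¹₀(Ω)`, `Ω` bounded, which has bounded gradients and
converges weakly to zero in `L²`, converges to zero in `L²`. -/
theorem tendsto_norm_fst_of_tendsto_inner {Ω : Opens (E d)} (hd : 0 < d)
    (hΩ : Bornology.IsBounded (Ω : Set (E d))) {ι : Type*} {l : Filter ι}
    [l.IsCountablyGenerated] {w : ι → L2Pair d} (hw : ∀ᶠ i in l, w i ∈ sobolevZero Ω) {M : ℝ}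
    (hM : ∀ᶠ i in l, ‖(w i).snd‖ ≤ M)
    (hweak : ∀ m : L2 d, Tendsto (fun i => inner ℝ m (w i).fst) l (𝓝 0)) :
    Tendsto (fun i => ‖(w i).fst‖) l (𝓝 0) := by
  rcases l.eq_or_neBot with rfl | hl
  · exact tendsto_bot
  have hM0 : 0 ≤ M := by
    obtain ⟨i, hi⟩ := hM.exists
    exact (norm_nonneg _).trans hi
  obtain ⟨C, hC, hpoin⟩ := exists_poincare_const hd hΩ
  have hbd : ∀ᶠ i in l, ‖(w i).fst‖ ≤ C * M := by
    filter_upwards [hw, hM] with i h1 h2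
    exact (hpoin _ h1).trans (by gcongr)
  have hΩm := Ω.isOpen.measurableSet
  have hΩfin : volume (Ω : Set (E d)) ≠ ∞ := hΩ.measure_lt_top.ne
  have : IsFiniteMeasure (volume.restrict (Ω : Set (E d))) := ⟨by simpa using hΩfin.lt_top⟩
  -- the local averages converge to zero in `L²(Ω)`
  have havg : ∀ δ : ℝ, Tendsto (fun i => ∫ x in (Ω : Set (E d)), ballIntegral δ (w i).fst x ^ 2) l
      (𝓝 0) := by
    intro δ
    set K := volume.real (Metric.ball (0 : E d) δ) ^ (1 / 2 : ℝ) * (C * M)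
    have := tendsto_integral_filter_of_dominated_convergence
      (μ := volume.restrict (Ω : Set (E d))) (l := l)
      (F := fun i x => ballIntegral δ (w i).fst x ^ 2) (f := fun _ => 0) (fun _ => K ^ 2)
      (Eventually.of_forall fun i =>
        ((aestronglyMeasurable_ballIntegral δ (w i).fst).pow 2).restrict)
      ?_ (integrable_const _) ?_
    · simpa using this
    · filter_upwards [hbd] with i hi
      refine Eventually.of_forall fun x => ?_
      rw [norm_pow, Real.norm_eq_abs]
      have := abs_ballIntegral_le δ (w i).fst x
      have h2 : |ballIntegral δ (w i).fst x| ≤ K :=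
        this.trans (mul_le_mul_of_nonneg_left hi (by positivity))
      gcongr
    · refine Eventually.of_forall fun x => ?_
      have := (hweak (indicatorConstLp 2 (Metric.isOpen_ball.measurableSet)
        (measure_ball_lt_top (x := x) (r := δ)).ne (1 : ℝ))).pow 2
      simpa [ballIntegral_eq_inner] using this
  -- Since u vanishes off Ω, Cauchy-Schwarz involves the averages on Ω only, where they tend to zero
  -- by bounded convergence.
  have hpair : ∀ (δ : ℝ), ∀ᶠ i in l, ∫ x, (w i).fst x * ballIntegral δ (w i).fst x ≤
      C * M * Real.sqrt (∫ x in (Ω : Set (E d)), ballIntegral δ (w i).fst x ^ 2) := by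
    intro δ
    filter_upwards [hbd, hw] with i hi hwi
    have hmem : MemLp (ballIntegral δ (w i).fst) 2 (volume.restrict (Ω : Set (E d))) :=
      MemLp.of_bound (aestronglyMeasurable_ballIntegral δ (w i).fst).restrict _
        (Eventually.of_forall fun x => abs_ballIntegral_le δ (w i).fst x)
    have hmem' := (memLp_indicator_iff_restrict hΩm).2 hmem
    have h1 : ∫ x, (w i).fst x * ballIntegral δ (w i).fst x =
        inner ℝ (hmem'.toLp _) (w i).fst := by
      rw [L2.inner_def]
      refine integral_congr_ae ?_
      filter_upwards [hmem'.coeFn_toLp, sobolevZero_fst_eq_zero hwi] with x h2 h3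
      rw [h2]
      by_cases hx : x ∈ (Ω : Set (E d))
      · simp [Set.indicator_of_mem hx]
      · simp [h3 hx]
    have h2 : ‖hmem'.toLp _‖ =
        Real.sqrt (∫ x in (Ω : Set (E d)), ballIntegral δ (w i).fst x ^ 2) := by
      rw [← Real.sqrt_sq (norm_nonneg (hmem'.toLp _)), ← real_inner_self_eq_norm_sq, L2.inner_def,
        ← integral_indicator hΩm]
      congr 1
      refine integral_congr_ae ?_
      filter_upwards [hmem'.coeFn_toLp] with x hx
      rw [hx]
      by_cases hx : x ∈ (Ω : Set (E d))
      · simp [Set.indicator_of_mem hx, pow_two]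
      · simp [Set.indicator_of_notMem hx]
    rw [h1]
    refine (real_inner_le_norm _ _).trans ?_
    rw [h2, mul_comm]
    gcongr
  rw [Metric.tendsto_nhds]
  intro ε hε
  -- With this δ the translation error δ²M²/2 stays below ε²/2; the averages contribute the other
  -- half.
  obtain ⟨δ, hδ, hδM⟩ : ∃ δ : ℝ, 0 < δ ∧ δ * M < ε := by
    refine ⟨ε / (2 * (M + 1)), by positivity, ?_⟩
    rw [div_mul_eq_mul_div, div_lt_iff₀ (by positivity)]
    nlinarith
  set β := volume.real (Metric.ball (0 : E d) δ) with hβ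
  have hβ0 : 0 < β := by
    rw [hβ, Measure.real]
    exact ENNReal.toReal_pos (Metric.measure_ball_pos volume _ hδ).ne' measure_ball_lt_top.ne
  have hlim : Tendsto (fun i => C * M *
      Real.sqrt (∫ x in (Ω : Set (E d)), ballIntegral δ (w i).fst x ^ 2)) l (𝓝 0) := by
    have := ((Real.continuous_sqrt.tendsto 0).comp (havg δ)).const_mul (C * M)
    simpa using this
  have hev := hlim.eventually (gt_mem_nhds (show 0 < β * (ε ^ 2 / 2) by positivity))
  filter_upwards [hev, hpair δ, hw, hM] with i h1 h2 h3 h4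
  rw [Real.dist_eq, sub_zero, abs_of_nonneg (norm_nonneg _)]
  have h5 := norm_sq_mul_measure_ball_le (δ := δ) hM0 (u := (w i).fst) fun h =>
    (norm_translateL2_sub_le h h3).trans (by gcongr)
  have h6 : ‖(w i).fst‖ ^ 2 - δ ^ 2 * M ^ 2 / 2 < ε ^ 2 / 2 :=
    lt_of_mul_lt_mul_left ((h5.trans h2).trans_lt h1) hβ0.le
  have h7 : (δ * M) ^ 2 < ε ^ 2 := by
    have : 0 ≤ δ * M := by positivity
    gcongr
  have : ‖(w i).fst‖ ^ 2 < ε ^ 2 := by nlinarith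
  exact lt_of_pow_lt_pow_left₀ 2 hε.le this

end Rellich

/-! ### Weak gradients; functions with zero weak gradient are constant -/

section WeakGradient

variable {d : ℕ} {Ω : Opens (E d)}

lemma memLp_smul_single (ψ : 𝓓(Ω, ℝ)) (i : Fin d) :
    MemLp (fun x => EuclideanSpace.single i (ψ x)) 2 (volume : Measure (E d)) := by
  have : Continuous fun x => EuclideanSpace.single i (ψ x) := by
    have h : (fun x => EuclideanSpace.single i (ψ x)) =
        fun x => ψ x • (EuclideanSpace.single i (1 : ℝ) : E d) := by
      ext x j
      by_cases hj : j = i <;> simp [hj]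
    rw [h]
    exact ψ.continuous.smul continuous_const
  exact this.memLp_of_hasCompactSupport (ψ.hasCompactSupport.comp_left
    (g := fun t : ℝ => (EuclideanSpace.single i t : E d)) (by simp))

/-- Written as an inner product, the pairing is visibly continuous in g, so weak-gradient identities
survive L² limits. -/
lemma integral_coord_mul_eq_inner (g : L2v d) (ψ : 𝓓(Ω, ℝ)) (i : Fin d) :
    ∫ x, g x i * ψ x = inner ℝ ((memLp_smul_single ψ i).toLp _) g := by
  rw [L2.inner_def]
  refine integral_congr_ae ?_
  filter_upwards [(memLp_smul_single ψ i).coeFn_toLp] with x hx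
  rw [hx, EuclideanSpace.inner_single_left]
  simp [mul_comm]

lemma memLp_gradient_coord (ψ : 𝓓(Ω, ℝ)) (i : Fin d) :
    MemLp (fun x => gradient ψ x i) 2 (volume : Measure (E d)) :=
  (Continuous.memLp_of_hasCompactSupport
    ((EuclideanSpace.proj (𝕜 := ℝ) i).continuous.comp ψ.continuous_gradient)
    (ψ.hasCompactSupport.gradient.comp_left (g := fun v : E d => v i) (by simp)))

lemma integral_mul_gradient_eq_inner (u : L2 d) (ψ : 𝓓(Ω, ℝ)) (i : Fin d) :
    ∫ x, u x * gradient ψ x i = inner ℝ ((memLp_gradient_coord ψ i).toLp _) u := by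
  rw [L2.inner_def]
  refine integral_congr_ae ?_
  filter_upwards [(memLp_gradient_coord ψ i).coeFn_toLp] with x hx
  rw [hx]; simp

lemma integral_mul_gradient_of_mem_sobolevZero {w : L2Pair d} (hw : w ∈ sobolevZero Ω)
    (ψ : 𝓓(Ω, ℝ)) (i : Fin d) :
    ∫ x, w.fst x * gradient ψ x i = - ∫ x, w.snd x i * ψ x := by
  refine sobolevZero_induction
    (P := fun w => ∫ x, w.fst x * gradient ψ x i = - ∫ x, w.snd x i * ψ x) ?_ (fun φ => ?_) hw
  · simp_rw [integral_coord_mul_eq_inner, integral_mul_gradient_eq_inner]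
    exact isClosed_eq (continuous_const.inner continuous_L2Pair_fst)
      (continuous_const.inner continuous_L2Pair_snd).neg
  · have h1 : ∫ x, (testPair Ω φ).fst x * gradient ψ x i = ∫ x, φ x * gradient ψ x i := by
      refine integral_congr_ae ?_
      filter_upwards [φ.memLp_two.coeFn_toLp] with x hx
      rw [testPair_fst, hx]
    have h2 : ∫ x, (testPair Ω φ).snd x i * ψ x = ∫ x, gradient φ x i * ψ x := by
      refine integral_congr_ae ?_
      filter_upwards [φ.memLp_gradient.coeFn_toLp] with x hx
      rw [testPair_snd, hx]
    rw [h1, h2, integral_mul_gradient_eq_neg φ.contDiff_one]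

/-- A locally integrable function on `ℝ^d` whose weak gradient vanishes is constant. -/
theorem exists_ae_eq_const_of_integral_mul_gradient_eq_zero {z : E d → ℝ}
    (hz : LocallyIntegrable z volume)
    (h : ∀ (ψ : 𝓓((⊤ : Opens (E d)), ℝ)) (i : Fin d), ∫ x, z x * gradient ψ x i = 0) :
    ∃ k : ℝ, z =ᵐ[volume] fun _ => k := by
  -- The convolution z ∗ g has gradient z ∗ ∇g, and this vanishes by `h` applied to the test
  -- function t ↦ g(x - t). So z ∗ g is constant.
  have hconst : ∀ g : E d → ℝ, ContDiff ℝ (⊤ : ℕ∞) g → HasCompactSupport g → ∀ x y : E d,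
      ∫ t, z t * g (x - t) = ∫ t, z t * g (y - t) := by
    intro g hg hgc
    have hg1 : ContDiff ℝ 1 g := hg.of_le (by exact_mod_cast le_top)
    have hder := hgc.hasFDerivAt_convolution_right (ContinuousLinearMap.mul ℝ ℝ) hz hg1
    refine is_const_of_fderiv_eq_zero (𝕜 := ℝ)
      (f := convolution z g (ContinuousLinearMap.mul ℝ ℝ) volume)
      (fun x => (hder x).differentiableAt) fun x => ?_
    rw [(hder x).fderiv]
    refine ContinuousLinearMap.coe_injective
      ((EuclideanSpace.basisFun (Fin d) ℝ).toBasis.ext fun i => ?_)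
    rw [ContinuousLinearMap.coe_coe, ContinuousLinearMap.coe_coe]
    simp only [OrthonormalBasis.coe_toBasis, EuclideanSpace.basisFun_apply,
      zero_apply]
    rw [convolution_precompR_apply _ hz (hgc.fderiv ℝ) (hg1.continuous_fderiv one_ne_zero)]
    rw [convolution_def]
    let ψ : 𝓓((⊤ : Opens (E d)), ℝ) :=
      ⟨fun t => g (x - t), hg.comp (by fun_prop),
        hgc.comp_homeomorph (Homeomorph.subLeft x), fun _ _ => trivial⟩
    have hψ := h ψ i
    rw [← neg_eq_zero, ← hψ, ← integral_neg]
    refine integral_congr_ae (Eventually.of_forall fun t => ?_)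
    have : HasFDerivAt ψ (-(fderiv ℝ g (x - t))) t := by
      have h1 : HasFDerivAt (fun t : E d => x - t) (-(ContinuousLinearMap.id ℝ (E d))) t :=
        (hasFDerivAt_id t).const_sub x
      have h2 := ((hg1.differentiable one_ne_zero (x - t)).hasFDerivAt).comp t h1
      exact h2.congr_fderiv (by ext v; simp)
    simp only [gradient_apply_eq_fderiv]
    rw [this.fderiv]
    simp
  -- Constancy of all these convolutions says that z and its translate by y have the same integral
  -- against every test function.
  have htrans : ∀ y : E d, (fun t => z (t + y)) =ᵐ[volume] z := by
    intro y
    have hmp := measurePreserving_translate y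
    have hz' : LocallyIntegrable (fun t => z (t + y)) volume := by
      rw [locallyIntegrable_iff] at hz ⊢
      intro K hK
      have hK' : IsCompact ((fun t => t + y) '' K) := hK.image (by fun_prop)
      have := (hmp.integrableOn_comp_preimage (measurableEmbedding_addRight y)).2 (hz _ hK')
      rwa [Set.preimage_image_eq _ (add_left_injective y)] at this
    refine ae_eq_of_integral_contDiff_smul_eq hz' hz fun g hg hgc => ?_
    have h1 : ∫ x, g x • z (x + y) = ∫ x, z x * g (x - y) := by
      rw [← integral_add_right_eq_self (fun x => z x * g (x - y)) y]
      simp [mul_comm]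
    have h2 := hconst (fun t => g (-t)) (hg.comp contDiff_neg)
      (hgc.comp_homeomorph (Homeomorph.neg _)) y 0
    rw [h1]
    simpa [mul_comm] using h2
  have hzm := hz.aestronglyMeasurable
  set z' := hzm.mk z
  have hz'm : Measurable z' := hzm.stronglyMeasurable_mk.measurable
  have hzz' : z =ᵐ[volume] z' := hzm.ae_eq_mk
  have htrans' : ∀ y : E d, ∀ᵐ t, z' (t + y) = z' t := by
    intro y
    filter_upwards [htrans y, hzz', (measurePreserving_translate y).quasiMeasurePreserving.ae hzz']
      with t h1 h2 h3
    rw [← h3, ← h2, h1]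
  -- The exceptional null set of t depends on y. Fubini, for the measurable representative z',
  -- supplies one t with z'(t + y) = z'(t) for almost all y.
  have hcomm := (Measure.ae_ae_comm (μ := (volume : Measure (E d)))
    (ν := (volume : Measure (E d))) (p := fun y t => z' (t + y) = z' t)
    (measurableSet_eq_fun (hz'm.comp (measurable_snd.add measurable_fst))
      (hz'm.comp measurable_snd))).1 (Eventually.of_forall htrans')
  obtain ⟨t, ht⟩ := hcomm.exists
  refine ⟨z' t, hzz'.trans ?_⟩
  have := (measurePreserving_add_right (volume : Measure (E d)) (-t)).quasiMeasurePreserving.ae ht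
  filter_upwards [this] with x hx
  rw [← hx]; congr 1; abel

end WeakGradient

/-! ### A weighted Poincaré inequality and potentials on ℝ^d -/

section Potential

variable {d : ℕ}

/-- The weights `(c + |x|)^{-(d+3)}`. -/
def weight (d : ℕ) (c : NNReal) (x : E d) : NNReal := ((c + ‖x‖₊) ^ (d + 3))⁻¹

lemma continuous_weight {c : NNReal} (hc : 0 < c) : Continuous (weight d c) :=
  Continuous.inv₀ (by fun_prop) fun x => (pow_pos (add_pos_of_pos_of_nonneg hc zero_le) _).ne'

lemma weight_pos {c : NNReal} (hc : 0 < c) (x : E d) : 0 < weight d c x :=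
  inv_pos.2 (pow_pos (add_pos_of_pos_of_nonneg hc zero_le) _)

/-- The offsets 2 and 1 differ so as to absorb a shift by a point of the unit ball. -/
lemma weight_add_le {x h : E d} (hx : ‖x‖ ≤ 1) : weight d 2 (x + h) ≤ weight d 1 h := by
  unfold weight
  have : 1 + ‖h‖₊ ≤ 2 + ‖x + h‖₊ := by
    rw [← NNReal.coe_le_coe]
    push_cast
    have := norm_sub_le (x + h) x
    rw [add_sub_cancel_left] at this
    linarith
  gcongr

/-- The exponent d + 3 of the weight is chosen here: the translation estimate costs a factor
quadratic in |h|, and (1 + |h|)^{-(d+1)} remains integrable. -/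
lemma weight_mul_sq_le (h : E d) :
    (weight d 1 h : ℝ≥0∞) * (1 + ‖h‖ₑ) ^ 2 ≤ ENNReal.ofReal ((1 + ‖h‖) ^ (-((d : ℝ) + 1))) := by
  have h0 : (0 : ℝ) < 1 + ‖h‖ := by positivity
  have : (weight d 1 h : ℝ≥0∞) * (1 + ‖h‖ₑ) ^ 2 =
      ENNReal.ofReal (((1 + ‖h‖) ^ (d + 3))⁻¹ * (1 + ‖h‖) ^ 2) := by
    rw [ENNReal.ofReal_mul (by positivity), ENNReal.ofReal_pow h0.le,
      ENNReal.ofReal_add zero_le_one (norm_nonneg _), ENNReal.ofReal_one, ofReal_norm]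
    congr 1
    rw [← ENNReal.ofReal_coe_nnreal]
    simp [weight]
  rw [this]
  refine ENNReal.ofReal_le_ofReal (le_of_eq ?_)
  rw [Real.rpow_neg h0.le, show ((d : ℝ) + 1) = ((d + 1 : ℕ) : ℝ) by push_cast; rfl,
    Real.rpow_natCast, pow_add _ d 3, pow_add _ d 1]
  field_simp

lemma lintegral_weight_mul_sq_lt_top :
    ∫⁻ h : E d, (weight d 1 h : ℝ≥0∞) * (1 + ‖h‖ₑ) ^ 2 < ∞ :=
  (lintegral_mono weight_mul_sq_le).trans_lt (finite_integral_one_add_norm (by simp))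

variable (d) in
/-- The finite measure with density `(2 + |x|)^{-(d+3)}`. -/
def weightMeasure : Measure (E d) := volume.withDensity fun x => (weight d 2 x : ℝ≥0∞)

instance : IsFiniteMeasure (weightMeasure d) := by
  refine isFiniteMeasure_withDensity ((lintegral_mono fun x => ?_).trans_lt
    (lintegral_weight_mul_sq_lt_top (d := d))).ne
  have h1 := weight_add_le (d := d) (x := 0) (h := x) (by simp)
  rw [zero_add] at h1
  calc (weight d 2 x : ℝ≥0∞) ≤ weight d 1 x * 1 := by rw [mul_one]; exact_mod_cast h1
    _ ≤ _ := by gcongr; exact one_le_pow₀ (by simp)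

variable (d) in
/-- The uniform probability measure on the unit ball. -/
def ballMeasure : Measure (E d) :=
  (volume (Metric.ball (0 : E d) 1))⁻¹ • volume.restrict (Metric.ball (0 : E d) 1)

instance : IsProbabilityMeasure (ballMeasure d) := ⟨by
  simp only [ballMeasure, Measure.smul_apply, Measure.restrict_apply_univ, smul_eq_mul]
  exact ENNReal.inv_mul_cancel (Metric.measure_ball_pos volume _ one_pos).ne'
    measure_ball_lt_top.ne⟩

variable (d) in
/-- The constant in the weighted Poincaré inequality `lintegral_sub_average_sq_le`. -/
def weightConst : ℝ≥0∞ := (volume (Metric.ball (0 : E d) 1))⁻¹ *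
  ∫⁻ h : E d, (weight d 1 h : ℝ≥0∞) * (1 + ‖h‖ₑ) ^ 2

lemma weightConst_ne_top : weightConst d ≠ ∞ :=
  ENNReal.mul_ne_top (ENNReal.inv_ne_top.2 (Metric.measure_ball_pos volume _ one_pos).ne')
    lintegral_weight_mul_sq_lt_top.ne

lemma volume_unitBall_inv_ne_top : (volume (Metric.ball (0 : E d) 1))⁻¹ ≠ ∞ :=
  ENNReal.inv_ne_top.2 (Metric.measure_ball_pos volume _ one_pos).ne'

lemma Continuous.integrable_ballMeasure {u : E d → ℝ} (hu : Continuous u) :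
    Integrable u (ballMeasure d) := by
  refine Integrable.smul_measure ?_ volume_unitBall_inv_ne_top
  exact (hu.continuousOn.integrableOn_compact
    (isCompact_closedBall 0 1)).mono_set Metric.ball_subset_closedBall

lemma enorm_sub_average_sq_le {u : E d → ℝ} (hu : Continuous u) (x : E d) :
    ‖u x - ∫ y, u y ∂(ballMeasure d)‖ₑ ^ 2 ≤ ∫⁻ y, ‖u x - u y‖ₑ ^ 2 ∂(ballMeasure d) := by
  have h1 : u x - ∫ y, u y ∂(ballMeasure d) = ∫ y, (u x - u y) ∂(ballMeasure d) := by
    rw [integral_sub (integrable_const _) hu.integrable_ballMeasure]; simp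
  rw [h1]
  refine (pow_le_pow_left' (enorm_integral_le_lintegral_enorm _) 2).trans ?_
  exact lintegral_enorm_sq_le (continuous_const.sub hu).aestronglyMeasurable

/-- For a fixed displacement h the weight is at most `weight d 1 h`, since y lies in the unit ball;
the rest is the translation estimate over all of ℝ^d. -/
lemma lintegral_ballMeasure_le {u : E d → ℝ} (hu : ContDiff ℝ 1 u) (h : E d) :
    ∫⁻ y, (weight d 2 (y + h) : ℝ≥0∞) * ‖u (y + h) - u y‖ₑ ^ 2 ∂(ballMeasure d) ≤
      ((volume (Metric.ball (0 : E d) 1))⁻¹ * ((weight d 1 h : ℝ≥0∞) * (1 + ‖h‖ₑ) ^ 2)) *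
        ∫⁻ x, ‖gradient u x‖ₑ ^ 2 := by
  rw [ballMeasure, lintegral_smul_measure, smul_eq_mul, mul_assoc, mul_assoc]
  gcongr
  calc ∫⁻ y in Metric.ball (0 : E d) 1, (weight d 2 (y + h) : ℝ≥0∞) * ‖u (y + h) - u y‖ₑ ^ 2
      ≤ ∫⁻ y in Metric.ball (0 : E d) 1, (weight d 1 h : ℝ≥0∞) * ‖u (y + h) - u y‖ₑ ^ 2 := by
        refine setLIntegral_mono' Metric.isOpen_ball.measurableSet fun y hy => ?_
        gcongr
        exact weight_add_le (by simpa using (Metric.mem_ball.1 hy).le)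
    _ ≤ ∫⁻ y, (weight d 1 h : ℝ≥0∞) * ‖u (y + h) - u y‖ₑ ^ 2 := setLIntegral_le_lintegral _ _
    _ = (weight d 1 h : ℝ≥0∞) * ∫⁻ y, ‖u (y + h) - u y‖ₑ ^ 2 :=
        lintegral_const_mul' _ _ ENNReal.coe_ne_top
    _ ≤ _ := by
        gcongr
        refine (lintegral_sub_translate_sq_le hu h).trans ?_
        gcongr
        exact le_add_self

lemma measurable_weight {c : NNReal} (hc : 0 < c) :
    Measurable fun x : E d => (weight d c x : ℝ≥0∞) :=
  (continuous_weight hc).measurable.coe_nnreal_ennreal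

/-- Substitute x = y + h and integrate over y first. The bound for fixed h is then integrable in h,
with total constant `weightConst`. -/
lemma lintegral_lintegral_sub_sq_le {u : E d → ℝ} (hu : ContDiff ℝ 1 u) :
    ∫⁻ x, ∫⁻ y, (weight d 2 x : ℝ≥0∞) * ‖u x - u y‖ₑ ^ 2 ∂(ballMeasure d) ≤
      weightConst d * ∫⁻ x, ‖gradient u x‖ₑ ^ 2 := by
  have hm1 : Measurable (Function.uncurry fun x y : E d =>
      (weight d 2 x : ℝ≥0∞) * ‖u x - u y‖ₑ ^ 2) :=
    ((measurable_weight two_pos).comp measurable_fst).mul (Measurable.pow_const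
      (((hu.continuous.comp continuous_fst).sub
        (hu.continuous.comp continuous_snd)).enorm.measurable) 2)
  have hm2 : Measurable (Function.uncurry fun y h : E d =>
      (weight d 2 (y + h) : ℝ≥0∞) * ‖u (y + h) - u y‖ₑ ^ 2) :=
    ((measurable_weight two_pos).comp (measurable_fst.add measurable_snd)).mul
      (Measurable.pow_const (((hu.continuous.comp (continuous_fst.add continuous_snd)).sub
        (hu.continuous.comp continuous_fst)).enorm.measurable) 2)
  have hm3 : AEMeasurable (fun h : E d => (volume (Metric.ball (0 : E d) 1))⁻¹ *
      ((weight d 1 h : ℝ≥0∞) * (1 + ‖h‖ₑ) ^ 2)) volume :=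
    (((measurable_weight one_pos).mul
      ((continuous_const.add continuous_enorm).measurable.pow_const 2)).const_mul _).aemeasurable
  rw [lintegral_lintegral_swap hm1.aemeasurable]
  have h1 : ∀ y : E d, ∫⁻ x, (weight d 2 x : ℝ≥0∞) * ‖u x - u y‖ₑ ^ 2 =
      ∫⁻ h, (weight d 2 (y + h) : ℝ≥0∞) * ‖u (y + h) - u y‖ₑ ^ 2 := fun y =>
    (lintegral_add_left_eq_self (fun x => (weight d 2 x : ℝ≥0∞) * ‖u x - u y‖ₑ ^ 2) y).symm
  simp_rw [h1]
  rw [lintegral_lintegral_swap hm2.aemeasurable]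
  refine (lintegral_mono fun h => lintegral_ballMeasure_le hu h).trans_eq ?_
  rw [lintegral_mul_const'' _ hm3, lintegral_const_mul' _ _ volume_unitBall_inv_ne_top, weightConst]

/-- A weighted Poincaré inequality on `ℝ^d`. -/
lemma lintegral_sub_average_sq_le {u : E d → ℝ} (hu : ContDiff ℝ 1 u) :
    ∫⁻ x, ‖u x - ∫ y, u y ∂(ballMeasure d)‖ₑ ^ 2 ∂(weightMeasure d) ≤
      weightConst d * ∫⁻ x, ‖gradient u x‖ₑ ^ 2 := by
  refine le_trans ?_ (lintegral_lintegral_sub_sq_le hu)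
  have hm : Measurable fun x => ‖u x - ∫ y, u y ∂(ballMeasure d)‖ₑ ^ 2 :=
    ((hu.continuous.sub continuous_const).enorm.measurable).pow_const 2
  rw [weightMeasure, lintegral_withDensity_eq_lintegral_mul _ (measurable_weight two_pos) hm]
  refine lintegral_mono fun x => ?_
  rw [lintegral_const_mul' _ _ ENNReal.coe_ne_top, Pi.mul_apply]
  gcongr
  exact enorm_sub_average_sq_le hu.continuous x

lemma memLp_weightMeasure_sub_average (φ : 𝓓((⊤ : Opens (E d)), ℝ)) :
    MemLp (fun x => φ x - ∫ y, φ y ∂(ballMeasure d)) 2 (weightMeasure d) := by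
  obtain ⟨C, hC⟩ := φ.continuous.bounded_above_of_compact_support φ.hasCompactSupport
  exact (MemLp.of_bound φ.continuous.aestronglyMeasurable C (Eventually.of_forall hC)).sub
    (memLp_const _)

lemma TestFunction.integrable_ballMeasure (φ : 𝓓((⊤ : Opens (E d)), ℝ)) :
    Integrable φ (ballMeasure d) := by
  obtain ⟨C, hC⟩ := φ.continuous.bounded_above_of_compact_support φ.hasCompactSupport
  exact Integrable.of_bound φ.continuous.aestronglyMeasurable C (Eventually.of_forall hC)

/-- The class of `φ` minus its average over the unit ball in the weighted `L²` space. -/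
def normalizedTest (φ : 𝓓((⊤ : Opens (E d)), ℝ)) : Lp ℝ 2 (weightMeasure d) :=
  (memLp_weightMeasure_sub_average φ).toLp _

lemma enorm_normalizedTest_sub_le (φ ψ : 𝓓((⊤ : Opens (E d)), ℝ)) :
    ‖normalizedTest φ - normalizedTest ψ‖ₑ ^ 2 ≤ weightConst d *
      ‖φ.memLp_gradient.toLp (gradient φ) - ψ.memLp_gradient.toLp (gradient ψ)‖ₑ ^ 2 := by
  have h1 : ‖normalizedTest φ - normalizedTest ψ‖ₑ ^ 2 =
      ∫⁻ x, ‖(φ - ψ) x - ∫ y, (φ - ψ) y ∂(ballMeasure d)‖ₑ ^ 2 ∂(weightMeasure d) := by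
    rw [normalizedTest, normalizedTest, ← MemLp.toLp_sub, MemLp.enorm_toLp_sq]
    refine lintegral_congr fun x => ?_
    have : ∫ y, (φ - ψ) y ∂(ballMeasure d) =
        ∫ y, φ y ∂(ballMeasure d) - ∫ y, ψ y ∂(ballMeasure d) :=
      integral_sub φ.integrable_ballMeasure ψ.integrable_ballMeasure
    rw [this]
    congr 2
    simp only [Pi.sub_apply]
    change _ = φ x - ψ x - _
    ring
  have h2 : φ.memLp_gradient.toLp (gradient φ) - ψ.memLp_gradient.toLp (gradient ψ) =
      (φ - ψ).memLp_gradient.toLp (gradient (φ - ψ : 𝓓((⊤ : Opens (E d)), ℝ))) := by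
    have := congrArg WithLp.snd (map_sub (testPair (⊤ : Opens (E d))) φ ψ)
    exact this.symm
  rw [h1, h2, MemLp.enorm_toLp_sq]
  exact lintegral_sub_average_sq_le (φ - ψ).contDiff_one

lemma norm_normalizedTest_sub_le (φ ψ : 𝓓((⊤ : Opens (E d)), ℝ)) :
    ‖normalizedTest φ - normalizedTest ψ‖ ≤ Real.sqrt (weightConst d).toReal *
      ‖φ.memLp_gradient.toLp (gradient φ) - ψ.memLp_gradient.toLp (gradient ψ)‖ := by
  refine (sq_le_sq₀ (norm_nonneg _) (by positivity)).1 ?_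
  rw [mul_pow, Real.sq_sqrt ENNReal.toReal_nonneg]
  have := ENNReal.toReal_mono (ENNReal.mul_ne_top weightConst_ne_top (by simp))
    (enorm_normalizedTest_sub_le φ ψ)
  simpa using this

/-- The representative is ∂ᵢψ divided by the weight, which is continuous with compact support. This
makes the weak-gradient pairing continuous on the weighted space. -/
lemma integral_mul_gradient_eq_inner_weight
    (ψ : 𝓓((⊤ : Opens (E d)), ℝ)) (i : Fin d) :
    ∃ m : Lp ℝ 2 (weightMeasure d), ∀ z : Lp ℝ 2 (weightMeasure d),
      ∫ x, z x * gradient ψ x i = inner ℝ m z := by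
  have hc : Continuous fun x => ((weight d 2 x : ℝ))⁻¹ * gradient ψ x i :=
    (Continuous.inv₀ (NNReal.continuous_coe.comp (continuous_weight two_pos))
      fun x => (NNReal.coe_pos.2 (weight_pos two_pos x)).ne').mul
      ((EuclideanSpace.proj (𝕜 := ℝ) i).continuous.comp ψ.continuous_gradient)
  have hs : HasCompactSupport fun x => ((weight d 2 x : ℝ))⁻¹ * gradient ψ x i :=
    (ψ.hasCompactSupport.gradient.comp_left (g := fun v : E d => v i) (by simp)).mul_left
  have hm : MemLp (fun x => ((weight d 2 x : ℝ))⁻¹ * gradient ψ x i) 2 (weightMeasure d) :=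
    hc.memLp_of_hasCompactSupport hs
  refine ⟨hm.toLp _, fun z => ?_⟩
  rw [L2.inner_def]
  have : ∫ x, inner ℝ (hm.toLp _ x) (z x) ∂(weightMeasure d) =
      ∫ x, z x * (((weight d 2 x : ℝ))⁻¹ * gradient ψ x i) ∂(weightMeasure d) := by
    refine integral_congr_ae ?_
    filter_upwards [hm.coeFn_toLp] with x hx
    rw [hx]; simp
  rw [this]
  refine Eq.trans ?_
    (integral_withDensity_eq_integral_smul (continuous_weight two_pos).measurable _).symm
  refine integral_congr_ae (Eventually.of_forall fun x => ?_)
  have : (weight d 2 x : ℝ) ≠ 0 := (NNReal.coe_pos.2 (weight_pos two_pos x)).ne'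
  simp only [NNReal.smul_def, smul_eq_mul]
  field_simp

/-- On a bounded set the weight is bounded below, so Lebesgue measure there is dominated by a
multiple of the weighted measure. -/
lemma memLp_restrict_of_memLp_weightMeasure {z : E d → ℝ} (hz : MemLp z 2 (weightMeasure d))
    {K : Set (E d)} (hK : IsCompact K) : MemLp z 2 (volume.restrict K) := by
  obtain ⟨R, hR⟩ := hK.isBounded.exists_norm_le
  set c : NNReal := (2 + R.toNNReal) ^ (d + 3)
  refine MemLp.of_measure_le_smul (c := (c : ℝ≥0∞)) ENNReal.coe_ne_top ?_ hz
  have hw : Measurable fun x => (weight d 2 x : ℝ≥0∞) :=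
    (continuous_weight two_pos).measurable.coe_nnreal_ennreal
  rw [weightMeasure, ← withDensity_smul _ hw, ← withDensity_indicator_one hK.measurableSet]
  refine withDensity_mono (Eventually.of_forall fun x => ?_)
  by_cases hx : x ∈ K
  · rw [Set.indicator_of_mem hx, Pi.one_apply, Pi.smul_apply, smul_eq_mul]
    have h1 : (2 + ‖x‖₊) ^ (d + 3) ≤ c := by
      have : ‖x‖₊ ≤ R.toNNReal := by
        rw [← norm_toNNReal]; exact Real.toNNReal_le_toNNReal (hR x hx)
      exact pow_le_pow_left' (add_le_add_right this 2) _
    have h2 : 0 < (2 + ‖x‖₊) ^ (d + 3) := by positivity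
    have : 1 ≤ c * weight d 2 x := by
      rw [weight, ← div_eq_mul_inv, one_le_div h2]; exact h1
    exact_mod_cast this
  · rw [Set.indicator_of_notMem hx]; exact zero_le

/-- Every element of the closure of the gradients of test functions is the gradient of an element of
`Ḣ¹(ℝ^d)`. -/
theorem exists_memHomH1_of_mem_gradientClosure {g : L2v d} (hg : g ∈ gradientClosure d) :
    ∃ z : E d → ℝ, MemHomH1 z g := by
  obtain ⟨s, hs, hlim⟩ := mem_closure_iff_seq_limit.1 (show g ∈ closure _ from hg)
  choose φ hφ using hs
  have hφ' : ∀ n, (φ n).memLp_gradient.toLp (gradient (φ n)) = s n := hφ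
  -- Gradients alone leave the constants free. After subtraction of the mean over the unit ball,
  -- convergence of gradients forces convergence in the weighted space.
  have hcauchy : CauchySeq fun n => normalizedTest (φ n) := by
    have hsC := hlim.cauchySeq
    rw [Metric.cauchySeq_iff] at hsC ⊢
    intro ε hε
    set S := Real.sqrt (weightConst d).toReal
    obtain ⟨N, hN⟩ := hsC (ε / (S + 1)) (by positivity)
    refine ⟨N, fun m hm n hn => ?_⟩
    have h1 := norm_normalizedTest_sub_le (φ m) (φ n)
    have h2 := hN m hm n hn
    rw [dist_eq_norm, lt_div_iff₀ (by positivity)] at h2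
    rw [hφ', hφ'] at h1
    rw [dist_eq_norm]
    nlinarith [norm_nonneg (s m - s n)]
  obtain ⟨z, hz⟩ := cauchySeq_tendsto_of_complete hcauchy
  have hzK : ∀ K : Set (E d), IsCompact K → MemLp z 2 (volume.restrict K) := fun K hK =>
    memLp_restrict_of_memLp_weightMeasure (Lp.memLp z) hK
  have hzloc : LocallyIntegrable z volume := by
    rw [locallyIntegrable_iff]
    intro K hK
    have : IsFiniteMeasure (volume.restrict K) := ⟨by simpa using hK.measure_lt_top⟩
    exact (hzK K hK).integrable one_le_two
  refine ⟨z, hzK, Lp.memLp g, ?_, ?_, ?_⟩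
  · simpa [locallyIntegrableOn_univ] using hzloc
  · simpa [locallyIntegrableOn_univ] using (Lp.memLp g).locallyIntegrable one_le_two
  intro ψ i
  simp only [Opens.coe_top, Measure.restrict_univ]
  obtain ⟨m, hm⟩ := integral_mul_gradient_eq_inner_weight ψ i
  rw [hm, integral_coord_mul_eq_inner]
  have hL : Tendsto (fun n => inner ℝ m (normalizedTest (φ n))) atTop (𝓝 (inner ℝ m z)) :=
    tendsto_const_nhds.inner hz
  have hR : Tendsto (fun n => -inner ℝ ((memLp_smul_single ψ i).toLp _) (s n)) atTop
      (𝓝 (-inner ℝ ((memLp_smul_single ψ i).toLp _) g)) := (tendsto_const_nhds.inner hlim).neg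
  refine tendsto_nhds_unique hL (hR.congr fun n => ?_)
  rw [← hm, ← integral_coord_mul_eq_inner]
  -- The subtracted mean has zero gradient, so classical integration by parts still applies to φ_n -
  -- c.
  set c := ∫ y, φ n y ∂(ballMeasure d)
  have h1 : ∫ x, normalizedTest (φ n) x * gradient ψ x i =
      ∫ x, (φ n x - c) * gradient ψ x i := by
    have hvol : (volume : Measure (E d)) ≪ weightMeasure d :=
      withDensity_absolutelyContinuous'
        (continuous_weight two_pos).measurable.coe_nnreal_ennreal.aemeasurable
        (Eventually.of_forall fun x => by simpa using (weight_pos two_pos x).ne')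
    refine integral_congr_ae ?_
    filter_upwards [hvol.ae_le (memLp_weightMeasure_sub_average (φ n)).coeFn_toLp] with x hx
    rw [normalizedTest, hx]
  have h2 : ∫ x, s n x i * ψ x = ∫ x, gradient (fun x => φ n x - c) x i * ψ x := by
    refine integral_congr_ae ?_
    rw [← hφ']
    filter_upwards [(φ n).memLp_gradient.coeFn_toLp] with x hx
    rw [hx, gradient, gradient, fderiv_sub_const]
  rw [h1, h2, integral_mul_gradient_eq_neg ((φ n).contDiff_one.sub contDiff_const)]

end Potential

/-! ### Dominated convergence in L² -/

section Dominated

/-- Dominated convergence in `L²`. -/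
lemma tendsto_toLp_of_dominated {α F ι : Type*} [MeasurableSpace α] {μ : Measure α}
    [NormedAddCommGroup F] {l : Filter ι} [l.IsCountablyGenerated] {f : ι → α → F} {g : α → F}
    (hf : ∀ i, MemLp (f i) 2 μ) (hg : MemLp g 2 μ) {B : α → ℝ} (hB : MemLp B 2 μ)
    (hfB : ∀ᶠ i in l, ∀ᵐ x ∂μ, ‖f i x - g x‖ ≤ B x)
    (hlim : ∀ᵐ x ∂μ, Tendsto (fun i => f i x) l (𝓝 (g x))) :
    Tendsto (fun i => (hf i).toLp (f i)) l (𝓝 (hg.toLp g)) := by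
  rw [tendsto_iff_norm_sub_tendsto_zero]
  have hsq : ∀ i, ‖(hf i).toLp (f i) - hg.toLp g‖ ^ 2 = ∫ x, ‖f i x - g x‖ ^ 2 ∂μ := by
    intro i
    rw [← MemLp.toLp_sub, Lp.norm_toLp]
    have h := eLpNorm_nnreal_pow_eq_lintegral (p := 2) (μ := μ) (f := f i - g) two_ne_zero
    have hm : AEStronglyMeasurable (fun x => ‖f i x - g x‖ ^ 2) μ :=
      ((hf i).sub hg).1.norm.pow 2
    rw [integral_eq_lintegral_of_nonneg_ae (Eventually.of_forall fun x => sq_nonneg _) hm,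
      ← ENNReal.toReal_pow]
    congr 1
    have h' : eLpNorm (f i - g) 2 μ ^ 2 = ∫⁻ x, ‖(f i - g) x‖ₑ ^ 2 ∂μ := by simpa using h
    rw [h']
    refine lintegral_congr fun x => ?_
    rw [ENNReal.ofReal_pow (norm_nonneg _), ofReal_norm]; rfl
  have h0 : Tendsto (fun i => ∫ x, ‖f i x - g x‖ ^ 2 ∂μ) l (𝓝 (∫ _, (0 : ℝ) ∂μ)) := by
    refine tendsto_integral_filter_of_dominated_convergence (fun x => B x ^ 2)
      (Eventually.of_forall fun i => ((hf i).sub hg).1.norm.pow 2) ?_ hB.integrable_sq ?_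
    · filter_upwards [hfB] with i hi
      filter_upwards [hi] with x hx
      rw [norm_pow, norm_norm]
      gcongr
    · filter_upwards [hlim] with x hx
      have := ((hx.sub_const (g x)).norm).pow 2
      simpa using this
  rw [integral_zero] at h0
  have := (Real.continuous_sqrt.tendsto 0).comp h0
  rw [Real.sqrt_zero] at this
  refine this.congr fun i => ?_
  rw [Function.comp_apply, ← hsq, Real.sqrt_sq (norm_nonneg _)]

end Dominated

/-! ### Truncation of smooth functions -/

section Cutoff

variable {d : ℕ}

/-- Gradients in `L²` of square integrable smooth functions are limits of gradients of test
functions. -/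
theorem gradient_mem_gradientClosure_of_memLp {u : E d → ℝ} (hu : ContDiff ℝ (⊤ : ℕ∞) u)
    (hu2 : MemLp u 2 volume) (hgu2 : MemLp (gradient u) 2 volume) :
    hgu2.toLp (gradient u) ∈ gradientClosure d := by
  have hu1 : Differentiable ℝ u := hu.differentiable (by simp)
  let f : ContDiffBump (0 : E d) := ⟨1, 2, one_pos, one_lt_two⟩
  have hf1 : ContDiff ℝ 1 f := f.contDiff
  obtain ⟨C, hC⟩ := hf1.continuous_gradient.bounded_above_of_compact_support
    f.hasCompactSupport.gradient
  let c : ℕ → ℝ := fun k => 1 / ((k : ℝ) + 1)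
  have hc0 : ∀ k, 0 < c k := fun k => by positivity
  have hc1 : ∀ k, c k ≤ 1 := fun k => by
    rw [div_le_one (by positivity)]; linarith [Nat.cast_nonneg (α := ℝ) k]
  have hclim : Tendsto c atTop (𝓝 0) := tendsto_one_div_add_atTop_nhds_zero_nat
  -- Cutting off at scale 1/c_k produces the extra term c_k u ∇f(c_k x), which is dominated by a
  -- multiple of |u| and tends to zero; this is where u ∈ L² enters.
  let φ : ℕ → 𝓓((⊤ : Opens (E d)), ℝ) := fun k =>
    ⟨fun x => f (c k • x) * u x, (f.contDiff.comp (by fun_prop)).mul hu,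
      (f.hasCompactSupport.comp_smul (hc0 k).ne').mul_right, fun _ _ => trivial⟩
  have hgrad : ∀ k x, gradient (φ k) x =
      f (c k • x) • gradient u x + (u x * c k) • gradient f (c k • x) := by
    intro k x
    have h1 : HasFDerivAt (fun x : E d => f (c k • x))
        ((fderiv ℝ f (c k • x)).comp (c k • ContinuousLinearMap.id ℝ (E d))) x :=
      ((hf1.differentiable one_ne_zero (c k • x)).hasFDerivAt).comp x
        ((hasFDerivAt_id x).const_smul (c k))
    have h2 : HasFDerivAt (φ k) _ x := h1.mul (hu1 x).hasFDerivAt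
    rw [gradient, h2.fderiv, map_add, map_smul, gradient, gradient, mul_smul,
      ← map_smul _ (c k)]
    simp
  have hlim := tendsto_toLp_of_dominated (l := atTop) (fun k => (φ k).memLp_gradient) hgu2
    (B := fun x => ‖gradient u x‖ + C * ‖u x‖) (hgu2.norm.add (hu2.norm.const_mul C)) ?_ ?_
  · exact isClosed_gradientClosure.mem_of_tendsto hlim
      (Eventually.of_forall fun k => gradient_mem_gradientClosure (φ k))
  · refine Eventually.of_forall fun k => Eventually.of_forall fun x => ?_
    have : gradient (φ k) x - gradient u x =
        (f (c k • x) - 1) • gradient u x + (u x * c k) • gradient f (c k • x) := by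
      rw [hgrad, sub_smul, one_smul]; abel
    rw [this]
    refine (norm_add_le _ _).trans (add_le_add ?_ ?_)
    · rw [norm_smul]
      refine mul_le_of_le_one_left (norm_nonneg _) ?_
      rw [Real.norm_eq_abs, abs_le]
      constructor <;> linarith [f.nonneg (x := c k • x), f.le_one (x := c k • x)]
    · rw [norm_smul, norm_mul, mul_comm C]
      have : ‖c k‖ ≤ 1 := by rw [Real.norm_of_nonneg (hc0 k).le]; exact hc1 k
      refine mul_le_mul ?_ (hC _) (norm_nonneg _) (norm_nonneg _)
      exact mul_le_of_le_one_right (norm_nonneg _) this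
  · refine Eventually.of_forall fun x => ?_
    simp_rw [hgrad]
    have h0 : Tendsto (fun k => c k • x) atTop (𝓝 0) := by simpa using hclim.smul_const x
    have h1 : Tendsto (fun k => f (c k • x)) atTop (𝓝 (f 0)) :=
      (f.continuous.tendsto 0).comp h0
    have h2 : Tendsto (fun k => gradient f (c k • x)) atTop (𝓝 (gradient f 0)) :=
      (hf1.continuous_gradient.tendsto 0).comp h0
    have hf0 : f (0 : E d) = 1 := f.one_of_mem_closedBall (by simp [f])
    have h3 := (h1.smul_const (gradient u x)).add ((hclim.const_mul (u x)).smul h2)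
    simpa [hf0] using h3

end Cutoff

/-! ### Gradients are curl free -/

section CurlFree

variable {d : ℕ}

lemma memLp_single_coord (n : L2v d) (i j : Fin d) :
    MemLp (fun x => (EuclideanSpace.single j (n x i) : E d)) 2 volume := by
  let L : E d →L[ℝ] E d := ContinuousLinearMap.smulRight (EuclideanSpace.proj (𝕜 := ℝ) i)
    (EuclideanSpace.single j (1 : ℝ) : E d)
  have : (fun x => (EuclideanSpace.single j (n x i) : E d)) = fun x => L (n x) := by
    ext x k
    by_cases hk : k = j <;> simp [L, hk]
  rw [this]
  exact L.comp_memLp' (Lp.memLp n)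

/-- The vector field `n_i e_j - n_j e_i`. -/
def curlField (n : L2v d) (i j : Fin d) : L2v d :=
  (memLp_single_coord n i j).toLp _ - (memLp_single_coord n j i).toLp _

lemma inner_single_coord (n g : L2v d) (i j : Fin d) :
    inner ℝ ((memLp_single_coord n i j).toLp _) g = ∫ x, n x i * g x j := by
  rw [L2.inner_def]
  refine integral_congr_ae ?_
  filter_upwards [(memLp_single_coord n i j).coeFn_toLp] with x hx
  rw [hx, EuclideanSpace.inner_single_left]
  simp

lemma inner_curlField (n g : L2v d) (i j : Fin d) :
    inner ℝ (curlField n i j) g = (∫ x, n x i * g x j) - ∫ x, n x j * g x i := by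
  rw [curlField, inner_sub_left, inner_single_coord, inner_single_coord]

lemma TestFunction.contDiff_fderiv_apply {Ω : Opens (E d)} (φ : 𝓓(Ω, ℝ)) (v : E d) :
    ContDiff ℝ (⊤ : ℕ∞) fun x => fderiv ℝ φ x v :=
  (φ.contDiff.fderiv_right (m := (⊤ : ℕ∞)) (by simp)).clm_apply contDiff_const

/-- The partial derivatives of a test function. -/
def TestFunction.partialDeriv {Ω : Opens (E d)} (φ : 𝓓(Ω, ℝ)) (i : Fin d) : 𝓓(Ω, ℝ) :=
  ⟨fun x => fderiv ℝ φ x (EuclideanSpace.single i 1), φ.contDiff_fderiv_apply _,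
    (φ.hasCompactSupport.fderiv ℝ).comp_left
      (g := fun L : E d →L[ℝ] ℝ => L (EuclideanSpace.single i (1 : ℝ))) rfl,
    (closure_minimal (fun x hx => subset_tsupport _ (by
      intro h0
      apply hx
      simp [h0])) (isClosed_tsupport _)).trans
      ((tsupport_fderiv_subset ℝ).trans φ.tsupport_subset)⟩

lemma TestFunction.partialDeriv_apply {Ω : Opens (E d)} (φ : 𝓓(Ω, ℝ)) (i : Fin d) (x : E d) :
    φ.partialDeriv i x = gradient φ x i := (gradient_apply_eq_fderiv _ _ _).symm

lemma TestFunction.gradient_partialDeriv_comm {Ω : Opens (E d)} (φ : 𝓓(Ω, ℝ)) (i j : Fin d)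
    (x : E d) : gradient (φ.partialDeriv i) x j = gradient (φ.partialDeriv j) x i := by
  rw [gradient_apply_eq_fderiv, gradient_apply_eq_fderiv]
  have hd2 : DifferentiableAt ℝ (fderiv ℝ φ) x :=
    (φ.contDiff.fderiv_right (m := 1)
      (WithTop.coe_le_coe.2 (le_top : (2 : ℕ∞) ≤ ⊤))).differentiable one_ne_zero x
  have h : ∀ i : Fin d, fderiv ℝ (φ.partialDeriv i) x =
      (fderiv ℝ (fderiv ℝ φ) x).flip (EuclideanSpace.single i 1) := by
    intro i
    have := hd2.hasFDerivAt.clm_apply (hasFDerivAt_const (EuclideanSpace.single i (1 : ℝ)) x)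
    refine HasFDerivAt.fderiv (this.congr_fderiv ?_)
    ext v; simp
  rw [h, h]
  have hsymm : IsSymmSndFDerivAt ℝ φ x := φ.contDiff.contDiffAt.isSymmSndFDerivAt
    (by simpa using WithTop.coe_le_coe.2 (le_top : (2 : ℕ∞) ≤ ⊤))
  exact hsymm _ _

/-- Moving the derivative from z to the test function turns both terms into -∫ z ∂ᵢ∂ⱼφ, and second
derivatives commute. -/
lemma inner_curlField_gradient_eq_zero {z : E d → ℝ} {g : L2v d} (hz : MemHomH1 z g)
    (i j : Fin d) (φ : 𝓓((⊤ : Opens (E d)), ℝ)) :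
    inner ℝ (curlField g i j) (φ.memLp_gradient.toLp (gradient φ)) = 0 := by
  have h := hz.2.2.2.2
  simp only [Opens.coe_top, Measure.restrict_univ] at h
  have h1 : ∀ i j : Fin d, ∫ x, g x i * φ.memLp_gradient.toLp (gradient φ) x j =
      - ∫ x, z x * gradient (φ.partialDeriv j) x i := by
    intro i j
    rw [h, neg_neg]
    refine integral_congr_ae ?_
    filter_upwards [φ.memLp_gradient.coeFn_toLp] with x hx
    rw [hx, TestFunction.partialDeriv_apply]
  rw [inner_curlField, h1, h1, sub_eq_zero]
  simp_rw [φ.gradient_partialDeriv_comm i j]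

end CurlFree

/-! ### A Liouville theorem and the density of test gradients in Ḣ¹(ℝ^d) -/

section Liouville

open scoped SchwartzMap LineDeriv Laplacian FourierTransform

variable {d : ℕ}

lemma memLp_coord (n : L2v d) (i : Fin d) : MemLp (fun x => n x i) 2 volume :=
  (EuclideanSpace.proj (𝕜 := ℝ) i).comp_memLp' (Lp.memLp n)

lemma SchwartzMap.lineDerivOp_comm (θ : 𝓢(E d, ℂ)) (v w : E d) : ∂_{v} (∂_{w} θ) = ∂_{w} (∂_{v} θ) := by
  ext x
  have hd2 : DifferentiableAt ℝ (fderiv ℝ θ) x :=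
    ((θ.smooth 2).fderiv_right (m := 1) le_rfl).differentiable one_ne_zero x
  have h : ∀ v w : E d, (∂_{v} (∂_{w} θ)) x = fderiv ℝ (fderiv ℝ θ) x v w := by
    intro v w
    rw [SchwartzMap.lineDerivOp_apply_eq_fderiv]
    have h1 : ⇑(∂_{w} θ : 𝓢(E d, ℂ)) = fun y => fderiv ℝ θ y w := by
      ext y; rw [SchwartzMap.lineDerivOp_apply_eq_fderiv]
    have := hd2.hasFDerivAt.clm_apply (hasFDerivAt_const w x)
    rw [h1, this.fderiv]
    simp
  rw [h, h]
  exact ((θ.smooth 2).contDiffAt.isSymmSndFDerivAt (by simp)) _ _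

lemma SchwartzMap.contDiff_re (θ : 𝓢(E d, ℂ)) : ContDiff ℝ (⊤ : ℕ∞) fun x => (θ x).re :=
  Complex.reCLM.contDiff.comp (θ.smooth ⊤)

lemma SchwartzMap.memLp_re (θ : 𝓢(E d, ℂ)) : MemLp (fun x => (θ x).re) 2 (volume : Measure (E d)) :=
  (θ.memLp 2 volume).re

lemma SchwartzMap.fderiv_re (θ : 𝓢(E d, ℂ)) (x : E d) :
    fderiv ℝ (fun x => (θ x).re) x = Complex.reCLM.comp (fderiv ℝ θ x) :=
  (Complex.reCLM.hasFDerivAt.comp x (θ.differentiableAt.hasFDerivAt)).fderiv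

lemma SchwartzMap.gradient_re_apply (θ : 𝓢(E d, ℂ)) (x : E d) (i : Fin d) :
    gradient (fun x => (θ x).re) x i = ((∂_{(EuclideanSpace.single i (1 : ℝ) : E d)} θ) x).re := by
  rw [gradient_apply_eq_fderiv, θ.fderiv_re, SchwartzMap.lineDerivOp_apply_eq_fderiv]
  rfl

lemma SchwartzMap.memLp_gradient_re (θ : 𝓢(E d, ℂ)) :
    MemLp (gradient fun x => (θ x).re) 2 (volume : Measure (E d)) := by
  refine MemLp.of_le ((SchwartzMap.fderivCLM ℝ (E d) ℂ θ).memLp 2 volume)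
    (θ.contDiff_re.of_le (by exact_mod_cast le_top)).continuous_gradient.aestronglyMeasurable
    (Eventually.of_forall fun x => ?_)
  rw [norm_gradient, θ.fderiv_re, SchwartzMap.fderivCLM_apply]
  refine (ContinuousLinearMap.opNorm_comp_le _ _).trans ?_
  simp

/-- The pairing of the `i`-th coordinate of `n` with the real part of a Schwartz function. -/
def coordPairing (n : L2v d) (i : Fin d) (θ : 𝓢(E d, ℂ)) : ℝ := ∫ x, n x i * (θ x).re

lemma integrable_coord_mul_re (n : L2v d) (i : Fin d) (θ : 𝓢(E d, ℂ)) :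
    Integrable fun x => n x i * (θ x).re :=
  (memLp_coord n i).integrable_mul θ.memLp_re

lemma integral_coord_mul_gradient_re (n : L2v d) (i j : Fin d) (θ : 𝓢(E d, ℂ)) :
    ∫ x, n x i * (θ.memLp_gradient_re.toLp _) x j =
      coordPairing n i (∂_{(EuclideanSpace.single j (1 : ℝ) : E d)} θ) := by
  refine integral_congr_ae ?_
  filter_upwards [θ.memLp_gradient_re.coeFn_toLp] with x hx
  rw [hx, θ.gradient_re_apply]

/-- Vanishing curl gives ∫ nᵢ ∂ⱼ∂ⱼθ = ∫ nⱼ ∂ᵢ∂ⱼθ = ∫ nⱼ ∂ⱼ(∂ᵢθ), and the sum over j vanishes because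
n has no divergence. Both hypotheses may be tested with Schwartz functions since the gradients of
their real parts lie in `gradientClosure`. -/
lemma coordPairing_laplacian_eq_zero {n : L2v d}
    (hcurl : ∀ i j, ∀ v ∈ gradientClosure d, inner ℝ (curlField n i j) v = 0)
    (hdiv : ∀ v ∈ gradientClosure d, inner ℝ n v = 0) (i : Fin d) (θ : 𝓢(E d, ℂ)) :
    coordPairing n i (Δ θ) = 0 := by
  have hV : ∀ θ : 𝓢(E d, ℂ), θ.memLp_gradient_re.toLp _ ∈ gradientClosure d := fun θ =>
    gradient_mem_gradientClosure_of_memLp θ.contDiff_re θ.memLp_re θ.memLp_gradient_re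
  have hc : ∀ (i j : Fin d) (θ : 𝓢(E d, ℂ)),
      coordPairing n i (∂_{(EuclideanSpace.single j (1 : ℝ) : E d)} θ) =
      coordPairing n j (∂_{(EuclideanSpace.single i (1 : ℝ) : E d)} θ) := by
    intro i j θ
    have := hcurl i j _ (hV θ)
    rw [inner_curlField, sub_eq_zero] at this
    rwa [integral_coord_mul_gradient_re, integral_coord_mul_gradient_re] at this
  have hdv : ∀ θ : 𝓢(E d, ℂ),
      ∑ j, coordPairing n j (∂_{(EuclideanSpace.single j (1 : ℝ) : E d)} θ) = 0 := by
    intro θ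
    rw [← hdiv _ (hV θ), L2.inner_def]
    simp only [coordPairing]
    rw [← integral_finsetSum _ fun j _ => integrable_coord_mul_re n j _]
    refine integral_congr_ae ?_
    filter_upwards [θ.memLp_gradient_re.coeFn_toLp] with x hx
    rw [hx, PiLp.inner_apply]
    refine Finset.sum_congr rfl fun j _ => ?_
    rw [θ.gradient_re_apply]
    simp [mul_comm]
  have hsum : coordPairing n i (Δ θ) = ∑ j, coordPairing n i
      (∂_{(EuclideanSpace.single j (1 : ℝ) : E d)}
        (∂_{(EuclideanSpace.single j (1 : ℝ) : E d)} θ)) := by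
    rw [SchwartzMap.laplacian_eq_sum (EuclideanSpace.basisFun (Fin d) ℝ)]
    simp only [coordPairing, EuclideanSpace.basisFun_apply]
    rw [← integral_finsetSum _ fun j _ => integrable_coord_mul_re n i _]
    refine integral_congr_ae (Eventually.of_forall fun x => ?_)
    simp [Finset.mul_sum]
  rw [hsum]
  simp_rw [hc i _]
  rw [← hdv (∂_{(EuclideanSpace.single i (1 : ℝ) : E d)} θ)]
  refine Finset.sum_congr rfl fun j _ => ?_
  rw [SchwartzMap.lineDerivOp_comm]

/-- A harmonic function in `L²(ℝ^d)` vanishes. -/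
theorem eq_zero_of_laplacian_toTemperedDistribution_eq_zero (hd : 0 < d)
    (u : Lp ℂ 2 (volume : Measure (E d))) (hu : Δ (u : 𝓢'(E d, ℂ)) = 0) : u = 0 := by
  have hne : Nonempty (Fin d) := ⟨⟨0, hd⟩⟩
  rw [TemperedDistribution.laplacian_eq_fourierMultiplierCLM,
    TemperedDistribution.fourierMultiplierCLM_apply] at hu
  have hu2 := (smul_eq_zero.1 hu).resolve_left (by
    have := Real.pi_pos
    exact neg_ne_zero.2 (by positivity))
  have hu3 := congrArg (fun t : 𝓢'(E d, ℂ) => 𝓕 t) hu2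
  simp only [FourierTransform.fourier_fourierInv_eq, FourierTransform.fourier_zero] at hu3
  rw [Lp.fourier_toTemperedDistribution_eq] at hu3
  set w : Lp ℂ 2 (volume : Measure (E d)) := 𝓕 u with hw
  suffices hw0 : w = 0 by
    have : ‖u‖ = 0 := by rw [← Lp.norm_fourier_eq, ← hw, hw0, norm_zero]
    exact norm_eq_zero.1 this
  have hg : (fun x : E d => Complex.ofReal (‖x‖ ^ 2)).HasTemperateGrowth := by fun_prop
  have hloc : LocallyIntegrable w volume := (Lp.memLp w).locallyIntegrable one_le_two
  have hloc2 : LocallyIntegrable (fun x => (‖x‖ ^ 2 : ℝ) • w x) volume :=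
    locallyIntegrableOn_univ.1 ((locallyIntegrableOn_univ.2 hloc).continuousOn_smul
      isOpen_univ.isLocallyClosed (by fun_prop))
  -- The distributional identity |ξ|² û = 0 becomes an almost everywhere one on testing with real
  -- smooth compactly supported functions, regarded as Schwartz functions.
  have hae : ∀ᵐ x, (‖x‖ ^ 2 : ℝ) • w x = 0 := by
    refine ae_eq_zero_of_integral_contDiff_smul_eq_zero hloc2 fun g hgs hgc => ?_
    have hg₁ : HasCompactSupport (Complex.ofRealCLM ∘ g) := hgc.comp_left rfl
    have hg₂ : ContDiff ℝ (⊤ : ℕ∞) (Complex.ofRealCLM ∘ g) := by fun_prop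
    have := congrArg (fun T : 𝓢'(E d, ℂ) => T (hg₁.toSchwartzMap hg₂)) hu3
    simp only [TemperedDistribution.smulLeftCLM_apply_apply, Lp.toTemperedDistribution_apply] at this
    rw [show (0 : 𝓢'(E d, ℂ)) (hg₁.toSchwartzMap hg₂) = 0 from rfl] at this
    rw [← this]
    refine integral_congr_ae (Eventually.of_forall fun x => ?_)
    simp only [SchwartzMap.smulLeftCLM_apply_apply hg]
    simp
    ring
  rw [Lp.eq_zero_iff_ae_eq_zero]
  -- The origin, the only zero of |ξ|², is negligible because d > 0.
  have h0 : ∀ᵐ x : E d, x ≠ 0 := by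
    simp [ae_iff]
  filter_upwards [hae, h0] with x hx hx0
  exact (smul_eq_zero.1 hx).resolve_left (by positivity)

/-- Each coordinate, viewed as a complex L² function, is harmonic as a tempered distribution and
therefore zero. -/
lemma eq_zero_of_curl_div_free (hd : 0 < d) {n : L2v d}
    (hcurl : ∀ i j, ∀ v ∈ gradientClosure d, inner ℝ (curlField n i j) v = 0)
    (hdiv : ∀ v ∈ gradientClosure d, inner ℝ n v = 0) : n = 0 := by
  have hcoord : ∀ i : Fin d, ∀ᵐ x, n x i = 0 := by
    intro i
    have hm : MemLp (fun x => (n x i : ℂ)) 2 (volume : Measure (E d)) := (memLp_coord n i).ofReal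
    have hre : ∀ θ : 𝓢(E d, ℂ), (∫ x, θ x * (n x i : ℂ)).re = coordPairing n i θ := by
      intro θ
      have hint : Integrable (fun x => θ x * (n x i : ℂ)) :=
        (θ.memLp 2 volume).integrable_mul hm
      rw [← Complex.reCLM_apply, ← Complex.reCLM.integral_comp_comm hint]
      refine integral_congr_ae (Eventually.of_forall fun x => ?_)
      simp [mul_comm]
    have hz : ∀ θ : 𝓢(E d, ℂ), ∫ x, (Δ θ) x * (n x i : ℂ) = 0 := by
      intro θ
      apply Complex.ext
      · rw [hre, coordPairing_laplacian_eq_zero hcurl hdiv]; rfl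
      -- Only real parts are known to vanish; replacing θ by -iθ turns the imaginary part into a
      -- real one.
      · have h1 := hre (Δ ((-Complex.I) • θ))
        rw [coordPairing_laplacian_eq_zero hcurl hdiv] at h1
        have h2 : Δ ((-Complex.I) • θ) = (-Complex.I) • Δ θ := by
          rw [← SchwartzMap.laplacianCLM_eq (𝕜 := ℂ), map_smul, SchwartzMap.laplacianCLM_eq]
        rw [h2] at h1
        simp only [smul_apply, smul_eq_mul, mul_assoc] at h1
        rw [integral_const_mul] at h1
        simpa using h1
    have hu : hm.toLp _ = 0 := by
      refine eq_zero_of_laplacian_toTemperedDistribution_eq_zero hd _ ?_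
      ext θ
      rw [TemperedDistribution.laplacian_apply_apply, Lp.toTemperedDistribution_apply]
      rw [show (0 : 𝓢'(E d, ℂ)) θ = 0 from rfl, ← hz θ]
      refine integral_congr_ae ?_
      filter_upwards [hm.coeFn_toLp] with x hx
      rw [hx, smul_eq_mul]
    rw [Lp.eq_zero_iff_ae_eq_zero] at hu
    filter_upwards [hu, hm.coeFn_toLp] with x h1 h2
    rw [h1, Pi.zero_apply] at h2
    exact Complex.ofReal_eq_zero.1 h2.symm
  rw [Lp.eq_zero_iff_ae_eq_zero]
  filter_upwards [ae_all_iff.2 hcoord] with x hx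
  ext i
  exact hx i

/-- The gradients of test functions are dense in the gradients of `Ḣ¹(ℝ^d)`. -/
theorem MemHomH1.toLp_mem_gradientClosure (hd : 0 < d) {z : E d → ℝ} {g : E d → E d}
    (hz : MemHomH1 z g) : hz.2.1.toLp g ∈ gradientClosure d := by
  have hcl := isClosed_gradientClosure (d := d)
  have : CompleteSpace (gradientClosure d) := hcl.completeSpace_coe
  set G := hz.2.1.toLp g with hG
  have hzG : MemHomH1 z G := by
    refine ⟨hz.1, Lp.memLp G, hz.2.2.1, ?_, fun φ i => ?_⟩
    · simpa [locallyIntegrableOn_univ] using (Lp.memLp G).locallyIntegrable one_le_two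
    · rw [hz.2.2.2.2 φ i]
      simp only [Opens.coe_top, Measure.restrict_univ]
      congr 1
      refine integral_congr_ae ?_
      filter_upwards [hz.2.1.coeFn_toLp] with x hx
      rw [hx]
  -- The projection v is itself the gradient of a potential, so n = G - v is curl free as a
  -- difference of gradients. Orthogonality to the closure is vanishing divergence. Both together
  -- force n = 0.
  obtain ⟨v, hv, n, hn, hvn⟩ := (gradientClosure d).exists_add_mem_mem_orthogonal G
  obtain ⟨ζ, hζ⟩ := exists_memHomH1_of_mem_gradientClosure hv
  have hn0 : n = 0 := by
    refine eq_zero_of_curl_div_free hd (fun i j => ?_) fun w hw => ?_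
    · intro w hw
      have hsub : curlField n i j = curlField G i j - curlField v i j := by
        have key : ∀ i j : Fin d, (memLp_single_coord n i j).toLp _ =
            (memLp_single_coord G i j).toLp _ - (memLp_single_coord v i j).toLp _ := by
          intro i j
          rw [← MemLp.toLp_sub]
          refine MemLp.toLp_congr _ _ ?_
          have hn' : n = G - v := by rw [hvn]; abel
          rw [hn']
          filter_upwards [Lp.coeFn_sub G v] with x hx
          rw [hx]
          ext k
          by_cases hk : k = j <;> simp [hk]
        rw [curlField, key, key, curlField, curlField]
        abel
      refine gradientClosure_induction (P := fun w => inner ℝ (curlField n i j) w = 0)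
        (isClosed_eq (continuous_const.inner continuous_id) continuous_const) (fun φ => ?_) hw
      rw [hsub, inner_sub_left, inner_curlField_gradient_eq_zero hzG,
        inner_curlField_gradient_eq_zero hζ, sub_zero]
    · exact Submodule.inner_left_of_mem_orthogonal hw hn
  rw [hvn, hn0, add_zero]
  exact hv

/-- Two elements of `Ḣ¹(ℝ^d)` with the same gradient differ by a constant. -/
theorem MemHomH1.exists_ae_eq_add_const {z z' : E d → ℝ} {g g' : E d → E d} (hz : MemHomH1 z g)
    (hz' : MemHomH1 z' g') (h : g' =ᵐ[volume] g) :
    ∃ k : ℝ, z' =ᵐ[volume] fun x => z x + k := by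
  have h1 := hz.2.2
  have h2 := hz'.2.2
  simp only [HasWeakGradient, Opens.coe_top, Measure.restrict_univ, locallyIntegrableOn_univ] at h1 h2
  obtain ⟨k, hk⟩ := exists_ae_eq_const_of_integral_mul_gradient_eq_zero (h2.1.sub h1.1)
    fun ψ i => by
      have hcs : HasCompactSupport fun x => gradient ψ x i :=
        ψ.hasCompactSupport.gradient.comp_left (g := fun v : E d => v i) (by simp)
      have hc : Continuous fun x => gradient ψ x i :=
        (EuclideanSpace.proj (𝕜 := ℝ) i).continuous.comp ψ.continuous_gradient
      have e1 : Integrable fun x => z x * gradient ψ x i := by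
        simpa [mul_comm] using h1.1.integrable_smul_left_of_hasCompactSupport hc hcs
      have e2 : Integrable fun x => z' x * gradient ψ x i := by
        simpa [mul_comm] using h2.1.integrable_smul_left_of_hasCompactSupport hc hcs
      simp only [Pi.sub_apply, sub_mul]
      rw [integral_sub e2 e1, h1.2.2, h2.2.2, sub_eq_zero]
      congr 1
      refine integral_congr_ae ?_
      filter_upwards [h] with x hx
      rw [hx]
  refine ⟨k, ?_⟩
  filter_upwards [hk] with x hx
  simp only [Pi.sub_apply] at hx
  linarith

end Liouville

/-! ### Lax-Milgram on closed subspaces -/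

section LaxMilgram

variable {H : Type*} [NormedAddCommGroup H] [InnerProductSpace ℝ H] [CompleteSpace H]

/-- The Lax-Milgram theorem on a closed subspace. -/
lemma exists_inner_apply_left_eq {V : Submodule ℝ H} (hV : IsClosed (V : Set H)) (T : H →L[ℝ] H)
    {c : ℝ} (hc : 0 < c) (hT : ∀ v ∈ V, c * ‖v‖ ^ 2 ≤ inner ℝ (T v) v) (f : H) :
    ∃ u ∈ V, ∀ v ∈ V, inner ℝ (T u) v = inner ℝ f v := by
  have : CompleteSpace V := hV.completeSpace_coe
  set B : V →L[ℝ] V →L[ℝ] ℝ := (innerSL ℝ).bilinearComp (T ∘L V.subtypeL) V.subtypeL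
  have hB : IsCoercive B := ⟨c, hc, fun v => by
    have := hT v v.2
    rw [mul_assoc, ← sq]
    exact this⟩
  set F := (InnerProductSpace.toDual ℝ V).symm (innerSL ℝ f ∘L V.subtypeL)
  refine ⟨(hB.continuousLinearEquivOfBilin.symm F : V), SetLike.coe_mem _, fun v hv => ?_⟩
  have hF : inner ℝ F (⟨v, hv⟩ : V) = inner ℝ f v := by
    rw [InnerProductSpace.toDual_symm_apply]; rfl
  have := hB.continuousLinearEquivOfBilin_apply (hB.continuousLinearEquivOfBilin.symm F) ⟨v, hv⟩
  rw [ContinuousLinearEquiv.apply_symm_apply, hF] at this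
  exact this.symm

/-- The Lax-Milgram theorem on a closed subspace, for the transposed form. -/
lemma exists_inner_apply_right_eq {V : Submodule ℝ H} (hV : IsClosed (V : Set H))
    (T : H →L[ℝ] H) {c : ℝ} (hc : 0 < c) (hT : ∀ v ∈ V, c * ‖v‖ ^ 2 ≤ inner ℝ (T v) v) (f : H) :
    ∃ u ∈ V, ∀ v ∈ V, inner ℝ (T v) u = inner ℝ f v := by
  obtain ⟨u, hu, h⟩ := exists_inner_apply_left_eq hV T.adjoint hc (fun v hv => by
    rw [ContinuousLinearMap.adjoint_inner_left, real_inner_comm]; exact hT v hv) f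
  refine ⟨u, hu, fun v hv => ?_⟩
  rw [← h v hv, ContinuousLinearMap.adjoint_inner_left, real_inner_comm]

end LaxMilgram

/-! ### Coefficients as local coercive operators -/

section Operators

variable {d : ℕ}

lemma memLp_top_indicator_one {s : Set (E d)} (hs : MeasurableSet s) :
    MemLp (s.indicator fun _ => (1 : ℝ)) ∞ (volume : Measure (E d)) :=
  (memLp_top_const 1).indicator hs

open Classical in
/-- Multiplication of vector fields by the indicator function of a measurable set. -/
def indicatorOp (s : Set (E d)) : L2v d →L[ℝ] L2v d :=
  if hs : MeasurableSet s then
    (ContinuousLinearMap.lsmul ℝ ℝ).holderL volume ∞ 2 2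
      ((memLp_top_indicator_one hs).toLp _)
  else 0

lemma indicatorOp_coeFn {s : Set (E d)} (hs : MeasurableSet s) (g : L2v d) :
    indicatorOp s g =ᵐ[volume] s.indicator g := by
  rw [indicatorOp, dif_pos hs]
  filter_upwards [(ContinuousLinearMap.lsmul ℝ ℝ).coeFn_holder (r := 2)
    ((memLp_top_indicator_one hs).toLp _) g, (memLp_top_indicator_one hs).coeFn_toLp] with x h1 h2
  refine h1.trans ?_
  rw [h2]
  by_cases hx : x ∈ s <;> simp [hx]

lemma inner_indicatorOp_left {s : Set (E d)} (hs : MeasurableSet s) (g h : L2v d) :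
    inner ℝ (indicatorOp s g) h = inner ℝ g (indicatorOp s h) := by
  rw [L2.inner_def, L2.inner_def]
  refine integral_congr_ae ?_
  filter_upwards [indicatorOp_coeFn hs g, indicatorOp_coeFn hs h] with x h1 h2
  rw [h1, h2]
  by_cases hx : x ∈ s <;> simp [hx]

lemma indicatorOp_idem {s : Set (E d)} (hs : MeasurableSet s) (g : L2v d) :
    indicatorOp s (indicatorOp s g) = indicatorOp s g := by
  apply Lp.ext
  filter_upwards [indicatorOp_coeFn hs g, indicatorOp_coeFn hs (indicatorOp s g)] with x h1 h2
  rw [h2]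
  by_cases hx : x ∈ s <;> simp [hx, h1]

lemma norm_indicatorOp_le {s : Set (E d)} (hs : MeasurableSet s) (g : L2v d) :
    ‖indicatorOp s g‖ ≤ ‖g‖ := by
  refine Lp.norm_le_norm_of_ae_le ?_
  filter_upwards [indicatorOp_coeFn hs g] with x h1
  rw [h1]
  exact norm_indicator_le_norm_self _ _

/-- Multiplication of vector fields by a bounded matrix-valued function. -/
def mulOp (A : Lp (E d →L[ℝ] E d) ∞ (volume : Measure (E d))) : L2v d →L[ℝ] L2v d :=
  (ContinuousLinearMap.id ℝ (E d →L[ℝ] E d)).holderL volume ∞ 2 2 A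

lemma mulOp_coeFn (A : Lp (E d →L[ℝ] E d) ∞ (volume : Measure (E d))) (g : L2v d) :
    mulOp A g =ᵐ[volume] fun x => A x (g x) :=
  (ContinuousLinearMap.id ℝ (E d →L[ℝ] E d)).coeFn_holder (r := 2) A g

/-- A coercive operator acting locally on vector fields. -/
structure IsCoefficientOp (α : ℝ) (T : L2v d →L[ℝ] L2v d) : Prop where
  comm : ∀ s : Set (E d), MeasurableSet s → ∀ g, T (indicatorOp s g) = indicatorOp s (T g)
  coercive : ∀ g, α * ‖g‖ ^ 2 ≤ inner ℝ (T g) g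

lemma norm_sq_eq_integral (g : L2v d) : ‖g‖ ^ 2 = ∫ x, ‖g x‖ ^ 2 := by
  rw [← real_inner_self_eq_norm_sq, L2.inner_def]
  simp_rw [real_inner_self_eq_norm_sq]

lemma IsCoefficientOp.of_coeFn {α : ℝ} {T : L2v d →L[ℝ] L2v d} {A : E d → E d →L[ℝ] E d}
    (h : ∀ g, T g =ᵐ[volume] fun x => A x (g x))
    (hA : ∀ᵐ x, ∀ ξ, α * ‖ξ‖ ^ 2 ≤ inner ℝ ξ (A x ξ)) : IsCoefficientOp α T where
  comm s hs g := by
    apply Lp.ext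
    filter_upwards [h g, h (indicatorOp s g), indicatorOp_coeFn hs g,
      indicatorOp_coeFn hs (T g)] with x h1 h2 h3 h4
    rw [h2, h4, h3]
    by_cases hx : x ∈ s <;> simp [hx, h1]
  coercive g := by
    rw [norm_sq_eq_integral, ← integral_const_mul, L2.inner_def]
    refine integral_mono_ae ?_ (L2.integrable_inner _ _) ?_
    · exact (Lp.memLp g).integrable_norm_pow two_ne_zero |>.const_mul _
    · filter_upwards [h g, hA] with x h1 h2
      rw [h1, real_inner_comm]
      exact h2 _

lemma isCoefficientOp_compLpL {α : ℝ} {B : E d →L[ℝ] E d}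
    (hB : ∀ ξ, α * ‖ξ‖ ^ 2 ≤ inner ℝ ξ (B ξ)) :
    IsCoefficientOp α (B.compLpL 2 (volume : Measure (E d))) :=
  .of_coeFn (A := fun _ => B) (fun g => B.coeFn_compLpL g) (ae_of_all _ fun _ => hB)

/-- The operator equal to `B` on `s` and to `T` on the complement. -/
def perturbOp (s : Set (E d)) (T B : L2v d →L[ℝ] L2v d) : L2v d →L[ℝ] L2v d :=
  T + indicatorOp s ∘L (B - T)

lemma perturbOp_apply (s : Set (E d)) (T B : L2v d →L[ℝ] L2v d) (g : L2v d) :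
    perturbOp s T B g = T g + indicatorOp s (B g - T g) := rfl

/-- Split g into p on s and q off s. By locality the perturbed operator sends g to Bp + Tq, the
cross terms are orthogonal, and the two coercivity bounds add up with the same α. -/
lemma IsCoefficientOp.perturb {α : ℝ} {T B : L2v d →L[ℝ] L2v d} (hT : IsCoefficientOp α T)
    (hB : IsCoefficientOp α B) {s : Set (E d)} (hs : MeasurableSet s) :
    IsCoefficientOp α (perturbOp s T B) where
  comm t ht g := by
    have hc : ∀ g, indicatorOp s (indicatorOp t g) = indicatorOp t (indicatorOp s g) := by
      intro g
      apply Lp.ext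
      filter_upwards [indicatorOp_coeFn ht (indicatorOp s g), indicatorOp_coeFn hs g,
        indicatorOp_coeFn hs (indicatorOp t g), indicatorOp_coeFn ht g] with x h1 h2 h3 h4
      rw [h1, h3]
      by_cases hx : x ∈ s <;> by_cases hx' : x ∈ t <;> simp [hx, hx', h2, h4]
    rw [perturbOp_apply, perturbOp_apply, hT.comm t ht, hB.comm t ht, map_add, ← map_sub, hc]
  coercive g := by
    set p := indicatorOp s g with hp
    set q := g - p with hq
    have hg : g = p + q := by rw [hq]; abel
    have hpp : indicatorOp s p = p := indicatorOp_idem hs g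
    have hqq : indicatorOp s q = 0 := by rw [hq, map_sub, hpp, ← hp, sub_self]
    have horth : ∀ u v : L2v d, indicatorOp s u = u → indicatorOp s v = 0 → inner ℝ u v = 0 := by
      intro u v hu hv
      rw [← hu, inner_indicatorOp_left hs, hv, inner_zero_right]
    have hTp : indicatorOp s (T p) = T p := by rw [← hT.comm s hs, hpp]
    have hBp : indicatorOp s (B p) = B p := by rw [← hB.comm s hs, hpp]
    have hTq : indicatorOp s (T q) = 0 := by rw [← hT.comm s hs, hqq, map_zero]
    have hBq : indicatorOp s (B q) = 0 := by rw [← hB.comm s hs, hqq, map_zero]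
    have hval : perturbOp s T B g = B p + T q := by
      rw [perturbOp_apply, hg]
      simp only [map_add, map_sub, hTp, hBp, hTq, hBq]
      abel
    have h1 : inner ℝ (B p) q = 0 := horth _ _ hBp hqq
    have h2 : inner ℝ (T q) p = 0 := by rw [real_inner_comm]; exact horth _ _ hpp hTq
    have h3 : ‖g‖ ^ 2 = ‖p‖ ^ 2 + ‖q‖ ^ 2 := by
      rw [hg, @norm_add_sq_real, horth _ _ hpp hqq]; ring
    rw [hval, h3]
    nth_rw 1 [hg]
    rw [inner_add_left, inner_add_right, inner_add_right, h1, h2]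
    linarith [hB.coercive p, hT.coercive q]

end Operators

/-! ### From functions on Ω to the operator formulation -/

section Correspondence

variable {d : ℕ} {Ω : Opens (E d)}

lemma L2Pair.norm_le (w : L2Pair d) : ‖w‖ ≤ ‖w.fst‖ + ‖w.snd‖ := by
  refine (sq_le_sq₀ (norm_nonneg _) (by positivity)).1 ?_
  rw [WithLp.prod_norm_sq_eq_of_L2]
  nlinarith [mul_nonneg (norm_nonneg w.fst) (norm_nonneg w.snd)]

lemma L2Pair.norm_fst_le (w : L2Pair d) : ‖w.fst‖ ≤ ‖w‖ := by
  refine (sq_le_sq₀ (norm_nonneg _) (norm_nonneg _)).1 ?_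
  rw [WithLp.prod_norm_sq_eq_of_L2]
  nlinarith [sq_nonneg ‖w.snd‖]

lemma L2Pair.norm_snd_le (w : L2Pair d) : ‖w.snd‖ ≤ ‖w‖ := by
  refine (sq_le_sq₀ (norm_nonneg _) (norm_nonneg _)).1 ?_
  rw [WithLp.prod_norm_sq_eq_of_L2]
  nlinarith [sq_nonneg ‖w.fst‖]

/-- Extension by zero of a square integrable function on `Ω`. -/
lemma memLp_indicator_of_restrict {F : Type*} [NormedAddCommGroup F] {u : E d → F}
    (hu : MemLp u 2 (volume.restrict (Ω : Set (E d)))) :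
    MemLp ((Ω : Set (E d)).indicator u) 2 volume :=
  (memLp_indicator_iff_restrict Ω.isOpen.measurableSet).2 hu

lemma toLp_indicator_ae_eq {F : Type*} [NormedAddCommGroup F] {u : E d → F}
    (hu : MemLp u 2 (volume.restrict (Ω : Set (E d)))) :
    (memLp_indicator_of_restrict hu).toLp _ =ᵐ[volume.restrict (Ω : Set (E d))] u :=
  EventuallyEq.trans (ae_restrict_of_ae (memLp_indicator_of_restrict hu).coeFn_toLp)
    (indicator_ae_eq_restrict Ω.isOpen.measurableSet)

/-- Both functions vanish off Ω, so distances over ℝ^d and over Ω coincide; this lets closures be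
compared. -/
lemma enorm_sub_toLp_eq {F : Type*} [NormedAddCommGroup F] {U : Lp F 2 (volume : Measure (E d))}
    {u φ : E d → F} (hU : ∀ᵐ x, x ∈ (Ω : Set (E d))ᶜ → U x = 0)
    (hu : u =ᵐ[volume.restrict (Ω : Set (E d))] U) (hφ : MemLp φ 2 volume)
    (hφ0 : ∀ x ∉ Ω, φ x = 0) :
    ‖U - hφ.toLp φ‖ₑ = eLpNorm (fun x => u x - φ x) 2 (volume.restrict (Ω : Set (E d))) := by
  rw [Lp.enorm_def, ← eLpNorm_indicator_eq_eLpNorm_restrict Ω.isOpen.measurableSet]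
  refine eLpNorm_congr_ae ?_
  rw [Filter.EventuallyEq, ae_restrict_iff' Ω.isOpen.measurableSet] at hu
  filter_upwards [hU, hu, Lp.coeFn_sub U (hφ.toLp φ), hφ.coeFn_toLp] with x h1 h2 h3 h4
  rw [h3, Pi.sub_apply, h4]
  by_cases hx : x ∈ (Ω : Set (E d))
  · rw [Set.indicator_of_mem hx, h2 hx]
  · rw [Set.indicator_of_notMem hx, h1 hx, hφ0 x hx, sub_zero]

/-- The elements of `H¹₀(Ω)` are the restrictions to `Ω` of the elements of `sobolevZero Ω`. -/
theorem memH10_iff {u : E d → ℝ} {g : E d → E d} :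
    MemH10 Ω u g ↔ ∃ w ∈ sobolevZero Ω, u =ᵐ[volume.restrict (Ω : Set (E d))] w.fst ∧
      g =ᵐ[volume.restrict (Ω : Set (E d))] w.snd := by
  have hm := Ω.isOpen.measurableSet
  constructor
  · rintro ⟨⟨hu, hg, -⟩, happ⟩
    set w : L2Pair d := WithLp.toLp 2 ((memLp_indicator_of_restrict hu).toLp _,
      (memLp_indicator_of_restrict hg).toLp _) with hw
    refine ⟨w, ?_, (toLp_indicator_ae_eq hu).symm, (toLp_indicator_ae_eq hg).symm⟩
    have key : w ∈ closure (LinearMap.range (testPair Ω) : Set (L2Pair d)) := by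
      rw [Metric.mem_closure_iff]
      intro ε hε
      obtain ⟨φ, h1, h2⟩ := happ (ENNReal.ofReal (ε / 2)) (by simpa using hε)
      refine ⟨testPair Ω φ, ⟨φ, rfl⟩, ?_⟩
      rw [← enorm_sub_toLp_eq (U := w.fst) ?_ (toLp_indicator_ae_eq hu).symm φ.memLp_two
        fun x hx => φ.eq_zero_of_notMem hx, ← ofReal_norm, ENNReal.ofReal_lt_ofReal_iff (by positivity)] at h1
      rw [← enorm_sub_toLp_eq (U := w.snd) ?_ (toLp_indicator_ae_eq hg).symm φ.memLp_gradient
        fun x hx => φ.gradient_eq_zero_of_notMem hx, ← ofReal_norm,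
        ENNReal.ofReal_lt_ofReal_iff (by positivity)] at h2
      · rw [dist_eq_norm]
        refine (L2Pair.norm_le _).trans_lt ?_
        have e1 : (w - testPair Ω φ).fst = w.fst - φ.memLp_two.toLp φ := rfl
        have e2 : (w - testPair Ω φ).snd = w.snd - φ.memLp_gradient.toLp _ := rfl
        rw [e1, e2]
        linarith
      · filter_upwards [(memLp_indicator_of_restrict hg).coeFn_toLp] with x hx hx'
        exact hx.trans (Set.indicator_of_notMem hx' _)
      · filter_upwards [(memLp_indicator_of_restrict hu).coeFn_toLp] with x hx hx'
        exact hx.trans (Set.indicator_of_notMem hx' _)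
    exact key
  · rintro ⟨w, hw, hu, hg⟩
    have hu2 : MemLp u 2 (volume.restrict (Ω : Set (E d))) :=
      ((Lp.memLp w.fst).restrict _).ae_eq hu.symm
    have hg2 : MemLp g 2 (volume.restrict (Ω : Set (E d))) :=
      ((Lp.memLp w.snd).restrict _).ae_eq hg.symm
    refine ⟨⟨hu2, hg2, locallyIntegrableOn_of_locallyIntegrable_restrict
      (hu2.locallyIntegrable one_le_two), locallyIntegrableOn_of_locallyIntegrable_restrict
      (hg2.locallyIntegrable one_le_two), fun φ i => ?_⟩, fun ε hε => ?_⟩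
    · have h := integral_mul_gradient_of_mem_sobolevZero hw φ i
      rw [← setIntegral_eq_integral_of_forall_compl_eq_zero (μ := volume) (s := (Ω : Set (E d)))
        (fun x hx => by rw [φ.gradient_eq_zero_of_notMem hx]; simp),
        ← setIntegral_eq_integral_of_forall_compl_eq_zero (μ := volume) (s := (Ω : Set (E d)))
        (fun x hx => by rw [φ.eq_zero_of_notMem hx]; simp)] at h
      refine Eq.trans (integral_congr_ae ?_) (h.trans (congrArg _ (integral_congr_ae ?_)))
      · filter_upwards [hu] with x hx
        rw [hx]
      · filter_upwards [hg] with x hx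
        rw [hx]
    · obtain ⟨δ, hδ, hδε⟩ : ∃ δ : ℝ, 0 < δ ∧ ENNReal.ofReal δ ≤ ε := by
        obtain ⟨δ, -, h1, h2⟩ := ENNReal.lt_iff_exists_real_btwn.1 hε
        exact ⟨δ, by simpa using h1, h2.le⟩
      have hw' : w ∈ closure (LinearMap.range (testPair Ω) : Set (L2Pair d)) := hw
      obtain ⟨_, ⟨φ, rfl⟩, hφ⟩ := Metric.mem_closure_iff.1 hw' δ hδ
      rw [dist_eq_norm] at hφ
      refine ⟨φ, ?_, ?_⟩
      · rw [← enorm_sub_toLp_eq (sobolevZero_fst_eq_zero hw) hu φ.memLp_two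
          fun x hx => φ.eq_zero_of_notMem hx, ← ofReal_norm]
        exact ((ENNReal.ofReal_lt_ofReal_iff hδ).2 ((L2Pair.norm_fst_le _).trans_lt hφ)).trans_le hδε
      · rw [← enorm_sub_toLp_eq (sobolevZero_snd_eq_zero hw) hg φ.memLp_gradient
          fun x hx => φ.gradient_eq_zero_of_notMem hx, ← ofReal_norm]
        exact ((ENNReal.ofReal_lt_ofReal_iff hδ).2 ((L2Pair.norm_snd_le _).trans_lt hφ)).trans_le hδε

/-- `w` is the solution in `H¹₀(Ω)` of the equation with coefficient operator `T` and right-hand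
side `F`. -/
def IsWeakSol (Ω : Opens (E d)) (T : L2v d →L[ℝ] L2v d) (F : L2 d) (w : L2Pair d) : Prop :=
  w ∈ sobolevZero Ω ∧ ∀ v ∈ sobolevZero Ω, inner ℝ (T w.snd) v.snd = inner ℝ F v.fst

/-- The form ⟨T∇u, ∇v⟩ controls gradients only. Poincaré extends coercivity to the full norm of
pairs, with constant α / (C² + 1). -/
theorem exists_isWeakSol (hd : 0 < d) (hΩ : Bornology.IsBounded (Ω : Set (E d))) {α : ℝ}
    (hα : 0 < α) {T : L2v d →L[ℝ] L2v d} (hT : IsCoefficientOp α T) (F : L2 d) :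
    ∃ w, IsWeakSol Ω T F w := by
  obtain ⟨C, hC, hP⟩ := exists_poincare_const hd hΩ
  set p := WithLp.fstL 2 ℝ (L2 d) (L2v d)
  set q := WithLp.sndL 2 ℝ (L2 d) (L2v d)
  obtain ⟨w, hw, h⟩ := exists_inner_apply_left_eq (isClosed_sobolevZero (Ω := Ω))
    (q.adjoint ∘L T ∘L q) (c := α / (C ^ 2 + 1)) (by positivity) (fun v hv => by
      have e : inner ℝ ((q.adjoint ∘L T ∘L q) v) v = inner ℝ (T v.snd) v.snd :=
        ContinuousLinearMap.adjoint_inner_left q v (T v.snd)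
      rw [e]
      refine le_trans ?_ (hT.coercive v.snd)
      rw [WithLp.prod_norm_sq_eq_of_L2, div_mul_eq_mul_div, div_le_iff₀ (by positivity), mul_assoc]
      refine mul_le_mul_of_nonneg_left ?_ hα.le
      have := pow_le_pow_left₀ (norm_nonneg _) (hP v hv) 2
      rw [mul_pow] at this
      linarith) (p.adjoint F)
  refine ⟨w, hw, fun v hv => ?_⟩
  have h1 := h v hv
  rw [ContinuousLinearMap.adjoint_inner_left] at h1
  exact (ContinuousLinearMap.adjoint_inner_left q v (T w.snd)).symm.trans h1

theorem IsWeakSol.unique (hd : 0 < d) (hΩ : Bornology.IsBounded (Ω : Set (E d))) {α : ℝ}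
    (hα : 0 < α) {T : L2v d →L[ℝ] L2v d} (hT : IsCoefficientOp α T) {F : L2 d} {w w' : L2Pair d}
    (hw : IsWeakSol Ω T F w) (hw' : IsWeakSol Ω T F w') : w' = w := by
  obtain ⟨C, hC, hP⟩ := exists_poincare_const hd hΩ
  have hm : w' - w ∈ sobolevZero Ω := Submodule.sub_mem _ hw'.1 hw.1
  have e : (w' - w).snd = w'.snd - w.snd := rfl
  have h1 := hT.coercive (w' - w).snd
  nth_rw 2 [e] at h1
  rw [map_sub, inner_sub_left, hw.2 _ hm, hw'.2 _ hm, sub_self] at h1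
  have h2 : ‖(w' - w).snd‖ = 0 := by
    have : ‖(w' - w).snd‖ ^ 2 ≤ 0 := by
      by_contra! hlt
      linarith [mul_pos hα hlt]
    exact pow_eq_zero_iff two_ne_zero |>.1 (le_antisymm this (sq_nonneg _))
  have h3 := hP _ hm
  have h4 := L2Pair.norm_le (w' - w)
  rw [h2] at h3 h4
  have : ‖w' - w‖ ≤ 0 := by linarith
  exact sub_eq_zero.1 (norm_le_zero_iff.1 this)

lemma IsCoefficientOp.adjoint {α : ℝ} {T : L2v d →L[ℝ] L2v d} (hT : IsCoefficientOp α T) :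
    IsCoefficientOp α T.adjoint where
  comm s hs g := by
    refine ext_inner_right ℝ fun h => ?_
    rw [ContinuousLinearMap.adjoint_inner_left, inner_indicatorOp_left hs,
      inner_indicatorOp_left hs, ContinuousLinearMap.adjoint_inner_left, hT.comm s hs]
  coercive g := by
    rw [ContinuousLinearMap.adjoint_inner_left, real_inner_comm]
    exact hT.coercive g

/-- `T` acts on vector fields on `Ω` as multiplication by `a`. -/
def Represents (Ω : Opens (E d)) (T : L2v d →L[ℝ] L2v d) (a : E d → Mat d) : Prop :=
  ∀ g, ∀ᵐ x, x ∈ Ω → T g x = act (a x) (g x)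

lemma Represents.setIntegral_eq_inner {T : L2v d →L[ℝ] L2v d} {a : E d → Mat d}
    (hT : Represents Ω T a) {g h : E d → E d} {G H : L2v d}
    (hg : g =ᵐ[volume.restrict (Ω : Set (E d))] G) (hh : h =ᵐ[volume.restrict (Ω : Set (E d))] H)
    (hGH : ∀ᵐ x, x ∈ (Ω : Set (E d))ᶜ → T G x = 0 ∨ H x = 0) :
    ∫ x in (Ω : Set (E d)), inner ℝ (act (a x) (g x)) (h x) = inner ℝ (T G) H := by
  rw [L2.inner_def, ← setIntegral_eq_integral_of_ae_compl_eq_zero (μ := volume) (s := (Ω : Set (E d)))]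
  · refine integral_congr_ae ?_
    filter_upwards [hg, hh, ae_restrict_of_ae (hT G), ae_restrict_mem Ω.isOpen.measurableSet]
      with x h1 h2 h3 h4
    rw [h1, h2, h3 h4]
  · filter_upwards [hGH] with x hx hx'
    rcases hx hx' with h | h <;> simp [h]

lemma setIntegral_mul_eq_inner {f v : E d → ℝ}
    (hf : MemLp f 2 (volume.restrict (Ω : Set (E d)))) {V : L2 d}
    (hv : v =ᵐ[volume.restrict (Ω : Set (E d))] V) :
    ∫ x in (Ω : Set (E d)), f x * v x = inner ℝ ((memLp_indicator_of_restrict hf).toLp _) V := by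
  rw [L2.inner_def, ← setIntegral_eq_integral_of_ae_compl_eq_zero (μ := volume) (s := (Ω : Set (E d)))]
  · refine integral_congr_ae ?_
    filter_upwards [hv, toLp_indicator_ae_eq hf] with x h1 h2
    rw [h1, h2]; simp [mul_comm]
  · filter_upwards [(memLp_indicator_of_restrict hf).coeFn_toLp] with x hx hx'
    rw [hx, Set.indicator_of_notMem hx', inner_zero_left]

theorem isState_iff {T : L2v d →L[ℝ] L2v d} {a : E d → Mat d} (hT : Represents Ω T a)
    {f : E d → ℝ} (hf : MemLp f 2 (volume.restrict (Ω : Set (E d)))) {y : E d → ℝ}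
    {gy : E d → E d} :
    IsState Ω a f y gy ↔ ∃ w, IsWeakSol Ω T ((memLp_indicator_of_restrict hf).toLp _) w ∧
      y =ᵐ[volume.restrict (Ω : Set (E d))] w.fst ∧
      gy =ᵐ[volume.restrict (Ω : Set (E d))] w.snd := by
  constructor
  · rintro ⟨h10, h⟩
    obtain ⟨w, hw, h1, h2⟩ := memH10_iff.1 h10
    refine ⟨w, ⟨hw, fun v hv => ?_⟩, h1, h2⟩
    have := h v.fst v.snd (memH10_iff.2 ⟨v, hv, .rfl, .rfl⟩)
    rwa [hT.setIntegral_eq_inner h2 .rfl, setIntegral_mul_eq_inner hf .rfl] at this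
    filter_upwards [sobolevZero_snd_eq_zero hv] with x hx hx'
    exact Or.inr (hx hx')
  · rintro ⟨w, hw, h1, h2⟩
    refine ⟨memH10_iff.2 ⟨w, hw.1, h1, h2⟩, fun v gv hv => ?_⟩
    obtain ⟨ζ, hζ, h3, h4⟩ := memH10_iff.1 hv
    rw [hT.setIntegral_eq_inner h2 h4, setIntegral_mul_eq_inner hf h3]
    · exact hw.2 ζ hζ
    · filter_upwards [sobolevZero_snd_eq_zero hζ] with x hx hx'
      exact Or.inr (hx hx')

/-- The adjoint equation is a state equation for the Hilbert space adjoint of `T`, so existence and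
uniqueness carry over. -/
theorem isAdjoint_iff {T : L2v d →L[ℝ] L2v d} {a : E d → Mat d} (hT : Represents Ω T a)
    {y yd : E d → ℝ} (hy : MemLp (y - yd) 2 (volume.restrict (Ω : Set (E d)))) {p : E d → ℝ}
    {gp : E d → E d} :
    IsAdjoint Ω a y yd p gp ↔
      ∃ w, IsWeakSol Ω T.adjoint ((memLp_indicator_of_restrict hy).toLp _) w ∧
        p =ᵐ[volume.restrict (Ω : Set (E d))] w.fst ∧
        gp =ᵐ[volume.restrict (Ω : Set (E d))] w.snd := by
  constructor
  · rintro ⟨h10, h⟩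
    obtain ⟨w, hw, h1, h2⟩ := memH10_iff.1 h10
    refine ⟨w, ⟨hw, fun v hv => ?_⟩, h1, h2⟩
    have := h v.fst v.snd (memH10_iff.2 ⟨v, hv, .rfl, .rfl⟩)
    rw [hT.setIntegral_eq_inner .rfl h2] at this
    · rw [ContinuousLinearMap.adjoint_inner_left, real_inner_comm, this]
      exact setIntegral_mul_eq_inner hy .rfl
    filter_upwards [sobolevZero_snd_eq_zero hw] with x hx hx'
    exact Or.inr (hx hx')
  · rintro ⟨w, hw, h1, h2⟩
    refine ⟨memH10_iff.2 ⟨w, hw.1, h1, h2⟩, fun v gv hv => ?_⟩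
    obtain ⟨ζ, hζ, h3, h4⟩ := memH10_iff.1 hv
    rw [hT.setIntegral_eq_inner h4 h2]
    · have := hw.2 ζ hζ
      rw [ContinuousLinearMap.adjoint_inner_left, real_inner_comm] at this
      rw [this]
      exact (setIntegral_mul_eq_inner hy h3).symm
    · filter_upwards [sobolevZero_snd_eq_zero hw.1] with x hx hx'
      exact Or.inr (hx hx')

/-- The value of `cost` depends on a chosen state; uniqueness makes the choice irrelevant. -/
theorem cost_eq (hd : 0 < d) (hΩ : Bornology.IsBounded (Ω : Set (E d))) {α : ℝ} (hα : 0 < α)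
    {T : L2v d →L[ℝ] L2v d} (hT : IsCoefficientOp α T) {a : E d → Mat d}
    (hTa : Represents Ω T a) {f yd : E d → ℝ}
    (hf : MemLp f 2 (volume.restrict (Ω : Set (E d))))
    (hyd : MemLp yd 2 (volume.restrict (Ω : Set (E d)))) {w : L2Pair d}
    (hw : IsWeakSol Ω T ((memLp_indicator_of_restrict hf).toLp _) w) :
    cost Ω f yd a = 1 / 2 * ‖w.fst - (memLp_indicator_of_restrict hyd).toLp _‖ ^ 2 := by
  have hex : ∃ y : E d → ℝ, ∃ gy : E d → E d, IsState Ω a f y gy :=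
    ⟨w.fst, w.snd, (isState_iff hTa hf).2 ⟨w, hw, .rfl, .rfl⟩⟩
  rw [cost, dif_pos hex]
  obtain ⟨gy, hgy⟩ := hex.choose_spec
  obtain ⟨w', hw', h1, -⟩ := (isState_iff hTa hf).1 hgy
  obtain rfl := hw.unique hd hΩ hα hT hw'
  congr 1
  rw [← real_inner_self_eq_norm_sq, L2.inner_def,
    ← setIntegral_eq_integral_of_ae_compl_eq_zero (μ := volume) (s := (Ω : Set (E d)))]
  · refine integral_congr_ae ?_
    filter_upwards [h1, toLp_indicator_ae_eq hyd, ae_restrict_of_ae (Lp.coeFn_sub w'.fst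
      ((memLp_indicator_of_restrict hyd).toLp _))] with x h2 h3 h4
    rw [h4, Pi.sub_apply, h3, h2, real_inner_self_eq_norm_sq, Real.norm_eq_abs, sq_abs]
  · filter_upwards [sobolevZero_fst_eq_zero hw.1, (memLp_indicator_of_restrict hyd).coeFn_toLp,
      Lp.coeFn_sub w'.fst ((memLp_indicator_of_restrict hyd).toLp _)] with x h2 h3 h4 hx
    rw [h4, Pi.sub_apply, h3, h2 hx, Set.indicator_of_notMem hx, sub_zero, inner_zero_left]

lemma act_eq (A : Mat d) (ξ : E d) : act A ξ = Matrix.toEuclideanCLM (𝕜 := ℝ) A ξ := rfl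

/-- Expansion in matrix units reduces the claim to the entries, without a norm on matrices. -/
lemma memLp_linearMap_matrix {F : Type*} [NormedAddCommGroup F] [NormedSpace ℝ F]
    (L : Mat d →ₗ[ℝ] F) {μ : Measure (E d)} {a : E d → Mat d}
    (ha : ∀ i j, MemLp (fun x => a x i j) ∞ μ) : MemLp (fun x => L (a x)) ∞ μ := by
  have : (fun x => L (a x)) = fun x => ∑ i, ∑ j,
      (ContinuousLinearMap.toSpanSingleton ℝ (L (Matrix.single i j (1 : ℝ)))) (a x i j) := by
    ext1 x
    conv_lhs => rw [Matrix.matrix_eq_sum_single (a x)]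
    simp only [map_sum, ContinuousLinearMap.toSpanSingleton_apply, ← map_smul, Matrix.smul_single,
      smul_eq_mul, mul_one]
  rw [this]
  exact memLp_finsetSum _ fun i _ => memLp_finsetSum _ fun j _ =>
    ContinuousLinearMap.comp_memLp' _ (ha i j)

lemma memLp_top_toEuclideanCLM {μ : Measure (E d)} {a : E d → Mat d}
    (ha : ∀ i j, MemLp (fun x => a x i j) ∞ μ) :
    MemLp (fun x => Matrix.toEuclideanCLM (𝕜 := ℝ) (a x)) ∞ μ :=
  memLp_linearMap_matrix (F := E d →L[ℝ] E d)
    { toFun := Matrix.toEuclideanCLM (𝕜 := ℝ), map_add' := map_add _, map_smul' := map_smul _ } ha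

open Classical in
lemma memLp_top_ite {F : Type*} [NormedAddCommGroup F] {f : E d → F}
    (hf : MemLp f ∞ (volume.restrict (Ω : Set (E d)))) (c : F) :
    MemLp (fun x => if x ∈ Ω then f x else c) ∞ volume :=
  MemLp.piecewise (g := fun _ => c) Ω.isOpen.measurableSet hf (memLp_top_const c)

open Classical in
/-- An everywhere defined coefficient operator extending `a`. -/
def coefficientExt (Ω : Opens (E d)) (α : ℝ) (a : E d → Mat d) (x : E d) : E d →L[ℝ] E d :=
  if x ∈ Ω then Matrix.toEuclideanCLM (𝕜 := ℝ) (a x) else α • ContinuousLinearMap.id ℝ (E d)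

lemma coefficientExt_of_mem {α : ℝ} {a : E d → Mat d} {x : E d} (hx : x ∈ Ω) :
    coefficientExt Ω α a x = Matrix.toEuclideanCLM (𝕜 := ℝ) (a x) := if_pos hx

lemma memLp_coefficientExt {α : ℝ} {a : E d → Mat d} (ha : a ∈ admissibleCoefficients Ω α) :
    MemLp (coefficientExt Ω α a) ∞ volume := by
  classical
  exact memLp_top_ite (F := E d →L[ℝ] E d) (memLp_top_toEuclideanCLM ha.1) _

/-- Off Ω the extension α·id satisfies the bound with equality. -/
lemma coefficientExt_coercive {α : ℝ} {a : E d → Mat d} (ha : a ∈ admissibleCoefficients Ω α) :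
    ∀ᵐ x, ∀ ξ, α * ‖ξ‖ ^ 2 ≤ inner ℝ ξ (coefficientExt Ω α a x ξ) := by
  filter_upwards [(ae_restrict_iff' Ω.isOpen.measurableSet).1 ha.2] with x hx ξ
  by_cases hx' : x ∈ (Ω : Set (E d))
  · rw [coefficientExt_of_mem hx']
    exact hx hx' ξ
  · rw [coefficientExt, if_neg (show x ∉ Ω from hx')]
    simp [inner_smul_right]

lemma represents_perturbOp {T : L2v d →L[ℝ] L2v d} {a : E d → Mat d} (hT : Represents Ω T a)
    (b : Mat d) (x₀ : E d) (ω : Set (E d)) (r : ℝ)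
    (hs : MeasurableSet ((fun z => x₀ + r • z) '' ω)) :
    Represents Ω (perturbOp ((fun z => x₀ + r • z) '' ω) T
      ((Matrix.toEuclideanCLM (𝕜 := ℝ) b).compLpL 2 volume)) (perturbedCoefficient a b x₀ ω r) := by
  intro g
  set B := (Matrix.toEuclideanCLM (𝕜 := ℝ) b).compLpL 2 (volume : Measure (E d))
  rw [perturbOp_apply]
  filter_upwards [hT g, indicatorOp_coeFn hs (B g - T g), Lp.coeFn_sub (B g) (T g),
    Lp.coeFn_add (T g) (indicatorOp ((fun z => x₀ + r • z) '' ω) (B g - T g)),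
    (Matrix.toEuclideanCLM (𝕜 := ℝ) b).coeFn_compLpL (p := 2) (μ := volume) g] with x h1 h2 h3 h4 h5 hx
  rw [h4, Pi.add_apply, h1 hx, h2, perturbedCoefficient]
  by_cases hx' : x ∈ (fun z => x₀ + r • z) '' ω
  · rw [Set.indicator_of_mem hx', Set.indicator_of_mem hx', h3, Pi.sub_apply, h5, h1 hx]
    simp only [act_eq]
    rw [add_sub_cancel, add_sub_cancel]
  · rw [Set.indicator_of_notMem hx', Set.indicator_of_notMem hx', add_zero, add_zero]

end Correspondence

/-! ### Rescaling around x₀ -/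

section Rescaling

variable {d : ℕ}

lemma integral_comp_add_smul {F : Type*} [NormedAddCommGroup F] [NormedSpace ℝ F] (f : E d → F)
    (x₀ : E d) {r : ℝ} (hr : 0 < r) :
    ∫ x, f (x₀ + r • x) = (r ^ d)⁻¹ • ∫ x, f x := by
  rw [Measure.integral_comp_smul volume (fun x => f (x₀ + x)) r,
    integral_add_left_eq_self f x₀, finrank_euclideanSpace_fin, abs_of_pos (by positivity)]

lemma setIntegral_comp_add_smul {F : Type*} [NormedAddCommGroup F] [NormedSpace ℝ F]
    (f : E d → F) (x₀ : E d) {r : ℝ} (hr : 0 < r) {s t : Set (E d)} (hs : MeasurableSet s)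
    (ht : MeasurableSet t) (hst : ∀ x, x₀ + r • x ∈ t ↔ x ∈ s) :
    ∫ x in s, f (x₀ + r • x) = (r ^ d)⁻¹ • ∫ x in t, f x := by
  rw [← integral_indicator hs, ← integral_indicator ht, ← integral_comp_add_smul _ x₀ hr]
  congr 1
  ext x
  by_cases hx : x ∈ s
  · rw [Set.indicator_of_mem hx, Set.indicator_of_mem ((hst x).2 hx)]
  · rw [Set.indicator_of_notMem hx, Set.indicator_of_notMem fun h => hx ((hst x).1 h)]

lemma map_add_smul (x₀ : E d) {r : ℝ} (hr : 0 < r) :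
    Measure.map (fun x : E d => x₀ + r • x) volume =
      ENNReal.ofReal |(r ^ d)⁻¹| • (volume : Measure (E d)) := by
  have h1 : (fun x : E d => x₀ + r • x) = (fun x => x₀ + x) ∘ fun x => r • x := rfl
  rw [h1, ← Measure.map_map (by fun_prop) (by fun_prop), Measure.map_addHaar_smul _ hr.ne',
    Measure.map_smul, map_add_left_eq_self, finrank_euclideanSpace_fin]

lemma MemLp.comp_add_smul {F : Type*} [NormedAddCommGroup F] {p : ℝ≥0∞} {f : E d → F}
    (hf : MemLp f p volume) (x₀ : E d) {r : ℝ} (hr : 0 < r) :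
    MemLp (fun x => f (x₀ + r • x)) p volume := by
  refine MemLp.comp_of_map (f := fun x : E d => x₀ + r • x) ?_ (by fun_prop)
  rw [map_add_smul x₀ hr]
  exact hf.smul_measure ENNReal.ofReal_ne_top

lemma quasiMeasurePreserving_add_smul (x₀ : E d) {r : ℝ} (hr : 0 < r) :
    Measure.QuasiMeasurePreserving (fun x : E d => x₀ + r • x) volume volume :=
  ⟨by fun_prop, by rw [map_add_smul x₀ hr]; exact Measure.smul_absolutelyContinuous⟩

/-- The rescaling `g ↦ g(x₀ + r ·)` of vector fields around `x₀`, for `r > 0`. -/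
def rescale (x₀ : E d) (r : ℝ) : L2v d →ₗ[ℝ] L2v d :=
  if hr : 0 < r then
    { toFun := fun g => (MemLp.comp_add_smul (Lp.memLp g) x₀ hr).toLp _
      map_add' := fun g h => by
        rw [← MemLp.toLp_add]
        refine MemLp.toLp_congr _ _ ?_
        exact (quasiMeasurePreserving_add_smul x₀ hr).ae (Lp.coeFn_add g h)
      map_smul' := fun c g => by
        rw [RingHom.id_apply, ← MemLp.toLp_const_smul]
        refine MemLp.toLp_congr _ _ ?_
        exact (quasiMeasurePreserving_add_smul x₀ hr).ae (Lp.coeFn_smul c g) }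
  else 0

lemma rescale_coeFn (x₀ : E d) {r : ℝ} (hr : 0 < r) (g : L2v d) :
    rescale x₀ r g =ᵐ[volume] fun x => g (x₀ + r • x) := by
  rw [rescale, dif_pos hr]
  exact (MemLp.comp_add_smul (Lp.memLp g) x₀ hr).coeFn_toLp

/-- The Jacobian r^{-d} is the normalisation of the difference quotient, so the quotient becomes a
pairing of rescaled fields. -/
lemma inner_rescale (x₀ : E d) {r : ℝ} (hr : 0 < r) (g h : L2v d) :
    inner ℝ (rescale x₀ r g) (rescale x₀ r h) = (r ^ d)⁻¹ * inner ℝ g h := by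
  rw [L2.inner_def, L2.inner_def, ← smul_eq_mul,
    ← integral_comp_add_smul (fun x => inner ℝ (g x) (h x)) x₀ hr]
  refine integral_congr_ae ?_
  filter_upwards [rescale_coeFn x₀ hr g, rescale_coeFn x₀ hr h] with x h1 h2
  rw [h1, h2]

lemma norm_rescale_sq (x₀ : E d) {r : ℝ} (hr : 0 < r) (g : L2v d) :
    ‖rescale x₀ r g‖ ^ 2 = (r ^ d)⁻¹ * ‖g‖ ^ 2 := by
  rw [← real_inner_self_eq_norm_sq, inner_rescale x₀ hr, real_inner_self_eq_norm_sq]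

lemma continuous_rescale (x₀ : E d) {r : ℝ} (hr : 0 < r) : Continuous (rescale x₀ r) := by
  refine AddMonoidHomClass.continuous_of_bound (rescale x₀ r) (Real.sqrt (r ^ d)⁻¹) fun g => ?_
  refine (sq_le_sq₀ (norm_nonneg _) (by positivity)).1 ?_
  rw [norm_rescale_sq x₀ hr, mul_pow, Real.sq_sqrt (by positivity)]

lemma add_smul_mem_image_iff (x₀ : E d) {r : ℝ} (hr : 0 < r) {ω : Set (E d)} (x : E d) :
    x₀ + r • x ∈ (fun z => x₀ + r • z) '' ω ↔ x ∈ ω := by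
  refine ⟨?_, fun hx => ⟨x, hx, rfl⟩⟩
  rintro ⟨z, hz, h⟩
  have : z = x := by simpa [hr.ne'] using h
  exact this ▸ hz

lemma isOpen_image_add_smul (x₀ : E d) {r : ℝ} (hr : 0 < r) {ω : Set (E d)} (hω : IsOpen ω) :
    IsOpen ((fun z => x₀ + r • z) '' ω) :=
  ((Homeomorph.smulOfNeZero r hr.ne').trans (Homeomorph.addLeft x₀)).isOpenMap _ hω

lemma rescale_indicatorOp (x₀ : E d) {r : ℝ} (hr : 0 < r) {ω : Set (E d)} (hω : IsOpen ω)
    (g : L2v d) :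
    rescale x₀ r (indicatorOp ((fun z => x₀ + r • z) '' ω) g) =
      indicatorOp ω (rescale x₀ r g) := by
  apply Lp.ext
  filter_upwards [rescale_coeFn x₀ hr (indicatorOp ((fun z => x₀ + r • z) '' ω) g),
    indicatorOp_coeFn hω.measurableSet (rescale x₀ r g), rescale_coeFn x₀ hr g,
    (quasiMeasurePreserving_add_smul x₀ hr).ae
      (indicatorOp_coeFn (isOpen_image_add_smul x₀ hr hω).measurableSet g)] with x h1 h2 h3 h4
  rw [h1, h2, h4]
  by_cases hx : x ∈ ω
  · rw [Set.indicator_of_mem hx, Set.indicator_of_mem ((add_smul_mem_image_iff x₀ hr x).2 hx), h3]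
  · rw [Set.indicator_of_notMem hx,
      Set.indicator_of_notMem fun h => hx ((add_smul_mem_image_iff x₀ hr x).1 h)]

lemma rescale_compLpL (x₀ : E d) {r : ℝ} (hr : 0 < r) (B : E d →L[ℝ] E d) (g : L2v d) :
    rescale x₀ r (B.compLpL 2 volume g) = B.compLpL 2 volume (rescale x₀ r g) := by
  apply Lp.ext
  filter_upwards [rescale_coeFn x₀ hr (B.compLpL 2 volume g), B.coeFn_compLpL (rescale x₀ r g),
    rescale_coeFn x₀ hr g,
    (quasiMeasurePreserving_add_smul x₀ hr).ae (B.coeFn_compLpL g)] with x h1 h2 h3 h4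
  rw [h1, h2, h3, h4]

/-- The test function `x ↦ c⁻¹ φ(x₁ + c x)`. -/
def TestFunction.affineComp {U V : Opens (E d)} (φ : 𝓓(U, ℝ)) (x₁ : E d) {c : ℝ} (hc : 0 < c)
    (h : ∀ x, x₁ + c • x ∈ tsupport φ → x ∈ V) : 𝓓(V, ℝ) where
  toFun x := c⁻¹ * φ (x₁ + c • x)
  contDiff' := contDiff_const.mul (φ.contDiff.comp (by fun_prop))
  hasCompactSupport' := by
    have := φ.hasCompactSupport.comp_homeomorph
      ((Homeomorph.smulOfNeZero c hc.ne').trans (Homeomorph.addLeft x₁))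
    exact this.mul_left
  tsupport_subset' := by
    intro x hx
    refine h x ?_
    have h1 : tsupport (fun x => c⁻¹ * φ (x₁ + c • x)) ⊆
        (fun x => x₁ + c • x) ⁻¹' tsupport φ := by
      refine closure_minimal (fun y hy => ?_) ((isClosed_tsupport _).preimage (by fun_prop))
      exact subset_tsupport _ fun h0 => hy (by simp [h0])
    exact h1 hx

lemma TestFunction.gradient_affineComp {U V : Opens (E d)} (φ : 𝓓(U, ℝ)) (x₁ : E d) {c : ℝ}
    (hc : 0 < c) (h : ∀ x, x₁ + c • x ∈ tsupport φ → x ∈ V) (x : E d) :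
    gradient (φ.affineComp x₁ hc h) x = gradient φ (x₁ + c • x) := by
  have h1 : HasFDerivAt (fun x : E d => x₁ + c • x) (c • ContinuousLinearMap.id ℝ (E d)) x :=
    ((hasFDerivAt_id x).const_smul c).const_add x₁
  have h2 := ((φ.differentiable (x₁ + c • x)).hasFDerivAt.comp x h1).const_mul c⁻¹
  have h3 : fderiv ℝ (φ.affineComp x₁ hc h) x = fderiv ℝ φ (x₁ + c • x) := by
    refine h2.fderiv.trans ?_
    ext v
    simp [hc.ne']
  rw [gradient, gradient, h3]

/-- For a test function the rescaled gradient is the gradient of r⁻¹φ(x₀ + r·). Continuity of the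
rescaling extends this to limits, with no control of function values on ℝ^d. -/
lemma rescale_mem_gradientClosure {Ω : Opens (E d)} (x₀ : E d) {r : ℝ} (hr : 0 < r)
    {w : L2Pair d} (hw : w ∈ sobolevZero Ω) : rescale x₀ r w.snd ∈ gradientClosure d := by
  refine sobolevZero_induction (P := fun w => rescale x₀ r w.snd ∈ gradientClosure d)
    (isClosed_gradientClosure.preimage ((continuous_rescale x₀ hr).comp continuous_L2Pair_snd))
    (fun φ => ?_) hw
  have h1 := gradient_mem_gradientClosure
    (φ.affineComp (V := ⊤) x₀ hr fun x _ => Set.mem_univ x)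
  convert h1 using 1
  apply Lp.ext
  filter_upwards [rescale_coeFn x₀ hr (testPair Ω φ).snd, (φ.affineComp (V := ⊤) x₀ hr
    fun x _ => Set.mem_univ x).memLp_gradient.coeFn_toLp,
    (quasiMeasurePreserving_add_smul x₀ hr).ae φ.memLp_gradient.coeFn_toLp] with x h2 h3 h4
  rw [h2, h3, testPair_snd, h4, φ.gradient_affineComp]

/-- A test function on `ℝ^d` can be transplanted to `Ω` around `x₀` at small scales. -/
lemma eventually_exists_rescale_eq {Ω : Opens (E d)} {x₀ : E d} (hx₀ : x₀ ∈ Ω)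
    (φ : 𝓓((⊤ : Opens (E d)), ℝ)) :
    ∀ᶠ r in 𝓝[>] (0 : ℝ), ∃ v ∈ sobolevZero Ω,
      ∀ᵐ x, v.snd (x₀ + r • x) = gradient φ x := by
  obtain ⟨ρ, hρ, hρΩ⟩ := Metric.isOpen_iff.1 Ω.isOpen x₀ hx₀
  obtain ⟨R, hR, hφR⟩ := φ.hasCompactSupport.isBounded.subset_closedBall_lt 0 0
  -- For r < ρ/R the scaled support, inside the ball of radius rR about x₀, stays within Ω.
  filter_upwards [Ioo_mem_nhdsGT (show 0 < ρ / R by positivity)] with r hr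
  have hr0 : 0 < r := hr.1
  have hsub : ∀ x, -(r⁻¹ • x₀) + r⁻¹ • x ∈ tsupport φ → x ∈ Ω := by
    intro x hx
    apply hρΩ
    have h1 := hφR hx
    rw [mem_closedBall_zero_iff, neg_add_eq_sub, ← smul_sub, norm_smul, norm_inv,
      Real.norm_of_nonneg hr0.le, inv_mul_le_iff₀ hr0] at h1
    rw [mem_ball_iff_norm]
    have h2 := hr.2
    rw [lt_div_iff₀ hR] at h2
    linarith
  refine ⟨_, testPair_mem (φ.affineComp _ (inv_pos.2 hr0) hsub), ?_⟩
  filter_upwards [(quasiMeasurePreserving_add_smul x₀ hr0).ae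
    (φ.affineComp _ (inv_pos.2 hr0) hsub).memLp_gradient.coeFn_toLp] with x hx
  rw [testPair_snd, hx, TestFunction.gradient_affineComp]
  congr 1
  rw [smul_add, smul_smul, inv_mul_cancel₀ hr0.ne', one_smul]
  abel

end Rescaling

/-! ### Lebesgue points in quadratic mean -/

section LebesguePoints

variable {d : ℕ} {F : Type*} [NormedAddCommGroup F]

lemma locallyIntegrable_norm_sub_sq {g : E d → F}
    (hg : ∀ K : Set (E d), IsCompact K → MemLp g 2 (volume.restrict K)) (c : F) :
    LocallyIntegrable (fun x => ‖g x - c‖ ^ 2) (volume : Measure (E d)) := by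
  rw [locallyIntegrable_iff]
  intro K hK
  have : IsFiniteMeasure (volume.restrict K) := ⟨by simpa using hK.measure_lt_top⟩
  exact ((hg K hK).sub (memLp_const c)).integrable_norm_pow two_ne_zero

/-- `x₀` is a Lebesgue point of `g` in the sense of quadratic means. -/
def IsLebesguePoint (g : E d → F) (x₀ : E d) : Prop :=
  ∀ R : ℝ, 0 < R → Tendsto
    (fun r : ℝ => ∫ x in Metric.closedBall (0 : E d) R, ‖g (x₀ + r • x) - g x₀‖ ^ 2)
    (𝓝[>] 0) (𝓝 0)

lemma add_smul_mem_closedBall_iff (x₀ : E d) {r R : ℝ} (hr : 0 < r) (x : E d) :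
    x₀ + r • x ∈ Metric.closedBall x₀ (r * R) ↔ x ∈ Metric.closedBall 0 R := by
  rw [mem_closedBall_iff_norm, mem_closedBall_zero_iff, add_sub_cancel_left, norm_smul,
    Real.norm_of_nonneg hr.le, mul_le_mul_iff_right₀ hr]

lemma setIntegral_closedBall_comp_eq_average (f : E d → ℝ) (x₀ : E d) {r R : ℝ} (hr : 0 < r)
    (hR : 0 < R) :
    ∫ x in Metric.closedBall (0 : E d) R, f (x₀ + r • x) =
      volume.real (Metric.closedBall (0 : E d) R) * ⨍ x in Metric.closedBall x₀ (r * R), f x := by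
  have h1 := setIntegral_comp_add_smul f x₀ hr Metric.isClosed_closedBall.measurableSet
    Metric.isClosed_closedBall.measurableSet (add_smul_mem_closedBall_iff x₀ (R := R) hr)
  have h2 := setIntegral_comp_add_smul (fun _ => (1 : ℝ)) x₀ hr
    Metric.isClosed_closedBall.measurableSet
    Metric.isClosed_closedBall.measurableSet (add_smul_mem_closedBall_iff x₀ (R := R) hr)
  simp only [setIntegral_const, smul_eq_mul, mul_one] at h2
  have h3 : 0 < volume.real (Metric.closedBall x₀ (r * R)) :=
    ENNReal.toReal_pos (Metric.measure_closedBall_pos _ _ (by positivity)).ne'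
      measure_closedBall_lt_top.ne
  rw [h1, setAverage_eq, smul_eq_mul, smul_eq_mul, h2]
  field_simp

/-- Lebesgue differentiation of |g - c|² holds off a null set depending on c. A countable dense set
of c has a common null set, and g(x₀) is then approximated by such c. -/
theorem ae_isLebesguePoint [SecondCountableTopology F] {g : E d → F}
    (hg : ∀ K : Set (E d), IsCompact K → MemLp g 2 (volume.restrict K)) :
    ∀ᵐ x₀, IsLebesguePoint g x₀ := by
  obtain ⟨D, hDc, hD⟩ := exists_countable_dense F
  have h : ∀ᵐ x₀ : E d, ∀ c ∈ D, ∀ R : ℝ, 0 < R → Tendsto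
      (fun r : ℝ => ⨍ x in Metric.closedBall x₀ (r * R), ‖g x - c‖ ^ 2) (𝓝[>] 0)
      (𝓝 (‖g x₀ - c‖ ^ 2)) := by
    rw [ae_ball_iff hDc]
    intro c _
    filter_upwards [IsUnifLocDoublingMeasure.ae_tendsto_average volume
      (locallyIntegrable_norm_sub_sq hg c) 1] with x₀ hx₀ R hR
    refine hx₀ (fun _ => x₀) (fun r => r * R) ?_ ?_
    · refine tendsto_nhdsWithin_iff.2 ⟨?_, ?_⟩
      · have : Tendsto (fun r : ℝ => r * R) (𝓝 0) (𝓝 (0 * R)) :=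
          (continuous_id.mul continuous_const).tendsto 0
        rw [zero_mul] at this
        exact this.mono_left nhdsWithin_le_nhds
      · filter_upwards [self_mem_nhdsWithin] with r hr
        exact mul_pos hr hR
    · filter_upwards [self_mem_nhdsWithin] with r hr
      exact Metric.mem_closedBall_self (by have := mul_pos hr hR; simpa using this.le)
  filter_upwards [h] with x₀ hx₀ R hR
  set V := volume.real (Metric.closedBall (0 : E d) R)
  have hV : 0 ≤ V := measureReal_nonneg
  rw [Metric.tendsto_nhds]
  intro ε hε
  -- From |g - g(x₀)|² ≤ 2|g - c|² + 2|g(x₀) - c|² the average is below 4ε/(8(V + 1)), which times V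
  -- is below ε.
  obtain ⟨c, hcD, hc⟩ := hD.exists_dist_lt (g x₀)
    (show 0 < Real.sqrt (ε / (8 * (V + 1))) by positivity)
  have hc2 : ‖g x₀ - c‖ ^ 2 < ε / (8 * (V + 1)) := by
    rw [dist_eq_norm] at hc
    exact (Real.lt_sqrt (norm_nonneg _)).1 hc
  filter_upwards [(hx₀ c hcD R hR).eventually_lt_const hc2, self_mem_nhdsWithin] with r hr hr0
  have hr0 : 0 < r := hr0
  rw [Real.dist_0_eq_abs, setIntegral_closedBall_comp_eq_average (fun x => ‖g x - g x₀‖ ^ 2) x₀ hr0 hR]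
  have hint : ∀ c, IntegrableOn (fun x => ‖g x - c‖ ^ 2) (Metric.closedBall x₀ (r * R)) volume :=
    fun c => (locallyIntegrable_norm_sub_sq hg c).integrableOn_isCompact
      (isCompact_closedBall _ _)
  have h3 : 0 < volume.real (Metric.closedBall x₀ (r * R)) :=
    ENNReal.toReal_pos (Metric.measure_closedBall_pos _ _ (by positivity)).ne'
      measure_closedBall_lt_top.ne
  have hconst : IntegrableOn (fun _ : E d => 2 * ‖g x₀ - c‖ ^ 2) (Metric.closedBall x₀ (r * R))
      volume := integrableOn_const measure_closedBall_lt_top.ne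
  have hle : ⨍ x in Metric.closedBall x₀ (r * R), ‖g x - g x₀‖ ^ 2 ≤
      2 * (⨍ x in Metric.closedBall x₀ (r * R), ‖g x - c‖ ^ 2) + 2 * ‖g x₀ - c‖ ^ 2 := by
    simp only [setAverage_eq, smul_eq_mul]
    have : ∫ x in Metric.closedBall x₀ (r * R), ‖g x - g x₀‖ ^ 2 ≤
        ∫ x in Metric.closedBall x₀ (r * R), (2 * ‖g x - c‖ ^ 2 + 2 * ‖g x₀ - c‖ ^ 2) := by
      refine integral_mono (hint _) (((hint c).const_mul 2).add hconst) fun x => ?_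
      have h1 : ‖g x - g x₀‖ ≤ ‖g x - c‖ + ‖g x₀ - c‖ := by
        have := norm_sub_le (g x - c) (g x₀ - c)
        rwa [sub_sub_sub_cancel_right] at this
      have h2 := pow_le_pow_left₀ (norm_nonneg _) h1 2
      nlinarith [sq_nonneg (‖g x - c‖ - ‖g x₀ - c‖)]
    rw [integral_add ((hint c).const_mul 2) hconst, integral_const_mul, setIntegral_const,
      smul_eq_mul] at this
    rw [inv_mul_le_iff₀ h3]
    refine this.trans (le_of_eq ?_)
    field_simp
  have hnn : 0 ≤ ⨍ x in Metric.closedBall x₀ (r * R), ‖g x - g x₀‖ ^ 2 := by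
    rw [setAverage_eq, smul_eq_mul]
    exact mul_nonneg (inv_nonneg.2 h3.le) (integral_nonneg fun x => sq_nonneg _)
  rw [abs_of_nonneg (mul_nonneg hV hnn)]
  have h5 : ⨍ x in Metric.closedBall x₀ (r * R), ‖g x - g x₀‖ ^ 2 ≤ ε / (2 * (V + 1)) := by
    have : ε / (2 * (V + 1)) = 4 * (ε / (8 * (V + 1))) := by field_simp; norm_num
    rw [this]
    linarith
  calc _ ≤ V * (ε / (2 * (V + 1))) := mul_le_mul_of_nonneg_left h5 hV
    _ < ε := by
      rw [mul_div_assoc', div_lt_iff₀ (by positivity)]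
      nlinarith

/-- At a Lebesgue point, the rescalings converge strongly to a constant on bounded sets. -/
lemma IsLebesguePoint.tendsto_rescale {g : L2v d} {x₀ : E d} (hg : IsLebesguePoint g x₀)
    {ω : Set (E d)} (hω : MeasurableSet ω) (hωb : Bornology.IsBounded ω) :
    Tendsto (fun r => indicatorOp ω (rescale x₀ r g)) (𝓝[>] 0)
      (𝓝 (indicatorConstLp 2 hω hωb.measure_lt_top.ne (g x₀))) := by
  obtain ⟨R, hR, hωR⟩ := hωb.subset_closedBall_lt 0 0
  rw [tendsto_iff_norm_sub_tendsto_zero]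
  have h0 : Tendsto (fun r : ℝ => Real.sqrt
      (∫ x in Metric.closedBall (0 : E d) R, ‖g (x₀ + r • x) - g x₀‖ ^ 2)) (𝓝[>] 0) (𝓝 0) := by
    have := (hg R hR).sqrt
    rwa [Real.sqrt_zero] at this
  refine squeeze_zero' (Eventually.of_forall fun _ => norm_nonneg _) ?_ h0
  filter_upwards [self_mem_nhdsWithin] with r hr
  have hr : 0 < r := hr
  refine Real.le_sqrt_of_sq_le ?_
  rw [norm_sq_eq_integral, ← integral_indicator Metric.isClosed_closedBall.measurableSet]
  refine integral_mono_ae ((Lp.memLp _).integrable_norm_pow two_ne_zero) ?_ ?_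
  · rw [integrable_indicator_iff Metric.isClosed_closedBall.measurableSet]
    have : IsFiniteMeasure (volume.restrict (Metric.closedBall (0 : E d) R)) :=
      ⟨by simpa using measure_closedBall_lt_top⟩
    exact (((MemLp.comp_add_smul (Lp.memLp g) x₀ hr).restrict _).sub
      (memLp_const _)).integrable_norm_pow two_ne_zero
  · filter_upwards [Lp.coeFn_sub (indicatorOp ω (rescale x₀ r g))
      (indicatorConstLp 2 hω hωb.measure_lt_top.ne (g x₀)), indicatorOp_coeFn hω (rescale x₀ r g),
      rescale_coeFn x₀ hr g, indicatorConstLp_coeFn (p := 2) (hs := hω)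
        (hμs := hωb.measure_lt_top.ne) (c := g x₀)] with x h1 h2 h3 h4
    rw [h1, Pi.sub_apply, h2, h4]
    by_cases hx : x ∈ ω
    · rw [Set.indicator_of_mem hx, Set.indicator_of_mem hx, Set.indicator_of_mem (hωR hx), h3]
    · rw [Set.indicator_of_notMem hx, Set.indicator_of_notMem hx, sub_zero, norm_zero]
      simp only [ne_eq, OfNat.ofNat_ne_zero, not_false_eq_true, zero_pow]
      exact Set.indicator_nonneg (fun _ _ => sq_nonneg _) x

/-- Freezing a coefficient at a Lebesgue point: multiplication by `A(x₀ + r ·)` converges on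
compactly supported fields. -/
lemma IsLebesguePoint.tendsto_mul {A : E d → E d →L[ℝ] E d} {x₀ : E d}
    (hA : IsLebesguePoint A x₀) (hAm : MemLp A ∞ volume) {φ : E d → E d} (hφ : Continuous φ)
    (hφc : HasCompactSupport φ) {G : L2v d} (hG : G =ᵐ[volume] φ) {u : ℝ → L2v d}
    (hu : ∀ᶠ r in 𝓝[>] (0 : ℝ), u r =ᵐ[volume] fun x => A (x₀ + r • x) (φ x)) :
    Tendsto u (𝓝[>] 0) (𝓝 ((A x₀).compLpL 2 volume G)) := by
  obtain ⟨R, hR, hφR⟩ := hφc.isBounded.subset_closedBall_lt 0 0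
  obtain ⟨C, hC⟩ := hφ.bounded_above_of_compact_support hφc
  have hC0 : 0 ≤ C := (norm_nonneg _).trans (hC 0)
  rw [tendsto_iff_norm_sub_tendsto_zero]
  have h0 : Tendsto (fun r : ℝ => Real.sqrt (C ^ 2 *
      ∫ x in Metric.closedBall (0 : E d) R, ‖A (x₀ + r • x) - A x₀‖ ^ 2)) (𝓝[>] 0) (𝓝 0) := by
    have := ((hA R hR).const_mul (C ^ 2)).sqrt
    rwa [mul_zero, Real.sqrt_zero] at this
  refine squeeze_zero' (Eventually.of_forall fun _ => norm_nonneg _) ?_ h0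
  filter_upwards [self_mem_nhdsWithin, hu] with r hr hur
  have hr : 0 < r := hr
  refine Real.le_sqrt_of_sq_le ?_
  rw [norm_sq_eq_integral, ← integral_const_mul,
    ← integral_indicator Metric.isClosed_closedBall.measurableSet]
  refine integral_mono_ae ((Lp.memLp _).integrable_norm_pow two_ne_zero) ?_ ?_
  · rw [integrable_indicator_iff Metric.isClosed_closedBall.measurableSet]
    have : IsFiniteMeasure (volume.restrict (Metric.closedBall (0 : E d) R)) :=
      ⟨by simpa using measure_closedBall_lt_top⟩
    have h2 : MemLp (fun x => A (x₀ + r • x)) 2 (volume.restrict (Metric.closedBall (0 : E d) R)) :=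
      ((MemLp.comp_add_smul hAm x₀ hr).restrict _).mono_exponent le_top
    exact ((h2.sub (memLp_const (A x₀))).integrable_norm_pow two_ne_zero).const_mul _
  · filter_upwards [Lp.coeFn_sub (u r) ((A x₀).compLpL 2 volume G), hur, hG,
      (A x₀).coeFn_compLpL G] with x h1 h2 h3 h4
    rw [h1, Pi.sub_apply, h2, h4, h3]
    by_cases hx : x ∈ Metric.closedBall (0 : E d) R
    · rw [Set.indicator_of_mem hx, ← _root_.sub_apply, mul_comm, ← mul_pow]
      refine pow_le_pow_left₀ (norm_nonneg _) ?_ 2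
      exact (ContinuousLinearMap.le_opNorm _ _).trans
        (mul_le_mul_of_nonneg_left (hC x) (norm_nonneg _))
    · have : φ x = 0 := image_eq_zero_of_notMem_tsupport fun h => hx (hφR h)
      rw [Set.indicator_of_notMem hx, this]
      simp

end LebesguePoints

/-! ### Weak limits and shrinking sets -/

section Limits

variable {d : ℕ}

lemma norm_rescale (x₀ : E d) {r : ℝ} (hr : 0 < r) (g : L2v d) :
    ‖rescale x₀ r g‖ = Real.sqrt (r ^ d)⁻¹ * ‖g‖ := by
  refine (sq_eq_sq₀ (norm_nonneg _) (by positivity)).1 ?_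
  rw [norm_rescale_sq x₀ hr, mul_pow, Real.sq_sqrt (by positivity)]

/-- The set of vectors tested against which a bounded family tends to zero is closed. -/
lemma isClosed_tendsto_inner_zero {H ι : Type*} [NormedAddCommGroup H] [InnerProductSpace ℝ H]
    {l : Filter ι} {k : ι → H} {M : ℝ} (hk : ∀ᶠ i in l, ‖k i‖ ≤ M) :
    IsClosed {m : H | Tendsto (fun i => inner ℝ m (k i)) l (𝓝 0)} := by
  rw [← closure_subset_iff_isClosed]
  intro m hm
  rw [Set.mem_ofPred_eq, Metric.tendsto_nhds]
  intro ε hε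
  obtain ⟨m', hm', hmm⟩ := Metric.mem_closure_iff.1 hm (ε / (2 * (|M| + 1))) (by positivity)
  rw [dist_eq_norm] at hmm
  have h1 := (Metric.tendsto_nhds.1 hm') (ε / 2) (by positivity)
  filter_upwards [h1, hk] with i hi hi'
  rw [Real.dist_0_eq_abs] at hi ⊢
  have h2 : inner ℝ m (k i) = inner ℝ (m - m') (k i) + inner ℝ m' (k i) := by
    rw [inner_sub_left]; ring
  have h3 : |inner ℝ (m - m') (k i)| ≤ ε / 2 := by
    calc _ ≤ ‖m - m'‖ * ‖k i‖ := abs_real_inner_le_norm _ _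
      _ ≤ ε / (2 * (|M| + 1)) * (|M| + 1) := by
        refine mul_le_mul hmm.le ?_ (norm_nonneg _) (by positivity)
        linarith [le_abs_self M]
      _ = ε / 2 := by field_simp
  rw [h2]
  exact (abs_add_le _ _).trans_lt (by linarith)

lemma tendsto_inner_zero_of_bounded {H ι : Type*} [NormedAddCommGroup H] [InnerProductSpace ℝ H]
    {l : Filter ι} {g k : ι → H} {M : ℝ} (hg : Tendsto g l (𝓝 0)) (hk : ∀ᶠ i in l, ‖k i‖ ≤ M) :
    Tendsto (fun i => inner ℝ (g i) (k i)) l (𝓝 0) := by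
  have h1 : Tendsto (fun i => ‖g i‖ * |M|) l (𝓝 0) := by
    simpa using hg.norm.mul_const |M|
  refine squeeze_zero_norm' ?_ h1
  filter_upwards [hk] with i hi
  exact (norm_inner_le_norm _ _).trans
    (mul_le_mul_of_nonneg_left (hi.trans (le_abs_self M)) (norm_nonneg _))

lemma tendsto_volume_image_add_smul (hd : 0 < d) (x₀ : E d) {ω : Set (E d)}
    (hωb : Bornology.IsBounded ω) :
    Tendsto (fun r : ℝ => volume ((fun z => x₀ + r • z) '' ω)) (𝓝[>] 0) (𝓝 0) := by
  obtain ⟨R, hR, hωR⟩ := hωb.subset_closedBall_lt 0 0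
  have h1 : Tendsto (fun r : ℝ => ENNReal.ofReal ((r * R) ^ d) *
      volume (Metric.ball (0 : E d) 1)) (𝓝[>] 0) (𝓝 0) := by
    have hc : Continuous fun r : ℝ => (r * R) ^ d := by fun_prop
    have h2 := (ENNReal.tendsto_ofReal (hc.tendsto 0)).mono_left
      (nhdsWithin_le_nhds (s := Set.Ioi (0 : ℝ)))
    have h3 := ENNReal.Tendsto.mul_const (b := volume (Metric.ball (0 : E d) 1)) h2
      (Or.inr measure_ball_lt_top.ne)
    simpa [hd.ne'] using h3
  refine tendsto_of_tendsto_of_tendsto_of_le_of_le' tendsto_const_nhds h1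
    (Eventually.of_forall fun _ => zero_le) ?_
  filter_upwards [self_mem_nhdsWithin] with r hr
  have hr : 0 < r := hr
  have h2 := Measure.addHaar_closedBall volume x₀ (show 0 ≤ r * R by positivity)
  rw [finrank_euclideanSpace_fin] at h2
  rw [← h2]
  refine measure_mono ?_
  rintro _ ⟨z, hz, rfl⟩
  exact (add_smul_mem_closedBall_iff x₀ hr z).2 (hωR hz)

/-- Absolute continuity of the integral of |g|² on sets of vanishing measure. -/
lemma tendsto_norm_indicatorOp_image (hd : 0 < d) (x₀ : E d) {ω : Set (E d)} (hω : IsOpen ω)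
    (hωb : Bornology.IsBounded ω) (g : L2v d) :
    Tendsto (fun r : ℝ => ‖indicatorOp ((fun z => x₀ + r • z) '' ω) g‖) (𝓝[>] 0) (𝓝 0) := by
  have hfin : ∫⁻ x, ‖g x‖ₑ ^ 2 ≠ ∞ := by
    rw [← Lp_two_enorm_sq]; exact ENNReal.pow_ne_top enorm_ne_top
  have h1 := tendsto_setLIntegral_zero hfin (tendsto_volume_image_add_smul hd x₀ hωb)
  have h2 := ((ENNReal.tendsto_toReal ENNReal.zero_ne_top).comp h1).sqrt
  rw [ENNReal.toReal_zero, Real.sqrt_zero] at h2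
  refine h2.congr' ?_
  filter_upwards [self_mem_nhdsWithin] with r hr
  have hr : 0 < r := hr
  have hm := (isOpen_image_add_smul x₀ hr hω).measurableSet
  have h3 : ∫⁻ x in (fun z => x₀ + r • z) '' ω, ‖g x‖ₑ ^ 2 =
      ‖indicatorOp ((fun z => x₀ + r • z) '' ω) g‖ₑ ^ 2 := by
    rw [Lp_two_enorm_sq, ← lintegral_indicator hm]
    refine lintegral_congr_ae ?_
    filter_upwards [indicatorOp_coeFn hm g] with x hx
    rw [hx]
    by_cases hx' : x ∈ (fun z => x₀ + r • z) '' ω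
    · rw [Set.indicator_of_mem hx', Set.indicator_of_mem hx']
    · rw [Set.indicator_of_notMem hx', Set.indicator_of_notMem hx']; simp
  rw [Function.comp_apply, h3, ENNReal.toReal_pow, toReal_enorm, Real.sqrt_sq (norm_nonneg _)]

end Limits

/-! ### Equations for the differences of states and of adjoint states -/

section Perturbation

variable {d : ℕ} {Ω : Opens (E d)} {α : ℝ} {T B : L2v d →L[ℝ] L2v d} {s : Set (E d)}

lemma perturbOp_apply' (g : L2v d) :
    perturbOp s T B g = T g - indicatorOp s ((T - B) g) := by
  rw [perturbOp_apply, _root_.sub_apply, map_sub, map_sub]; abel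

/-- Subtracting the equations cancels `F` and leaves a source supported on the perturbed set. -/
lemma IsWeakSol.inner_perturbOp_sub {F : L2 d} {w W : L2Pair d} (hw : IsWeakSol Ω T F w)
    (hW : IsWeakSol Ω (perturbOp s T B) F W) {v : L2Pair d} (hv : v ∈ sobolevZero Ω) :
    inner ℝ (perturbOp s T B (W - w).snd) v.snd =
      inner ℝ (indicatorOp s ((T - B) w.snd)) v.snd := by
  have e : (W - w).snd = W.snd - w.snd := rfl
  rw [e, map_sub, inner_sub_left, hW.2 v hv, ← hw.2 v hv, perturbOp_apply', inner_sub_left]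
  ring

lemma IsWeakSol.inner_perturbOp_adjoint_sub {F : L2 d} {p P : L2Pair d}
    (hp : IsWeakSol Ω T.adjoint F p) (hP : IsWeakSol Ω (perturbOp s T B).adjoint F P)
    {v : L2Pair d} (hv : v ∈ sobolevZero Ω) :
    inner ℝ (perturbOp s T B v.snd) (P - p).snd =
      inner ℝ (indicatorOp s ((T - B) v.snd)) p.snd := by
  have e : (P - p).snd = P.snd - p.snd := rfl
  have h1 := hP.2 v hv
  have h2 := hp.2 v hv
  rw [ContinuousLinearMap.adjoint_inner_left, real_inner_comm] at h1 h2
  rw [e, inner_sub_right, h1, ← h2, perturbOp_apply', inner_sub_left]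
  ring

lemma IsCoefficientOp.norm_le_of_inner_le (hα : 0 < α) (hT : IsCoefficientOp α T) {z : L2v d}
    {c : ℝ} (hc : 0 ≤ c) (h : inner ℝ (T z) z ≤ c * ‖z‖) : ‖z‖ ≤ α⁻¹ * c := by
  rw [inv_mul_eq_div, le_div_iff₀ hα]
  have h1 := (hT.coercive z).trans h
  rcases (norm_nonneg z).eq_or_lt with hz | hz
  · rw [← hz, zero_mul]; exact hc
  · nlinarith

end Perturbation

/-! ### Asymptotic expansion of the cost -/

section Asymptotics

/-- The operator on `L²` induced by a constant coefficient. -/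
abbrev constOp {d : ℕ} (b : E d →L[ℝ] E d) : L2v d →L[ℝ] L2v d :=
  b.compLpL 2 (volume : Measure (E d))

variable {d : ℕ} {Ω : Opens (E d)} {α : ℝ} {T B : L2v d →L[ℝ] L2v d} {s : Set (E d)}

/-- Energy estimate: test the difference equation with W - w itself. Its source lives on s, which
yields the order r^{d/2} after rescaling. -/
lemma norm_state_sub_le (hα : 0 < α) (hT : IsCoefficientOp α T) (hB : IsCoefficientOp α B)
    (hs : MeasurableSet s) {F : L2 d} {w W : L2Pair d} (hw : IsWeakSol Ω T F w)
    (hW : IsWeakSol Ω (perturbOp s T B) F W) :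
    ‖(W - w).snd‖ ≤ α⁻¹ * ‖indicatorOp s ((T - B) w.snd)‖ := by
  refine (hT.perturb hB hs).norm_le_of_inner_le hα (norm_nonneg _) ?_
  rw [hw.inner_perturbOp_sub hW (Submodule.sub_mem _ hW.1 hw.1)]
  exact real_inner_le_norm _ _

lemma norm_adjoint_sub_le (hα : 0 < α) (hT : IsCoefficientOp α T) (hB : IsCoefficientOp α B)
    (hs : MeasurableSet s) {F : L2 d} {p P : L2Pair d} (hp : IsWeakSol Ω T.adjoint F p)
    (hP : IsWeakSol Ω (perturbOp s T B).adjoint F P) :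
    ‖(P - p).snd‖ ≤ α⁻¹ * (‖T - B‖ * ‖indicatorOp s p.snd‖) := by
  refine (hT.perturb hB hs).norm_le_of_inner_le hα (by positivity) ?_
  rw [hp.inner_perturbOp_adjoint_sub hP (Submodule.sub_mem _ hP.1 hp.1),
    inner_indicatorOp_left hs]
  refine (real_inner_le_norm _ _).trans ?_
  rw [mul_right_comm]
  exact mul_le_mul_of_nonneg_right ((T - B).le_opNorm _) (norm_nonneg _)

/-- Expansion of the quadratic cost in terms of the perturbed adjoint state. -/
lemma cost_sub_eq {F M Y : L2 d} {w W P : L2Pair d} (hw : IsWeakSol Ω T F w)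
    (hW : IsWeakSol Ω (perturbOp s T B) F W) (hP : IsWeakSol Ω (perturbOp s T B).adjoint M P)
    (hM : M = w.fst - Y) :
    1 / 2 * ‖W.fst - Y‖ ^ 2 - 1 / 2 * ‖w.fst - Y‖ ^ 2 =
      inner ℝ (indicatorOp s ((T - B) w.snd)) P.snd + 1 / 2 * ‖(W - w).fst‖ ^ 2 := by
  have hmem : W - w ∈ sobolevZero Ω := Submodule.sub_mem _ hW.1 hw.1
  -- Testing the perturbed adjoint equation with W - w replaces the linear term ⟨w - Y, W - w⟩ of
  -- the expansion by a pairing on s, without remainder.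
  have h1 := hP.2 _ hmem
  rw [ContinuousLinearMap.adjoint_inner_left, real_inner_comm,
    hw.inner_perturbOp_sub hW hP.1, hM] at h1
  have e : W.fst - Y = (w.fst - Y) + (W - w).fst := by
    have : (W - w).fst = W.fst - w.fst := rfl
    rw [this]; abel
  rw [h1, e, @norm_add_sq_real]
  ring

variable {x₀ : E d} {ω : Set (E d)}

lemma norm_rescale_le_of_norm_le {r : ℝ} (hr : 0 < r) (hω : IsOpen ω) {z g : L2v d} {c : ℝ}
    (h : ‖z‖ ≤ c * ‖indicatorOp ((fun z => x₀ + r • z) '' ω) g‖) :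
    ‖rescale x₀ r z‖ ≤ c * ‖indicatorOp ω (rescale x₀ r g)‖ := by
  rw [← rescale_indicatorOp x₀ hr hω, norm_rescale x₀ hr, norm_rescale x₀ hr, mul_left_comm]
  exact mul_le_mul_of_nonneg_left h (Real.sqrt_nonneg _)

lemma Filter.Tendsto.eventually_norm_le {H ι : Type*} [NormedAddCommGroup H] {l : Filter ι}
    {f : ι → H} {a : H} (h : Tendsto f l (𝓝 a)) : ∀ᶠ i in l, ‖f i‖ ≤ ‖a‖ + 1 :=
  (h.norm.eventually_lt_const (lt_add_one _)).mono fun _ => le_of_lt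

/-- The states converge in `L²` faster than the energy scale `r^{d/2}`. -/
lemma tendsto_norm_state_sub_sq_div (hd : 0 < d) (hΩ : Bornology.IsBounded (Ω : Set (E d)))
    (hα : 0 < α) (hT : IsCoefficientOp α T) (hB : IsCoefficientOp α B) (hω : IsOpen ω)
    (hωb : Bornology.IsBounded ω) {F : L2 d} {w : L2Pair d} (hw : IsWeakSol Ω T F w)
    {W : ℝ → L2Pair d}
    (hW : ∀ r, 0 < r → IsWeakSol Ω (perturbOp ((fun z => x₀ + r • z) '' ω) T B) F (W r))
    (hx₀ : IsLebesguePoint ((T - B) w.snd) x₀) :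
    Tendsto (fun r : ℝ => (r ^ d)⁻¹ * ‖(W r - w).fst‖ ^ 2) (𝓝[>] 0) (𝓝 0) := by
  have hlim := hx₀.tendsto_rescale hω.measurableSet hωb
  set u := (T - B) w.snd
  set c₀ : L2v d := indicatorConstLp 2 hω.measurableSet hωb.measure_lt_top.ne (u x₀)
  have hz : ∀ r, 0 < r → ‖rescale x₀ r (W r - w).snd‖ ≤
      α⁻¹ * ‖indicatorOp ω (rescale x₀ r u)‖ := fun r hr =>
    norm_rescale_le_of_norm_le hr hω (norm_state_sub_le hα hT hB
      (isOpen_image_add_smul x₀ hr hω).measurableSet hw (hW r hr))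
  have hbd : ∀ᶠ r in 𝓝[>] (0 : ℝ), ‖rescale x₀ r (W r - w).snd‖ ≤ α⁻¹ * (‖c₀‖ + 1) := by
    filter_upwards [hlim.eventually_norm_le, self_mem_nhdsWithin] with r h1 h2
    exact (hz r h2).trans (mul_le_mul_of_nonneg_left h1 (by positivity))
  -- Rellich is applied to r^{-d/2}(W_r - w), whose gradients have the norm of the rescaled ones and
  -- are thus bounded.
  have key := tendsto_norm_fst_of_tendsto_inner hd hΩ (l := 𝓝[>] (0 : ℝ))
    (w := fun r => Real.sqrt (r ^ d)⁻¹ • (W r - w)) (M := α⁻¹ * (‖c₀‖ + 1)) ?_ ?_ ?_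
  · have h2 := key.pow 2
    rw [zero_pow two_ne_zero] at h2
    refine h2.congr' ?_
    filter_upwards [self_mem_nhdsWithin] with r hr
    have hr : 0 < r := hr
    have e : (Real.sqrt (r ^ d)⁻¹ • (W r - w)).fst = Real.sqrt (r ^ d)⁻¹ • (W r - w).fst := rfl
    rw [e, norm_smul, mul_pow, Real.norm_of_nonneg (Real.sqrt_nonneg _),
      Real.sq_sqrt (by positivity)]
  · filter_upwards [self_mem_nhdsWithin] with r hr
    exact Submodule.smul_mem _ _ (Submodule.sub_mem _ (hW r hr).1 hw.1)
  · filter_upwards [self_mem_nhdsWithin, hbd] with r hr h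
    have e : (Real.sqrt (r ^ d)⁻¹ • (W r - w)).snd = Real.sqrt (r ^ d)⁻¹ • (W r - w).snd := rfl
    rwa [e, norm_smul, Real.norm_of_nonneg (Real.sqrt_nonneg _), ← norm_rescale x₀ hr]
  · intro m
    -- With the dual solution ψ for m, the pairing ⟨m, W_r - w⟩ only sees ∇ψ on the shrinking set,
    -- whose L² norm there tends to zero.
    obtain ⟨ψ, hψ⟩ := exists_isWeakSol hd hΩ hα hT.adjoint m
    have h0 : Tendsto (fun r : ℝ => (‖c₀‖ + 1 + ‖T - B‖ * (α⁻¹ * (‖c₀‖ + 1))) *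
        ‖indicatorOp ((fun z => x₀ + r • z) '' ω) ψ.snd‖) (𝓝[>] 0) (𝓝 0) := by
      simpa using (tendsto_norm_indicatorOp_image hd x₀ hω hωb ψ.snd).const_mul
        (‖c₀‖ + 1 + ‖T - B‖ * (α⁻¹ * (‖c₀‖ + 1)))
    refine squeeze_zero_norm' ?_ h0
    filter_upwards [self_mem_nhdsWithin, hbd, hlim.eventually_norm_le] with r hr h1 h2
    have hr : 0 < r := hr
    have hs := (isOpen_image_add_smul x₀ hr hω).measurableSet
    have hmem : W r - w ∈ sobolevZero Ω := Submodule.sub_mem _ (hW r hr).1 hw.1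
    have e : (Real.sqrt (r ^ d)⁻¹ • (W r - w)).fst = Real.sqrt (r ^ d)⁻¹ • (W r - w).fst := rfl
    have e2 : inner ℝ m (W r - w).fst =
        inner ℝ (indicatorOp ((fun z => x₀ + r • z) '' ω) u +
          indicatorOp ((fun z => x₀ + r • z) '' ω) ((T - B) (W r - w).snd)) ψ.snd := by
      have h3 := hw.inner_perturbOp_sub (hW r hr) hψ.1
      have h4 := hψ.2 _ hmem
      rw [ContinuousLinearMap.adjoint_inner_left, real_inner_comm] at h4
      rw [perturbOp_apply', inner_sub_left, h4] at h3
      rw [inner_add_left, ← h3]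
      ring
    have e3 : ‖inner ℝ m (W r - w).fst‖ ≤ (‖indicatorOp ((fun z => x₀ + r • z) '' ω) u‖ +
        ‖T - B‖ * ‖(W r - w).snd‖) * ‖indicatorOp ((fun z => x₀ + r • z) '' ω) ψ.snd‖ := by
      rw [e2, ← map_add, ← indicatorOp_idem hs, inner_indicatorOp_left hs]
      refine (norm_inner_le_norm _ _).trans (mul_le_mul_of_nonneg_right ?_ (norm_nonneg _))
      rw [map_add]
      refine (norm_add_le _ _).trans (add_le_add le_rfl ?_)
      exact (norm_indicatorOp_le hs _).trans ((T - B).le_opNorm _)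
    rw [e, inner_smul_right, norm_mul, Real.norm_of_nonneg (Real.sqrt_nonneg _)]
    refine (mul_le_mul_of_nonneg_left e3 (Real.sqrt_nonneg _)).trans ?_
    rw [← mul_assoc]
    refine mul_le_mul_of_nonneg_right ?_ (norm_nonneg _)
    rw [mul_add, mul_left_comm, ← norm_rescale x₀ hr, ← norm_rescale x₀ hr,
      rescale_indicatorOp x₀ hr hω]
    exact add_le_add h2 (mul_le_mul_of_nonneg_left h1 (norm_nonneg _))

/-- The rescaled differences of the adjoint states converge weakly to the corrector. -/
lemma tendsto_inner_rescale_adjoint_sub (hα : 0 < α) (hT : IsCoefficientOp α T)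
    {A : E d → E d →L[ℝ] E d} (hAm : MemLp A ∞ volume)
    (hTA : ∀ g, T g =ᵐ[volume] fun x => A x (g x)) {b : E d →L[ℝ] E d}
    (hB : IsCoefficientOp α (constOp b)) (hω : IsOpen ω)
    (hωb : Bornology.IsBounded ω) {M : L2 d} {p : L2Pair d} (hp : IsWeakSol Ω T.adjoint M p)
    {P : ℝ → L2Pair d}
    (hP : ∀ r, 0 < r → IsWeakSol Ω (perturbOp ((fun z => x₀ + r • z) '' ω) T
      (constOp b)).adjoint M (P r))
    (hx₀ : x₀ ∈ Ω) (hpx₀ : IsLebesguePoint p.snd x₀) (hAx₀ : IsLebesguePoint A x₀)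
    {gQ : L2v d}
    (hQ : ∀ v ∈ gradientClosure d,
      inner ℝ (perturbOp ω (constOp (A x₀)) (constOp b) v) gQ =
        inner ℝ (constOp (A x₀) v - constOp b v)
          (indicatorConstLp 2 hω.measurableSet hωb.measure_lt_top.ne (p.snd x₀)))
    {ψ : L2v d} (hψ : ψ ∈ gradientClosure d) :
    Tendsto (fun r => inner ℝ
      (perturbOp ω (constOp (A x₀)) (constOp b) ψ)
      (rescale x₀ r (P r - p).snd - gQ)) (𝓝[>] 0) (𝓝 0) := by
  set B := constOp b with hBdef
  set A₀ := constOp (A x₀) with hA₀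
  have hlim := hpx₀.tendsto_rescale hω.measurableSet hωb
  set c₀ : L2v d := indicatorConstLp 2 hω.measurableSet hωb.measure_lt_top.ne (p.snd x₀)
  have hbd : ∀ᶠ r in 𝓝[>] (0 : ℝ), ‖rescale x₀ r (P r - p).snd‖ ≤
      α⁻¹ * ‖T - B‖ * (‖c₀‖ + 1) := by
    filter_upwards [hlim.eventually_norm_le, self_mem_nhdsWithin] with r h1 hr
    have hr : 0 < r := hr
    refine (norm_rescale_le_of_norm_le hr hω ((norm_adjoint_sub_le hα hT hB
      (isOpen_image_add_smul x₀ hr hω).measurableSet hp (hP r hr)).trans_eq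
        (mul_assoc _ _ _).symm)).trans (mul_le_mul_of_nonneg_left h1 (by positivity))
  have hbd' : ∀ᶠ r in 𝓝[>] (0 : ℝ), ‖rescale x₀ r (P r - p).snd - gQ‖ ≤
      α⁻¹ * ‖T - B‖ * (‖c₀‖ + 1) + ‖gQ‖ := by
    filter_upwards [hbd] with r hr
    exact (norm_sub_le _ _).trans (by gcongr)
  -- By boundedness of the family, test gradients suffice.
  refine gradientClosure_induction
    (P := fun ψ => Tendsto (fun r => inner ℝ (perturbOp ω A₀ B ψ)
      (rescale x₀ r (P r - p).snd - gQ)) (𝓝[>] 0) (𝓝 0))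
    ((isClosed_tendsto_inner_zero hbd').preimage (perturbOp ω A₀ B).continuous)
    (fun φ => ?_) hψ
  set G := φ.memLp_gradient.toLp (gradient φ) with hG
  obtain ⟨v, hv⟩ := (eventually_exists_rescale_eq hx₀ φ).choice
  have hSv : ∀ᶠ r in 𝓝[>] (0 : ℝ), rescale x₀ r (v r).snd = G := by
    filter_upwards [hv, self_mem_nhdsWithin] with r h hr
    apply Lp.ext
    filter_upwards [h.2, rescale_coeFn x₀ hr (v r).snd, φ.memLp_gradient.coeFn_toLp] with x h1 h2 h3
    rw [h2, h1, h3]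
  set N : ℝ → L2v d := fun r => rescale x₀ r (T (v r).snd) with hN
  -- Freezing the coefficient at x₀: on the fixed support of φ, a(x₀ + r·)∇φ converges strongly to
  -- a(x₀)∇φ.
  have hNlim : Tendsto N (𝓝[>] 0) (𝓝 (A₀ G)) := by
    refine hAx₀.tendsto_mul hAm φ.continuous_gradient φ.hasCompactSupport.gradient
      φ.memLp_gradient.coeFn_toLp ?_
    filter_upwards [hv, self_mem_nhdsWithin] with r h hr
    filter_upwards [h.2, rescale_coeFn x₀ hr (T (v r).snd),
      (quasiMeasurePreserving_add_smul x₀ hr).ae (hTA (v r).snd)] with x h1 h2 h3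
    rw [hN, h2, h3, h1]
  -- The equation for P_r - p, tested with the transplanted φ and divided by r^d. All factors but
  -- the rescaled ∇(P_r - p) converge strongly.
  have hid : ∀ᶠ r in 𝓝[>] (0 : ℝ),
      inner ℝ (N r - indicatorOp ω (N r - B G)) (rescale x₀ r (P r - p).snd) =
        inner ℝ (N r - B G) (indicatorOp ω (rescale x₀ r p.snd)) := by
    filter_upwards [hv, hSv, self_mem_nhdsWithin] with r h h1 hr
    have hr : 0 < r := hr
    have h2 := hp.inner_perturbOp_adjoint_sub (hP r hr) h.1
    have e1 : rescale x₀ r ((T - B) (v r).snd) = N r - B G := by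
      rw [_root_.sub_apply, map_sub, hBdef, rescale_compLpL x₀ hr, h1]
    have e2 : rescale x₀ r (perturbOp ((fun z => x₀ + r • z) '' ω) T B (v r).snd) =
        N r - indicatorOp ω (N r - B G) := by
      rw [perturbOp_apply', map_sub, rescale_indicatorOp x₀ hr hω, e1]
    rw [← e2, inner_rescale x₀ hr, h2, ← inner_rescale x₀ hr, rescale_indicatorOp x₀ hr hω, e1,
      inner_indicatorOp_left hω.measurableSet]
  have hlim1 : Tendsto (fun r => N r - B G) (𝓝[>] 0) (𝓝 (A₀ G - B G)) :=
    hNlim.sub_const _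
  have hlim2 : Tendsto (fun r => N r - indicatorOp ω (N r - B G)) (𝓝[>] 0)
      (𝓝 (perturbOp ω A₀ B G)) := by
    rw [perturbOp_apply', _root_.sub_apply]
    exact hNlim.sub (((indicatorOp ω).continuous.tendsto _).comp hlim1)
  have hlim3 : Tendsto (fun r => inner ℝ
      (perturbOp ω A₀ B G - (N r - indicatorOp ω (N r - B G)))
      (rescale x₀ r (P r - p).snd)) (𝓝[>] 0) (𝓝 0) := by
    refine tendsto_inner_zero_of_bounded ?_ hbd
    simpa using hlim2.const_sub (perturbOp ω A₀ B G)
  have hlim4 := hlim3.add (hlim1.inner hlim)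
  have hlim5 := hlim4.sub_const (inner ℝ (perturbOp ω A₀ B G) gQ)
  rw [hQ G (gradient_mem_gradientClosure φ), zero_add, sub_self] at hlim5
  refine hlim5.congr' ?_
  filter_upwards [hid] with r hr
  rw [← hQ G (gradient_mem_gradientClosure φ), ← hr, inner_sub_left, inner_sub_right]
  ring

/-- The topological derivative of the quadratic cost, in terms of operators on `L²`. -/
theorem tendsto_cost_sub_div (hd : 0 < d) (hΩ : Bornology.IsBounded (Ω : Set (E d)))
    (hα : 0 < α) (hT : IsCoefficientOp α T) {A : E d → E d →L[ℝ] E d} (hAm : MemLp A ∞ volume)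
    (hTA : ∀ g, T g =ᵐ[volume] fun x => A x (g x)) {b : E d →L[ℝ] E d}
    (hB : IsCoefficientOp α (constOp b))
    (hA₀ : IsCoefficientOp α (constOp (A x₀))) (hω : IsOpen ω)
    (hωb : Bornology.IsBounded ω) {F Y : L2 d} {w p : L2Pair d} (hw : IsWeakSol Ω T F w)
    (hp : IsWeakSol Ω T.adjoint (w.fst - Y) p) {W : ℝ → L2Pair d}
    (hW : ∀ r, 0 < r → IsWeakSol Ω (perturbOp ((fun z => x₀ + r • z) '' ω) T
      (constOp b)) F (W r))
    (hx₀ : x₀ ∈ Ω) (hux₀ : IsLebesguePoint ((T - constOp b) w.snd) x₀)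
    (hpx₀ : IsLebesguePoint p.snd x₀) (hAx₀ : IsLebesguePoint A x₀) {gQ : L2v d}
    (hgQ : gQ ∈ gradientClosure d)
    (hQ : ∀ v ∈ gradientClosure d,
      inner ℝ (perturbOp ω (constOp (A x₀)) (constOp b) v) gQ =
        inner ℝ (constOp (A x₀) v - constOp b v)
          (indicatorConstLp 2 hω.measurableSet hωb.measure_lt_top.ne (p.snd x₀))) :
    Tendsto (fun r : ℝ => (r ^ d)⁻¹ *
      (1 / 2 * ‖(W r).fst - Y‖ ^ 2 - 1 / 2 * ‖w.fst - Y‖ ^ 2)) (𝓝[>] 0)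
      (𝓝 (inner ℝ (indicatorConstLp 2 hω.measurableSet hωb.measure_lt_top.ne
        (((T - constOp b) w.snd : L2v d) x₀))
        (indicatorConstLp 2 hω.measurableSet hωb.measure_lt_top.ne (p.snd x₀) + gQ))) := by
  -- These adjoint states take the perturbed coefficient but keep the datum w - Y of the unperturbed
  -- state.
  have hP : ∀ r : ℝ, ∃ P : L2Pair d, 0 < r → IsWeakSol Ω (perturbOp ((fun z => x₀ + r • z) '' ω) T
      (constOp b)).adjoint (w.fst - Y) P := by
    intro r
    by_cases hr : 0 < r
    · obtain ⟨P, hP⟩ := exists_isWeakSol hd hΩ hα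
        (hT.perturb hB (isOpen_image_add_smul x₀ hr hω).measurableSet).adjoint (w.fst - Y)
      exact ⟨P, fun _ => hP⟩
    · exact ⟨0, fun h => absurd h hr⟩
  choose P hP using hP
  have hC := tendsto_norm_state_sub_sq_div hd hΩ hα hT hB hω hωb hw hW hux₀
  have hweak := fun {ψ} (hψ : ψ ∈ gradientClosure d) =>
    tendsto_inner_rescale_adjoint_sub hα hT hAm hTA hB hω hωb hp hP hx₀ hpx₀ hAx₀ hQ hψ
  have hu := hux₀.tendsto_rescale hω.measurableSet hωb
  have hlp := hpx₀.tendsto_rescale hω.measurableSet hωb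
  set B := constOp b
  set A₀ := constOp (A x₀)
  set u := (T - B) w.snd
  set u₀ : L2v d := indicatorConstLp 2 hω.measurableSet hωb.measure_lt_top.ne (u x₀)
  set p₀ : L2v d := indicatorConstLp 2 hω.measurableSet hωb.measure_lt_top.ne (p.snd x₀)
  have hbd : ∀ᶠ r in 𝓝[>] (0 : ℝ), ‖rescale x₀ r (P r - p).snd‖ ≤
      α⁻¹ * ‖T - B‖ * (‖p₀‖ + 1) := by
    filter_upwards [hlp.eventually_norm_le, self_mem_nhdsWithin] with r h1 hr
    have hr : 0 < r := hr
    refine (norm_rescale_le_of_norm_le hr hω ((norm_adjoint_sub_le hα hT hB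
      (isOpen_image_add_smul x₀ hr hω).measurableSet hp (hP r hr)).trans_eq
        (mul_assoc _ _ _).symm)).trans (mul_le_mul_of_nonneg_left h1 (by positivity))
  -- Weak convergence is known only along vectors `perturbOp ω A₀ B ψ`. By Lax-Milgram, u₀ acts on
  -- the gradient closure as such a vector.
  obtain ⟨ψ, hψ, hψu⟩ := exists_inner_apply_left_eq isClosed_gradientClosure
    (perturbOp ω A₀ B) hα
    (fun v _ => (hA₀.perturb hB hω.measurableSet).coercive v) u₀
  have h1 : Tendsto (fun r => inner ℝ u₀ (rescale x₀ r (P r - p).snd)) (𝓝[>] 0)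
      (𝓝 (inner ℝ u₀ gQ)) := by
    have h2 := (hweak hψ).add_const (inner ℝ u₀ gQ)
    rw [zero_add] at h2
    refine h2.congr' ?_
    filter_upwards [self_mem_nhdsWithin] with r hr
    have hm : rescale x₀ r (P r - p).snd ∈ gradientClosure d :=
      rescale_mem_gradientClosure x₀ hr (Submodule.sub_mem _ (hP r hr).1 hp.1)
    rw [hψu _ (Submodule.sub_mem _ hm hgQ), inner_sub_right]
    ring
  have h2 : Tendsto (fun r => inner ℝ (indicatorOp ω (rescale x₀ r u) - u₀)
      (rescale x₀ r (P r - p).snd)) (𝓝[>] 0) (𝓝 0) :=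
    tendsto_inner_zero_of_bounded (by simpa using hu.sub_const u₀) hbd
  -- The pairing of the rescaled flux jump with ∇P splits into the part with ∇p, the strongly
  -- vanishing error of the flux against the bounded corrector, and u₀ against the corrector; the
  -- quadratic remainder is added last.
  have h3 := (((hu.inner hlp).add (h2.add h1)).add (hC.const_mul (1 / 2)))
  rw [mul_zero, add_zero, zero_add, ← inner_add_right] at h3
  refine h3.congr' ?_
  filter_upwards [self_mem_nhdsWithin] with r hr
  have hr : 0 < r := hr
  have e : (P r).snd = p.snd + (P r - p).snd := by
    have : (P r - p).snd = (P r).snd - p.snd := rfl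
    rw [this]; abel
  rw [cost_sub_eq hw (hW r hr) (hP r hr) rfl, mul_add, ← inner_rescale x₀ hr,
    rescale_indicatorOp x₀ hr hω, e, map_add, inner_add_right, inner_sub_left,
    ← inner_indicatorOp_left hω.measurableSet (indicatorOp ω (rescale x₀ r u)),
    indicatorOp_idem hω.measurableSet]
  ring

end Asymptotics

/-! ### The transmission problem -/

section Transmission

variable {d : ℕ} {α : ℝ} {A b : Mat d} {q : E d} {ω : Set (E d)}

/-- The operator on `L²` induced by a constant matrix. -/
abbrev matOp (A : Mat d) : L2v d →L[ℝ] L2v d := constOp (Matrix.toEuclideanCLM (𝕜 := ℝ) A)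

lemma matOp_coeFn (A : Mat d) (g : L2v d) : matOp A g =ᵐ[volume] fun x => act A (g x) :=
  (Matrix.toEuclideanCLM (𝕜 := ℝ) A).coeFn_compLpL g

lemma isCoefficientOp_matOp (hA : A ∈ ellipticMatrices d α) : IsCoefficientOp α (matOp A) :=
  isCoefficientOp_compLpL hA

lemma perturbOp_matOp_coeFn (hω : IsOpen ω) (g : L2v d) :
    perturbOp ω (matOp A) (matOp b) g =ᵐ[volume]
      fun x => act (transmissionCoefficient A b ω x) (g x) := by
  rw [perturbOp_apply]
  filter_upwards [Lp.coeFn_add (matOp A g) (indicatorOp ω (matOp b g - matOp A g)),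
    indicatorOp_coeFn hω.measurableSet (matOp b g - matOp A g),
    Lp.coeFn_sub (matOp b g) (matOp A g), matOp_coeFn A g, matOp_coeFn b g] with x h1 h2 h3 h4 h5
  rw [h1, Pi.add_apply, h2, h4, transmissionCoefficient]
  by_cases hx : x ∈ ω
  · rw [Set.indicator_of_mem hx, if_pos hx, h3, Pi.sub_apply, h4, h5, add_sub_cancel]
  · rw [Set.indicator_of_notMem hx, if_neg hx, add_zero]

lemma integrableOn_of_bounded (hωb : Bornology.IsBounded ω) (g : L2v d) :
    IntegrableOn g ω volume := by
  have : IsFiniteMeasure (volume.restrict ω) := ⟨by simpa using hωb.measure_lt_top⟩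
  exact ((Lp.memLp g).restrict ω).integrable one_le_two

lemma transmission_form_eq (hω : IsOpen ω) (hωb : Bornology.IsBounded ω) {gv gQ : E d → E d}
    {V G : L2v d} (hV : gv =ᵐ[volume] V) (hG : gQ =ᵐ[volume] G) :
    (∫ x, inner ℝ (act (transmissionCoefficient A b ω x) (gv x)) (gQ x)) +
      inner ℝ (act (b - A) (∫ x in ω, gv x)) q =
    inner ℝ (perturbOp ω (matOp A) (matOp b) V) G - inner ℝ (matOp A V - matOp b V)
      (indicatorConstLp 2 hω.measurableSet hωb.measure_lt_top.ne q) := by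
  have h1 : ∫ x, inner ℝ (act (transmissionCoefficient A b ω x) (gv x)) (gQ x) =
      inner ℝ (perturbOp ω (matOp A) (matOp b) V) G := by
    rw [L2.inner_def]
    refine integral_congr_ae ?_
    filter_upwards [hV, hG, perturbOp_matOp_coeFn (A := A) (b := b) hω V] with x h1 h2 h3
    rw [h1, h2, h3]
  have h2 : act (b - A) (∫ x in ω, gv x) = ∫ x in ω, (matOp b V - matOp A V : L2v d) x := by
    have h3 : act (b - A) (∫ x in ω, gv x) =
        ∫ x in ω, (Matrix.toEuclideanCLM (𝕜 := ℝ) (b - A)) (V x) := by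
      rw [integral_congr_ae (ae_restrict_of_ae hV), act_eq]
      exact (ContinuousLinearMap.integral_comp_comm _ (integrableOn_of_bounded hωb V)).symm
    rw [h3]
    refine integral_congr_ae (ae_restrict_of_ae ?_)
    filter_upwards [Lp.coeFn_sub (matOp b V) (matOp A V), matOp_coeFn b V, matOp_coeFn A V]
      with x h4 h5 h6
    rw [h4, Pi.sub_apply, h5, h6, act_eq, act_eq, map_sub, _root_.sub_apply]
  rw [h1, h2, ← neg_sub (matOp b V), inner_neg_left, sub_neg_eq_add, real_inner_comm q,
    real_inner_comm _ (matOp b V - matOp A V), L2.inner_indicatorConstLp_eq_inner_setIntegral]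

lemma IsTransmissionSolution.exists_mem_gradientClosure (hd : 0 < d) (hω : IsOpen ω)
    (hωb : Bornology.IsBounded ω) {Q : E d → ℝ} {gQ : E d → E d}
    (h : IsTransmissionSolution A b q ω Q gQ) :
    ∃ G ∈ gradientClosure d, gQ =ᵐ[volume] G ∧ ∀ v ∈ gradientClosure d,
      inner ℝ (perturbOp ω (matOp A) (matOp b) v) G = inner ℝ (matOp A v - matOp b v)
        (indicatorConstLp 2 hω.measurableSet hωb.measure_lt_top.ne q) := by
  refine ⟨_, h.1.toLp_mem_gradientClosure hd, h.1.2.1.coeFn_toLp.symm, fun v hv => ?_⟩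
  obtain ⟨z, hz⟩ := exists_memHomH1_of_mem_gradientClosure hv
  have h1 := h.2 z v hz
  rw [transmission_form_eq hω hωb .rfl h.1.2.1.coeFn_toLp.symm] at h1
  exact sub_eq_zero.1 h1

/-- Unique solvability of the transmission problem. -/
theorem exists_isTransmissionSolution (hd : 0 < d) (hα : 0 < α) (hA : A ∈ ellipticMatrices d α)
    (hb : b ∈ ellipticMatrices d α) (hω : IsOpen ω) (hωb : Bornology.IsBounded ω) (q : E d) :
    ∃ (Q : E d → ℝ) (G : L2v d), G ∈ gradientClosure d ∧ IsTransmissionSolution A b q ω Q G ∧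
      (∀ v ∈ gradientClosure d,
        inner ℝ (perturbOp ω (matOp A) (matOp b) v) G = inner ℝ (matOp A v - matOp b v)
          (indicatorConstLp 2 hω.measurableSet hωb.measure_lt_top.ne q)) ∧
      ∀ (Q' : E d → ℝ) (gQ' : E d → E d), IsTransmissionSolution A b q ω Q' gQ' →
        gQ' =ᵐ[volume] G ∧ ∃ k : ℝ, Q' =ᵐ[volume] fun x => Q x + k := by
  have hT := (isCoefficientOp_matOp hA).perturb (isCoefficientOp_matOp hb) hω.measurableSet
  -- The unknown ∇Q sits in the second slot of the form, hence the transposed version.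
  obtain ⟨G, hG, hGeq⟩ := exists_inner_apply_right_eq isClosed_gradientClosure
    (perturbOp ω (matOp A) (matOp b)) hα (fun v _ => hT.coercive v)
    ((matOp A - matOp b).adjoint
      (indicatorConstLp 2 hω.measurableSet hωb.measure_lt_top.ne q : L2v d))
  obtain ⟨Q, hQ⟩ := exists_memHomH1_of_mem_gradientClosure hG
  have hGeq' : ∀ v ∈ gradientClosure d,
      inner ℝ (perturbOp ω (matOp A) (matOp b) v) G = inner ℝ (matOp A v - matOp b v)
        (indicatorConstLp 2 hω.measurableSet hωb.measure_lt_top.ne q) := fun v hv => by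
    rw [hGeq v hv, ContinuousLinearMap.adjoint_inner_left, real_inner_comm]; rfl
  refine ⟨Q, G, hG, ⟨hQ, fun v gv hv => ?_⟩, hGeq', fun Q' gQ' h' => ?_⟩
  -- Density of test gradients carries the equation from `gradientClosure` to all of Ḣ¹(ℝ^d).
  · rw [transmission_form_eq hω hωb hv.2.1.coeFn_toLp.symm .rfl, sub_eq_zero]
    exact hGeq' _ (hv.toLp_mem_gradientClosure hd)
  · obtain ⟨G', hG', hgG', hGeq''⟩ := h'.exists_mem_gradientClosure hd hω hωb
    have hmem : G' - G ∈ gradientClosure d := Submodule.sub_mem _ hG' hG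
    have h1 := hT.coercive (G' - G)
    rw [inner_sub_right, hGeq' _ hmem, hGeq'' _ hmem, sub_self] at h1
    have h2 : ‖G' - G‖ = 0 := by
      by_contra hne
      have : 0 < ‖G' - G‖ := lt_of_le_of_ne (norm_nonneg _) (Ne.symm hne)
      have : 0 < α * ‖G' - G‖ ^ 2 := by positivity
      linarith
    have h3 : G' = G := sub_eq_zero.1 (norm_eq_zero.1 h2)
    subst h3
    exact ⟨hgG', hQ.exists_ae_eq_add_const h'.1 hgG'⟩

end Transmission

/-! ### Admissible coefficients and unique solvability -/

section Solvability

variable {d : ℕ} {Ω : Opens (E d)} {α : ℝ} {a : E d → Mat d}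

/-- The operator on `L²` induced by an admissible coefficient. -/
def admissibleOp (ha : a ∈ admissibleCoefficients Ω α) : L2v d →L[ℝ] L2v d :=
  mulOp ((memLp_coefficientExt ha).toLp _)

lemma admissibleOp_coeFn (ha : a ∈ admissibleCoefficients Ω α) (g : L2v d) :
    admissibleOp ha g =ᵐ[volume] fun x => coefficientExt Ω α a x (g x) := by
  filter_upwards [mulOp_coeFn ((memLp_coefficientExt ha).toLp _) g,
    (memLp_coefficientExt ha).coeFn_toLp] with x h1 h2
  rw [admissibleOp, h1, h2]

lemma isCoefficientOp_admissibleOp (ha : a ∈ admissibleCoefficients Ω α) :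
    IsCoefficientOp α (admissibleOp ha) :=
  .of_coeFn (admissibleOp_coeFn ha) (coefficientExt_coercive ha)

lemma represents_admissibleOp (ha : a ∈ admissibleCoefficients Ω α) :
    Represents Ω (admissibleOp ha) a := by
  intro g
  filter_upwards [admissibleOp_coeFn ha g] with x hx hx'
  rw [hx, coefficientExt_of_mem hx', act_eq]

theorem exists_isState (hd : 0 < d) (hΩb : Bornology.IsBounded (Ω : Set (E d))) (hα : 0 < α)
    {f : E d → ℝ} (hf : MemLp f 2 (volume.restrict (Ω : Set (E d))))
    (ha : a ∈ admissibleCoefficients Ω α) :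
    ∃ (y : E d → ℝ) (gy : E d → E d), IsState Ω a f y gy ∧
      ∀ (y' : E d → ℝ) (gy' : E d → E d), IsState Ω a f y' gy' →
        y' =ᵐ[volume.restrict (Ω : Set (E d))] y ∧
        gy' =ᵐ[volume.restrict (Ω : Set (E d))] gy := by
  have hT := isCoefficientOp_admissibleOp ha
  obtain ⟨w, hw⟩ := exists_isWeakSol hd hΩb hα hT ((memLp_indicator_of_restrict hf).toLp _)
  refine ⟨w.fst, w.snd, (isState_iff (represents_admissibleOp ha) hf).2 ⟨w, hw, .rfl, .rfl⟩,
    fun y' gy' h' => ?_⟩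
  obtain ⟨w', hw', h1, h2⟩ := (isState_iff (represents_admissibleOp ha) hf).1 h'
  obtain rfl := hw.unique hd hΩb hα hT hw'
  exact ⟨h1, h2⟩

theorem exists_isAdjoint (hd : 0 < d) (hΩb : Bornology.IsBounded (Ω : Set (E d))) (hα : 0 < α)
    {y yd : E d → ℝ} (hy : MemLp (y - yd) 2 (volume.restrict (Ω : Set (E d))))
    (ha : a ∈ admissibleCoefficients Ω α) :
    ∃ (p : E d → ℝ) (gp : E d → E d), IsAdjoint Ω a y yd p gp ∧
      ∀ (p' : E d → ℝ) (gp' : E d → E d), IsAdjoint Ω a y yd p' gp' →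
        p' =ᵐ[volume.restrict (Ω : Set (E d))] p ∧
        gp' =ᵐ[volume.restrict (Ω : Set (E d))] gp := by
  have hT := (isCoefficientOp_admissibleOp ha).adjoint
  obtain ⟨w, hw⟩ := exists_isWeakSol hd hΩb hα hT ((memLp_indicator_of_restrict hy).toLp _)
  refine ⟨w.fst, w.snd, (isAdjoint_iff (represents_admissibleOp ha) hy).2 ⟨w, hw, .rfl, .rfl⟩,
    fun y' gy' h' => ?_⟩
  obtain ⟨w', hw', h1, h2⟩ := (isAdjoint_iff (represents_admissibleOp ha) hy).1 h'
  obtain rfl := hw.unique hd hΩb hα hT hw'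
  exact ⟨h1, h2⟩

lemma toLp_indicator_sub {y yd : E d → ℝ} (hy : MemLp (y - yd) 2 (volume.restrict (Ω : Set (E d))))
    (hyd : MemLp yd 2 (volume.restrict (Ω : Set (E d)))) {w : L2Pair d} (hw : w ∈ sobolevZero Ω)
    (hyw : y =ᵐ[volume.restrict (Ω : Set (E d))] w.fst) :
    (memLp_indicator_of_restrict hy).toLp _ =
      w.fst - (memLp_indicator_of_restrict hyd).toLp _ := by
  apply Lp.ext
  filter_upwards [(memLp_indicator_of_restrict hy).coeFn_toLp,
    (memLp_indicator_of_restrict hyd).coeFn_toLp, sobolevZero_fst_eq_zero hw,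
    Lp.coeFn_sub w.fst ((memLp_indicator_of_restrict hyd).toLp _),
    (ae_restrict_iff' Ω.isOpen.measurableSet).1 hyw] with x h1 h2 h3 h4 h5
  rw [h1, h4, Pi.sub_apply, h2]
  by_cases hx : x ∈ (Ω : Set (E d))
  · rw [Set.indicator_of_mem hx, Set.indicator_of_mem hx, Pi.sub_apply, h5 hx]
  · rw [Set.indicator_of_notMem hx, Set.indicator_of_notMem hx, h3 hx, sub_zero]

end Solvability

end

/-! ### The topological derivative -/

theorem mainTheorem1 {d : ℕ} (hd : 0 < d)
    (Ω : Opens (E d)) (hΩ : IsConnected (Ω : Set (E d)))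
    (hΩb : Bornology.IsBounded (Ω : Set (E d)))
    {α : ℝ} (hα : 0 < α) (f yd : E d → ℝ)
    (hf : MemLp f 2 (volume.restrict (Ω : Set (E d))))
    (hyd : MemLp yd 2 (volume.restrict (Ω : Set (E d))))
    (a : E d → Mat d) (ha : a ∈ admissibleCoefficients Ω α)
    (ω : Set (E d)) (hω : IsOpen ω) (hωb : Bornology.IsBounded ω) (hω0 : (0 : E d) ∈ ω)
    (b : Mat d) (hb : b ∈ ellipticMatrices d α) :
    -- the state equation is uniquely solvable, so that the cost is well defined
    (∀ c ∈ admissibleCoefficients Ω α, ∃ (y : E d → ℝ) (gy : E d → E d), IsState Ω c f y gy ∧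
      ∀ (y' : E d → ℝ) (gy' : E d → E d), IsState Ω c f y' gy' →
        y' =ᵐ[volume.restrict (Ω : Set (E d))] y ∧
        gy' =ᵐ[volume.restrict (Ω : Set (E d))] gy) ∧
    ∀ (y : E d → ℝ) (gy : E d → E d), IsState Ω a f y gy →
      -- the adjoint equation is uniquely solvable
      (∃ (p : E d → ℝ) (gp : E d → E d), IsAdjoint Ω a y yd p gp ∧
        ∀ (p' : E d → ℝ) (gp' : E d → E d), IsAdjoint Ω a y yd p' gp' →
          p' =ᵐ[volume.restrict (Ω : Set (E d))] p ∧
          gp' =ᵐ[volume.restrict (Ω : Set (E d))] gp) ∧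
      ∀ (p : E d → ℝ) (gp : E d → E d), IsAdjoint Ω a y yd p gp →
        ∀ᵐ x₀ ∂(volume.restrict (Ω : Set (E d))),
          ∃ (Q : E d → ℝ) (gQ : E d → E d),
            IsTransmissionSolution (a x₀) b (gp x₀) ω Q gQ ∧
            -- `Q` is the only solution in `Ḣ¹(ℝ^d)`: it is determined by
            -- `a x₀`, `b`, `gp x₀` and `ω`
            (∀ (Q' : E d → ℝ) (gQ' : E d → E d),
              IsTransmissionSolution (a x₀) b (gp x₀) ω Q' gQ' →
                gQ' =ᵐ[volume] gQ ∧ ∃ k : ℝ, Q' =ᵐ[volume] fun x => Q x + k) ∧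
            Tendsto
              (fun r : ℝ => (cost Ω f yd (perturbedCoefficient a b x₀ ω r) - cost Ω f yd a) /
                (r ^ d * volume.real ω))
              (𝓝[>] 0)
              (𝓝 (-inner ℝ (act (b - a x₀) (gy x₀))
                (gp x₀ + (volume.real ω)⁻¹ • ∫ x in ω, gQ x))) := by
  have hω' := hω.measurableSet
  refine ⟨fun c hc => exists_isState hd hΩb hα hf hc, fun y gy hy => ?_⟩
  have hyy : MemLp (y - yd) 2 (volume.restrict (Ω : Set (E d))) := hy.1.1.1.sub hyd
  refine ⟨exists_isAdjoint hd hΩb hα hyy ha, fun p gp hp => ?_⟩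
  set T := admissibleOp ha
  have hT : IsCoefficientOp α T := isCoefficientOp_admissibleOp ha
  have hTa : Represents Ω T a := represents_admissibleOp ha
  have hB : IsCoefficientOp α (matOp b) := isCoefficientOp_matOp hb
  obtain ⟨w, hw, hyw, hgyw⟩ := (isState_iff hTa hf).1 hy
  obtain ⟨π, hπ, -, hgpπ⟩ := (isAdjoint_iff hTa hyy).1 hp
  rw [toLp_indicator_sub hyy hyd hw.1 hyw] at hπ
  have hL2 : ∀ g : L2v d, ∀ᵐ x₀, IsLebesguePoint g x₀ := fun g =>
    ae_isLebesguePoint fun K _ => (Lp.memLp g).restrict K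
  have hLA : ∀ᵐ x₀, IsLebesguePoint (coefficientExt Ω α a) x₀ :=
    ae_isLebesguePoint fun K hK => by
      have : IsFiniteMeasure (volume.restrict K) := ⟨by simpa using hK.measure_lt_top⟩
      exact ((memLp_coefficientExt ha).restrict K).mono_exponent le_top
  -- Good points are common Lebesgue points of the flux jump (a - b)∇y, of ∇p and of a, at which the
  -- representatives take the expected values. None of these conditions involves b's inclusion shape
  -- ω.
  filter_upwards [ha.2, hgyw, hgpπ, ae_restrict_mem Ω.isOpen.measurableSet,
    ae_restrict_of_ae (hL2 ((T - matOp b) w.snd)), ae_restrict_of_ae (hL2 π.snd),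
    ae_restrict_of_ae hLA, ae_restrict_of_ae (Lp.coeFn_sub (T w.snd) (matOp b w.snd)),
    ae_restrict_of_ae (matOp_coeFn b w.snd), ae_restrict_of_ae (hTa w.snd)]
    with x₀ hax₀ hgy hgp hx₀ hLu hLp hLA hu1 hu2 hu3
  obtain ⟨Q, G, hG, hQ, hGeq, hQu⟩ :=
    exists_isTransmissionSolution hd hα hax₀ hb hω hωb (gp x₀)
  refine ⟨Q, G, hQ, hQu, ?_⟩
  have hAx₀ := coefficientExt_of_mem (α := α) (a := a) hx₀
  have hex : ∀ r : ℝ, ∃ W : L2Pair d, 0 < r → IsWeakSol Ω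
      (perturbOp ((fun z => x₀ + r • z) '' ω) T (matOp b))
      ((memLp_indicator_of_restrict hf).toLp _) W := by
    intro r
    by_cases hr : 0 < r
    · obtain ⟨W, hW⟩ := exists_isWeakSol hd hΩb hα (hT.perturb hB
        (isOpen_image_add_smul x₀ hr hω).measurableSet) ((memLp_indicator_of_restrict hf).toLp _)
      exact ⟨W, fun _ => hW⟩
    · exact ⟨0, fun h => absurd h hr⟩
  choose W hW using hex
  have hlim := tendsto_cost_sub_div (A := coefficientExt Ω α a)
    (b := Matrix.toEuclideanCLM (𝕜 := ℝ) b) hd hΩb hα hT (memLp_coefficientExt ha)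
    (admissibleOp_coeFn ha) hB (by rw [hAx₀]; exact isCoefficientOp_matOp hax₀) hω hωb hw hπ hW
    hx₀ hLu hLp hLA hG (by rw [hAx₀, ← hgp]; exact hGeq)
  have hvol : 0 < volume.real ω :=
    ENNReal.toReal_pos (hω.measure_pos volume ⟨0, hω0⟩).ne' hωb.measure_lt_top.ne
  -- The operator limit is expressed through a - b, which accounts for the minus sign in the
  -- formula.
  have hval : ((T - matOp b) w.snd : L2v d) x₀ = -act (b - a x₀) (gy x₀) := by
    have e : ((T - matOp b) w.snd : L2v d) x₀ = (T w.snd : L2v d) x₀ - (matOp b w.snd : L2v d) x₀ :=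
      hu1
    rw [e, hu2, hu3 hx₀, hgy, act_eq, act_eq, act_eq, map_sub, _root_.sub_apply, neg_sub]
  have hconst := hlim.const_mul (volume.real ω)⁻¹
  have hlimit : (volume.real ω)⁻¹ * inner ℝ
      (indicatorConstLp 2 hω' hωb.measure_lt_top.ne (((T - matOp b) w.snd : L2v d) x₀))
      (indicatorConstLp 2 hω' hωb.measure_lt_top.ne (π.snd x₀) + G) =
      -inner ℝ (act (b - a x₀) (gy x₀)) (gp x₀ + (volume.real ω)⁻¹ • ∫ x in ω, G x) := by
    rw [hval, inner_add_right, L2.inner_indicatorConstLp_eq_inner_setIntegral,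
      L2.inner_indicatorConstLp_eq_inner_setIntegral, setIntegral_indicatorConstLp hω',
      Set.inter_self, ← hgp, inner_neg_left, inner_neg_left, inner_add_right, inner_smul_right,
      inner_smul_right]
    field_simp
    ring
  rw [← hlimit]
  refine hconst.congr' ?_
  filter_upwards [self_mem_nhdsWithin] with r hr
  have hr : 0 < r := hr
  have hs := (isOpen_image_add_smul x₀ hr hω).measurableSet
  rw [cost_eq hd hΩb hα (hT.perturb hB hs) (represents_perturbOp hTa b x₀ ω r hs) hf hyd (hW r hr),
    cost_eq hd hΩb hα hT hTa hf hyd hw]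
  field_simp
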